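/- Let $E/F$ be a finite Galois extension, with group $\Gamma$, of local fields or of global fields (a local field is $\mathbb{R}$, $\mathbb{C}$ or a non-Archimedean local field of any characteristic; a global field is a number field or a finite extension of some $\mathbb{F}_p(t)$). Let $C_K=K^*$ if $K$ is local and $C_K=\mathbb{A}_K^*/K^*$ if $K$ is global, with its usual topology. Let $|\cdot|_F\colon C_F\to\mathbb{R}_{>0}$ be the normalized absolute value: $|a|$ for $F=\mathbb{R}$, $|a|^2$ for $F=\mathbb{C}$, $q_F^{-v_F(a)}$ for $F$ non-Archimedean with residue field of order $q_F$, and the product of the normalized local absolute values over all places for $F$ global. Let $X$ be a free abelian group of finite rank with an action of $\Gamma$ (equivalently, the character lattice of a torus $T$ over $F$ that splits over $E$), and let $$T_{C_F}=\mathrm{Hom}_{\Gamma}(X,C_E),\qquad T^1_{C_F}=\{t\in T_{C_F} : \chi(t)\in C_F \text{ and } |\chi(t)|_F=1\text{ for all }\chi\in X^{\Gamma}\},$$ where $\chi(t)$ denotes the value of $t$ at $\chi$, the group $C_F$ is regarded as a subgroup of $C_E$, and $T_{C_F}$ has the topology of pointwise convergence on $X$ (the subspace topology of the product $C_E^X$).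 For topological groups $A,B$ with $B$ abelian let $\mathrm{Hom}_c(A,B)$ be the group of continuous homomorphisms with the compact-open topology, and let $\widetilde X_T\subseteq \mathrm{Hom}_c(T_{C_F},\mathbb{C}^*)$ be the subgroup of unramified characters, that is, of those that are trivial on $T^1_{C_F}$. Then: 1. inflation along $T_{C_F}\to T_{C_F}/T^1_{C_F}$ is an isomorphism of topological groups from $\mathrm{Hom}_c(T_{C_F}/T^1_{C_F},\mathbb{C}^*)$ onto $\widetilde X_T$; 2. $\widetilde X_T$ is the identity component of $\mathrm{Hom}_c(T_{C_F},\mathbb{C}^*)$; 3. $\widetilde X_T$ is open in $\mathrm{Hom}_c(T_{C_F},\mathbb{C}^*)$; 4. restriction to $T^1_{C_F}$ induces an isomorphism of topological groups $\mathrm{Hom}_c(T_{C_F},\mathbb{C}^*)/\widetilde X_T\to \mathrm{Hom}_c(T^1_{C_F},\mathbb{C}^*)$. -/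

import Mathlib

open NumberField IsDedekindDomain UniformSpace
open scoped NNReal WithZero RestrictedProduct

/-! ## Global fields, their places and completions -/

/-- A global field: a number field, or a finite extension of `𝔽_p(t)` for some prime `p`. -/
class IsGlobalField (K : Type*) [Field K] : Prop where
  out : NumberField K ∨ ∃ (p : ℕ) (_ : Fact p.Prime) (_ : Algebra (RatFunc (ZMod p)) K),
    FiniteDimensional (RatFunc (ZMod p)) K

instance IsGlobalField.finite_infinitePlace (K : Type*) [Field K] [h : IsGlobalField K] :
    Finite (InfinitePlace K) := by
  rcases h.out with h | ⟨p, hp, halg, -⟩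
  · exact Finite.of_fintype _
  · have : IsEmpty (InfinitePlace K) := ⟨fun v ↦ by
      have h0 : (p : RatFunc (ZMod p)) = 0 := by
        rw [← map_natCast (algebraMap (ZMod p) (RatFunc (ZMod p))), CharP.cast_eq_zero, map_zero]
      have h1 : (p : K) = 0 := by
        rw [← map_natCast (algebraMap (RatFunc (ZMod p)) K), h0, map_zero]
      have h2 : (p : ℂ) = 0 := by rw [← map_natCast v.embedding, h1, map_zero]
      exact hp.out.ne_zero (by exact_mod_cast h2)⟩
    infer_instance

/-- A non-Archimedean place of a field `K`, given by its valuation ring: a discrete valuation ring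
with fraction field `K` and finite residue field. (For a number field these are the localizations
of the ring of integers at its nonzero primes; for a global function field they are all places.) -/
@[ext] structure NonarchPlace (K : Type*) [Field K] where
  ring : ValuationSubring K
  isDVR : IsDiscreteValuationRing ring
  finite_residue : Finite (IsLocalRing.ResidueField ring)

namespace NonarchPlace

attribute [instance] NonarchPlace.isDVR NonarchPlace.finite_residue

variable {K L : Type*} [Field K] [Field L]

/-- The maximal ideal of the valuation ring of `v`. -/
abbrev prime (v : NonarchPlace K) : HeightOneSpectrum v.ring :=
  IsDiscreteValuationRing.maximalIdeal v.ring

/-- The completion `K_v`. -/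
abbrev Completion (v : NonarchPlace K) : Type _ := v.prime.adicCompletion K

/-- The ring of integers of `K_v`. -/
noncomputable abbrev Integers (v : NonarchPlace K) : ValuationSubring v.Completion :=
  v.prime.adicCompletionIntegers K

/-- The cardinality `q_v` of the residue field of `v`. -/
noncomputable def q (v : NonarchPlace K) : ℕ := Nat.card (IsLocalRing.ResidueField v.ring)

theorem q_ne_zero (v : NonarchPlace K) : (v.q : ℝ≥0) ≠ 0 :=
  Nat.cast_ne_zero.mpr Nat.card_pos.ne'

/-- The normalized absolute value `x ↦ q_v ^ (-v(x))` on `K_v`. -/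
noncomputable def normAbs (v : NonarchPlace K) : v.Completion →*₀ ℝ≥0 :=
  (WithZeroMulInt.toNNReal v.q_ne_zero).comp
    (Valued.v : Valuation v.Completion ℤᵐ⁰).toMonoidWithZeroHom

theorem valuation_le_one_iff (v : NonarchPlace K) (x : K) :
    v.prime.valuation K x ≤ 1 ↔ x ∈ v.ring := by
  constructor
  · intro h
    obtain ⟨a, rfl⟩ := IsDiscreteValuationRing.exists_lift_of_le_one h
    exact a.2
  · intro h
    exact HeightOneSpectrum.valuation_le_one v.prime (⟨x, h⟩ : v.ring)

theorem valuation_lt_one_iff (v : NonarchPlace K) {x : K} (hx : x ≠ 0) :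
    v.prime.valuation K x < 1 ↔ x⁻¹ ∉ v.ring := by
  rw [← valuation_le_one_iff, map_inv₀, not_le, one_lt_inv₀]
  exact zero_lt_iff.mpr ((Valuation.ne_zero_iff _).mpr hx)

/-- If the valuation ring of `w` contracts to that of `v` along `f : K →+* L`, then `f` is
continuous for the `v`-adic and `w`-adic topologies. -/
theorem continuous_map (f : K →+* L) (v : NonarchPlace K) (w : NonarchPlace L)
    (h : w.ring.comap f = v.ring) :
    Continuous (WithVal.map (v.prime.valuation K) (w.prime.valuation L) f) := by
  have hmem (x : K) : x ∈ v.ring ↔ f x ∈ w.ring := by rw [← h, ValuationSubring.mem_comap]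
  have hlt (x : K) (hx : v.prime.valuation K x < 1) : w.prime.valuation L (f x) < 1 := by
    rcases eq_or_ne x 0 with rfl | hx0
    · simp
    · rw [valuation_lt_one_iff _ ((map_ne_zero f).mpr hx0), ← map_inv₀, ← hmem,
        ← valuation_lt_one_iff _ hx0]
      exact hx
  obtain ⟨π, hπ⟩ := v.prime.valuation_exists_uniformizer K
  have hπ0 : π ≠ 0 := by
    rintro rfl
    rw [map_zero] at hπ
    exact WithZero.coe_ne_zero hπ.symm
  have hπ1 : v.prime.valuation K π < 1 := by
    rw [hπ, ← WithZero.exp_zero]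
    exact WithZero.exp_lt_exp.mpr (by norm_num)
  have hvπ : v.prime.valuation K π ≠ 0 := (Valuation.ne_zero_iff _).mpr hπ0
  have hwπ : w.prime.valuation L (f π) ≠ 0 :=
    (Valuation.ne_zero_iff _).mpr ((map_ne_zero f).mpr hπ0)
  refine continuous_of_continuousAt_zero (WithVal.map _ _ f) ?_
  rw [ContinuousAt, map_zero, Filter.tendsto_def]
  intro s hs
  obtain ⟨γ, hγ⟩ := Valued.mem_nhds_zero.mp hs
  have hγ0 : MonoidWithZeroHom.ValueGroup₀.embedding γ.1 ≠ 0 := by simp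
  obtain ⟨n, hn⟩ := MulArchimedean.arch
    (MonoidWithZeroHom.ValueGroup₀.embedding γ.1 : ℤᵐ⁰)⁻¹
    ((one_lt_inv₀ (zero_lt_iff.mpr hwπ)).mpr (hlt π hπ1))
  rw [inv_pow, inv_le_inv₀ (zero_lt_iff.mpr hγ0) (pow_pos (zero_lt_iff.mpr hwπ) n)] at hn
  rw [Valued.mem_nhds_zero]
  refine ⟨Units.mk0 (Valued.v.restrict (WithVal.toVal (v.prime.valuation K) (π ^ n))) ?_, ?_⟩
  · rw [ne_eq, Valuation.restrict_eq_zero_iff, WithVal.valued_toVal, map_pow]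
    exact pow_ne_zero _ hvπ
  · intro x hx
    apply hγ
    rw [Units.val_mk0, Set.mem_ofPred_eq, Valuation.restrict_lt_iff, WithVal.valued_toVal,
      ← WithVal.apply_ofVal, map_pow] at hx
    rw [Set.mem_ofPred_eq, Valuation.restrict_lt_iff_lt_embedding, WithVal.map_apply,
      WithVal.valued_toVal]
    refine lt_of_lt_of_le ?_ hn
    have hy := hlt (x.ofVal / π ^ n) (by
      rw [map_div₀, map_pow]
      exact (div_lt_one₀ (pow_pos (zero_lt_iff.mpr hvπ) n)).mpr hx)
    rw [map_div₀, map_div₀, map_pow, map_pow] at hy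
    exact (div_lt_one₀ (pow_pos (zero_lt_iff.mpr hwπ) n)).mp hy

/-- The homomorphism of completions `K_v →+* L_w` induced by `f : K →+* L`, when the place `w`
of `L` lies over the place `v` of `K` (along `f`). -/
noncomputable def completionMap (f : K →+* L) (v : NonarchPlace K) (w : NonarchPlace L)
    (h : w.ring.comap f = v.ring) : v.Completion →+* w.Completion :=
  ((HeightOneSpectrum.adicCompletion.equiv L w.prime).symm.toRingHom.comp
    (Completion.mapRingHom _ (continuous_map f v w h))).comp
      (HeightOneSpectrum.adicCompletion.equiv K v.prime).toRingHom

theorem completionMap_coe (f : K →+* L) (v : NonarchPlace K) (w : NonarchPlace L)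
    (h : w.ring.comap f = v.ring) (x : K) :
    completionMap f v w h (x : v.Completion) = (f x : w.Completion) := by
  apply HeightOneSpectrum.adicCompletion.ext
  exact Completion.mapRingHom_coe (continuous_map f v w h) (WithVal.toVal _ x)

theorem completionMap_mem_integers (f : K →+* L) (v : NonarchPlace K) (w : NonarchPlace L)
    (h : w.ring.comap f = v.ring) (x : v.Completion) (hx : x ∈ v.Integers) :
    completionMap f v w h x ∈ w.Integers := by
  obtain ⟨y⟩ := x
  rw [HeightOneSpectrum.mem_adicCompletionIntegers] at hx ⊢
  revert hx
  induction y using Completion.induction_on with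
  | hp =>
    have h1 := Valued.isClopen_integer (v.prime.valuation K).Completion
    have h2 := Valued.isClosed_integer (w.prime.valuation L).Completion
    convert! h1.compl.1.union
      (h2.preimage (Completion.continuous_map (f := WithVal.map _ _ f))) using 1
    ext y
    exact imp_iff_not_or
  | ih y =>
    intro hx
    have hx' : v.prime.valuation K y.ofVal ≤ 1 := by
      rwa [← HeightOneSpectrum.adicCompletion.valued_toCompletion,
        Valued.valuedCompletion_apply, ← WithVal.apply_ofVal] at hx
    have := completionMap_coe f v w h y.ofVal
    refine (congrArg Valued.v this).trans_le ?_
    rw [HeightOneSpectrum.valuedAdicCompletion_eq_valuation', valuation_le_one_iff,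
      ← ValuationSubring.mem_comap, h, ← valuation_le_one_iff]
    exact hx'

/-- `σ` restricts to an isomorphism of `σ⁻¹(A)` with `A`. -/
def comapRingEquiv (σ : K ≃+* L) (A : ValuationSubring L) : A.comap (σ : K →+* L) ≃+* A where
  toFun x := ⟨σ x, x.2⟩
  invFun y := ⟨σ.symm y, by simp [ValuationSubring.mem_comap]⟩
  left_inv x := by simp
  right_inv y := by simp
  map_mul' x y := by ext; simp
  map_add' x y := by ext; simp

/-- The place of `K` corresponding to a place `w` of `L` under an isomorphism `σ : K ≃+* L`. -/
def comapEquiv (σ : K ≃+* L) (w : NonarchPlace L) : NonarchPlace K where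
  ring := w.ring.comap (σ : K →+* L)
  isDVR := IsDiscreteValuationRing.RingEquivClass.isDiscreteValuationRing
    (comapRingEquiv σ w.ring).symm
  finite_residue :=
    Finite.of_equiv _ (IsLocalRing.ResidueField.mapEquiv (comapRingEquiv σ w.ring)).symm.toEquiv

theorem comapEquiv_injective (σ : K ≃+* L) :
    Function.Injective (comapEquiv σ) := by
  intro w w' h
  ext x
  have := congrArg (fun v : NonarchPlace K ↦ σ.symm x ∈ v.ring) h
  simpa [comapEquiv, ValuationSubring.mem_comap] using this

end NonarchPlace

namespace NumberField.InfinitePlace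

variable {K L : Type*} [Field K] [Field L]

theorem isometry_withAbs_map (f : K →+* L) (w : InfinitePlace L) :
    Isometry (((WithAbs.equiv w.1).symm.toRingHom.comp f).comp
      (WithAbs.equiv (w.comap f).1).toRingHom) :=
  AddMonoidHomClass.isometry_of_norm _ fun x ↦ by
    simp [WithAbs.norm_eq_apply_ofAbs]
    rfl

/-- The homomorphism of completions `K_v →+* L_w` induced by `f : K →+* L`, for `w` an infinite
place of `L` and `v` the infinite place of `K` below it. -/
noncomputable def completionMapComap (f : K →+* L) (w : InfinitePlace L) :
    (w.comap f).Completion →+* w.Completion :=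
  ((Completion.equiv w).symm.toRingHom.comp
    (isometry_withAbs_map f w).mapRingHom).comp (Completion.equiv (w.comap f)).toRingHom

theorem completionMapComap_coe (f : K →+* L) (w : InfinitePlace L) (x : K) :
    completionMapComap f w (x : (w.comap f).Completion) = (f x : w.Completion) :=
  Completion.ext ((isometry_withAbs_map f w).mapRingHom_coe (WithAbs.toAbs _ x))

end NumberField.InfinitePlace

/-! ## Adeles, ideles and the idele class group -/

/-- The non-Archimedean part of the adele ring of `K`: the restricted product of the completions
at all non-Archimedean places with respect to their rings of integers. -/
abbrev NonarchAdeles (K : Type*) [Field K] : Type _ :=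
  Πʳ v : NonarchPlace K, [v.Completion, v.Integers]

instance (K : Type*) [Field K] :
    Fact (∀ v : NonarchPlace K, IsOpen (v.Integers : Set v.Completion)) :=
  ⟨fun _ ↦ Valued.isOpen_valuationSubring _⟩

/-- The adele ring of a global field `K`, with its usual topology. (A field of positive
characteristic has no infinite places, and then the first factor is trivial.) -/
def Adeles (K : Type*) [Field K] : Type _ := InfiniteAdeleRing K × NonarchAdeles K

namespace Adeles

variable {K L : Type*} [Field K] [Field L]

noncomputable instance : CommRing (Adeles K) :=
  inferInstanceAs (CommRing (InfiniteAdeleRing K × NonarchAdeles K))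

noncomputable instance : TopologicalSpace (Adeles K) :=
  inferInstanceAs (TopologicalSpace (InfiniteAdeleRing K × NonarchAdeles K))

instance : IsTopologicalRing (Adeles K) :=
  inferInstanceAs (IsTopologicalRing (InfiniteAdeleRing K × NonarchAdeles K))

/-- The component `a ↦ a_v` at an infinite place. -/
noncomputable def infEval (v : InfinitePlace K) : Adeles K →+* v.Completion :=
  (Pi.evalRingHom (fun v : InfinitePlace K ↦ v.Completion) v).comp
    (RingHom.fst (InfiniteAdeleRing K) (NonarchAdeles K))

/-- The component `a ↦ a_v` at a non-Archimedean place. -/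
noncomputable def nonarchEval (v : NonarchPlace K) : Adeles K →+* v.Completion :=
  (RestrictedProduct.evalRingHom (fun v : NonarchPlace K ↦ v.Completion) v).comp
    (RingHom.snd (InfiniteAdeleRing K) (NonarchAdeles K))

/-- The isomorphism `σ` acts on adeles by `(σ a)_w = σ_w (a_v)`, with `v` the place that
corresponds to `w` under `σ` and `σ_w : K_v →+* L_w` induced by `σ`. -/
noncomputable def mapEquiv (σ : K ≃+* L) : Adeles K →+* Adeles L :=
  RingHom.prodMap (R := InfiniteAdeleRing K) (S := NonarchAdeles K)
    (RingHom.pi fun w : InfinitePlace L ↦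
      (w.completionMapComap (σ : K →+* L)).comp
        (Pi.evalRingHom (fun v : InfinitePlace K ↦ v.Completion) (w.comap (σ : K →+* L))))
    (RestrictedProduct.mapAlongRingHom (fun v : NonarchPlace K ↦ v.Completion)
      (fun w : NonarchPlace L ↦ w.Completion) (NonarchPlace.comapEquiv σ)
      (NonarchPlace.comapEquiv_injective σ).tendsto_cofinite
      (fun w ↦ NonarchPlace.completionMap (σ : K →+* L) (NonarchPlace.comapEquiv σ w) w rfl)
      (Filter.Eventually.of_forall fun _ x hx ↦
        NonarchPlace.completionMap_mem_integers _ _ _ _ x hx))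

/-- `b` is the image of `a` under the natural map `𝔸_K → 𝔸_L` attached to `f : K →+* L`:
for each place `w` of `L` over a place `v` of `K`, `b_w` is the image of `a_v` in `L_w`. -/
def IsImage (f : K →+* L) (a : Adeles K) (b : Adeles L) : Prop :=
  (∀ w : InfinitePlace L, infEval w b = w.completionMapComap f (infEval (w.comap f) a)) ∧
  ∀ (v : NonarchPlace K) (w : NonarchPlace L) (h : w.ring.comap f = v.ring),
    nonarchEval w b = NonarchPlace.completionMap f v w h (nonarchEval v a)

end Adeles

/-- The idele group of `K`, with its usual topology (the unit-group topology). -/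
abbrev Ideles (K : Type*) [Field K] : Type _ := (Adeles K)ˣ

namespace Ideles

/-- The subgroup of principal ideles, i.e. the image of `Kˣ` under the diagonal embedding. -/
def principal (K : Type*) [Field K] : Subgroup (Ideles K) where
  carrier := {a | ∃ x : Kˣ,
    (∀ v : InfinitePlace K, Adeles.infEval v a.1 = algebraMap K v.Completion x) ∧
    ∀ v : NonarchPlace K, Adeles.nonarchEval v a.1 = algebraMap K v.Completion x}
  one_mem' := ⟨1, fun v ↦ by simp only [Units.val_one, map_one],
    fun v ↦ by simp only [Units.val_one, map_one]⟩
  mul_mem' := by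
    rintro a b ⟨x, hx, hx'⟩ ⟨y, hy, hy'⟩
    exact ⟨x * y, fun v ↦ by simp only [Units.val_mul, map_mul, hx, hy],
      fun v ↦ by simp only [Units.val_mul, map_mul, hx', hy']⟩
  inv_mem' := by
    rintro a ⟨x, hx, hx'⟩
    exact ⟨x⁻¹, fun v ↦ by rw [map_units_inv, hx, Units.val_inv_eq_inv_val, map_inv₀],
      fun v ↦ by rw [map_units_inv, hx', Units.val_inv_eq_inv_val, map_inv₀]⟩

variable {K : Type*} [Field K]

/-- The idelic absolute value `|a| = ∏_v |a_v|_v`, a product over all places, of normalized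
absolute values (`‖a_v‖` for `v` real, `‖a_v‖ ^ 2` for `v` complex, `q_v ^ (-v(a_v))` for `v`
non-Archimedean). -/
noncomputable def absValue (a : Ideles K) : ℝ :=
  (∏ᶠ v : InfinitePlace K, ‖Adeles.infEval v a.1‖ ^ v.mult) *
    ∏ᶠ v : NonarchPlace K, (v.normAbs (Adeles.nonarchEval v a.1) : ℝ)

theorem finite_mulSupport_normAbs (a : Ideles K) :
    (Function.mulSupport fun v : NonarchPlace K ↦ (v.normAbs (Adeles.nonarchEval v a.1) : ℝ)).Finite := by
  have key (b : Ideles K) : ∀ᶠ v : NonarchPlace K in Filter.cofinite,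
      Valued.v (Adeles.nonarchEval v b.1) ≤ 1 := b.1.2.2
  refine Set.Finite.subset (Filter.eventually_cofinite.mp ((key a).and (key a⁻¹))) ?_
  intro v hv hle
  refine hv ?_
  have h1 : Valued.v (Adeles.nonarchEval v a.1) = 1 := by
    refine le_antisymm hle.1 ?_
    have h2 : Valued.v (Adeles.nonarchEval v a.1) *
        Valued.v (Adeles.nonarchEval v (a⁻¹).1) = 1 := by
      rw [← map_mul, ← map_mul, Units.mul_inv, map_one, map_one]
    rw [← h2]
    exact mul_le_of_le_one_right' hle.2
  have : v.normAbs (Adeles.nonarchEval v a.1) = 1 := by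
    change WithZeroMulInt.toNNReal v.q_ne_zero (Valued.v (Adeles.nonarchEval v a.1)) = 1
    rw [h1, map_one]
  simp [this]

theorem absValue_one : absValue (1 : Ideles K) = 1 := by
  simp [absValue]

theorem absValue_mul [IsGlobalField K] (a b : Ideles K) :
    absValue (a * b) = absValue a * absValue b := by
  simp only [absValue, Units.val_mul, map_mul, norm_mul, mul_pow, NNReal.coe_mul]
  rw [finprod_mul_distrib (Set.toFinite _) (Set.toFinite _),
    finprod_mul_distrib (finite_mulSupport_normAbs a) (finite_mulSupport_normAbs b),
    mul_mul_mul_comm]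

/-- The subgroup of ideles of absolute value `1`. -/
def normOne (K : Type*) [Field K] [IsGlobalField K] : Subgroup (Ideles K) where
  carrier := {a | absValue a = 1}
  one_mem' := absValue_one
  mul_mem' {a b} ha hb := by
    rw [Set.mem_ofPred_eq] at *
    rw [absValue_mul, ha, hb, mul_one]
  inv_mem' {a} ha := by
    have := absValue_mul a a⁻¹
    rw [mul_inv_cancel, absValue_one, Set.mem_ofPred_eq.mp ha, one_mul] at this
    exact this.symm

end Ideles

/-- The idele class group `C_K = 𝔸_Kˣ / Kˣ`, with the quotient topology. -/
def IdeleClassGroup (K : Type*) [Field K] : Type _ := Ideles K ⧸ Ideles.principal K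

namespace IdeleClassGroup

variable {K L : Type*} [Field K] [Field L]

noncomputable instance : CommGroup (IdeleClassGroup K) :=
  inferInstanceAs (CommGroup (Ideles K ⧸ Ideles.principal K))

noncomputable instance : TopologicalSpace (IdeleClassGroup K) :=
  inferInstanceAs (TopologicalSpace (Ideles K ⧸ Ideles.principal K))

instance : IsTopologicalGroup (IdeleClassGroup K) :=
  inferInstanceAs (IsTopologicalGroup (Ideles K ⧸ Ideles.principal K))

/-- The class of an idele. -/
noncomputable def mk : Ideles K →* IdeleClassGroup K := QuotientGroup.mk' (Ideles.principal K)

/-- The action of an isomorphism on idele classes. -/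
noncomputable def mapEquiv (σ : K ≃+* L) : IdeleClassGroup K →* IdeleClassGroup L :=
  QuotientGroup.map _ _ (Units.map (Adeles.mapEquiv σ : Adeles K →* Adeles L)) (by
    rintro a ⟨x, hx, hx'⟩
    refine ⟨Units.map σ x, fun w ↦ ?_, fun w ↦ ?_⟩
    · exact (congrArg _ (hx _)).trans (w.completionMapComap_coe (σ : K →+* L) x)
    · exact (congrArg _ (hx' _)).trans (NonarchPlace.completionMap_coe (σ : K →+* L) _ w rfl x))

/-- The action of the Galois group of `E/F` on `C_E`. -/
noncomputable def galoisAct (F E : Type*) [Field F] [Field E] [Algebra F E] (γ : E ≃ₐ[F] E) :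
    IdeleClassGroup E →* IdeleClassGroup E :=
  mapEquiv (γ : E ≃+* E)

/-- The image in `C_L` of the group `C_K^1` of idele classes of `K` of absolute value `1`, under
the natural map `C_K → C_L` attached to `f : K →+* L`. -/
noncomputable def normOneImage [IsGlobalField K] (f : K →+* L) : Subgroup (IdeleClassGroup L) :=
  Subgroup.map mk
    { carrier := {b : Ideles L | ∃ a ∈ Ideles.normOne K, Adeles.IsImage f a.1 b.1}
      one_mem' := ⟨1, one_mem _, fun w ↦ by simp, fun v w h ↦ by simp⟩
      mul_mem' := by
        rintro b b' ⟨a, ha, h, h'⟩ ⟨c, hc, g, g'⟩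
        exact ⟨a * c, mul_mem ha hc, fun w ↦ by simp only [Units.val_mul, map_mul, h, g],
          fun v w hw ↦ by simp only [Units.val_mul, map_mul, h' v w hw, g' v w hw]⟩
      inv_mem' := by
        rintro b ⟨a, ha, h, h'⟩
        exact ⟨a⁻¹, inv_mem ha,
          fun w ↦ by rw [map_units_inv, map_units_inv, h, map_inv₀],
          fun v w hw ↦ by rw [map_units_inv, map_units_inv, h' v w hw, map_inv₀]⟩ }

end IdeleClassGroup

/-! ## Normalized absolute values on local fields -/

/-- The cardinality of the residue field of a non-Archimedean local field. -/
noncomputable def residueCard (F : Type*) [Field F] [ValuativeRel F] [TopologicalSpace F]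
    [IsNonarchimedeanLocalField F] : ℕ :=
  Nat.card (IsLocalRing.ResidueField (ValuativeRel.valuation F).integer)

theorem residueCard_ne_zero (F : Type*) [Field F] [ValuativeRel F] [TopologicalSpace F]
    [IsNonarchimedeanLocalField F] : (residueCard F : ℝ≥0) ≠ 0 :=
  Nat.cast_ne_zero.mpr Nat.card_pos.ne'

/-- The normalized absolute value `x ↦ q ^ (-v(x))` of a non-Archimedean local field. -/
noncomputable def nonarchLocalAbs (F : Type*) [Field F] [ValuativeRel F] [TopologicalSpace F]
    [IsNonarchimedeanLocalField F] : F →*₀ ℝ≥0 :=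
  (WithZeroMulInt.toNNReal (residueCard_ne_zero F)).comp
    ((MonoidWithZeroHom.ofClass (IsNonarchimedeanLocalField.valueGroupWithZeroIsoInt F)).comp
      (ValuativeRel.valuation F).toMonoidWithZeroHom)

/-- The normalized absolute value of an Archimedean local field: `|x|` for `ℝ`, `|x| ^ 2` for
`ℂ`. -/
noncomputable def archLocalAbs (F : Type*) [RCLike F] : F →*₀ ℝ :=
  (powMonoidWithZeroHom (Module.finrank_pos (R := ℝ) (M := F)).ne').comp normHom

/-- The action of the Galois group of `E/F` on `C_E = Eˣ`. -/
def localGaloisAct (F E : Type*) [Field F] [Field E] [Algebra F E] (γ : E ≃ₐ[F] E) : Eˣ →* Eˣ :=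
  Units.map (γ : E →* E)

/-- For an absolute value on `F`, the image in `Eˣ` of the subgroup of `Fˣ` of elements of absolute
value `1`. -/
noncomputable def localNormOneImage {F M : Type*} (E : Type*) [Field F] [Field E] [Algebra F E]
    [MonoidWithZero M] (abs : F →*₀ M) : Subgroup Eˣ :=
  (Units.map (abs : F →* M)).ker.map (Units.map (algebraMap F E : F →* E))

/-! ## The groups attached to a torus

Let `X` be a lattice with an action of `Γ` (the character lattice of a torus `T`), and `C` an
abelian topological group with an action `act` of `Γ`. -/

section Torus

variable {Γ X C : Type*} [AddCommGroup X] [SMul Γ X] [CommGroup C]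

/-- `Hom_Γ(X, C)`, as a subgroup of the group of all functions `X → C`. As a topological group it
carries the subspace topology of the product topology, i.e. that of pointwise convergence. -/
def torusPoints (X : Type*) [AddCommGroup X] [SMul Γ X] (act : Γ → C →* C) :
    Subgroup (X → C) where
  carrier := {t | (∀ x y, t (x + y) = t x * t y) ∧ ∀ (γ : Γ) (x : X), t (γ • x) = act γ (t x)}
  one_mem' := ⟨fun _ _ ↦ (one_mul 1).symm, fun γ _ ↦ (map_one (act γ)).symm⟩
  mul_mem' {s t} hs ht := ⟨fun x y ↦ by simp only [Pi.mul_apply, hs.1, ht.1, mul_mul_mul_comm],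
    fun γ x ↦ by simp only [Pi.mul_apply, hs.2, ht.2, map_mul]⟩
  inv_mem' {s} hs := ⟨fun x y ↦ by simp only [Pi.inv_apply, hs.1, mul_inv],
    fun γ x ↦ by simp only [Pi.inv_apply, hs.2, map_inv]⟩

/-- The subgroup of all `t ∈ Hom_Γ(X, C)` with `χ(t) = t χ` in `N` for every rational (that is,
`Γ`-invariant) character `χ ∈ X`. For `C = C_E` and `N` the image of `C_F^1` in `C_E`, the condition
says that `χ(t) ∈ C_F` has absolute value `1`, and the subgroup is `T_{C_F}^1`. -/
def torusNormOne (X : Type*) [AddCommGroup X] [SMul Γ X] (act : Γ → C →* C) (N : Subgroup C) :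
    Subgroup (torusPoints X act) where
  carrier := {t | ∀ χ : X, (∀ γ : Γ, γ • χ = χ) → t.1 χ ∈ N}
  one_mem' _ _ := one_mem N
  mul_mem' hs ht χ hχ := mul_mem (hs χ hχ) (ht χ hχ)
  inv_mem' hs χ hχ := inv_mem (hs χ hχ)

end Torus

/-! ## Character groups -/

section Characters

variable {T : Type*} [CommGroup T] [TopologicalSpace T]

/-- The subgroup of `Hom_c(T, ℂˣ)` (with the compact-open topology) of characters that are trivial
on the subgroup `T1` of `T`. -/
def unramifiedCharacters (T1 : Subgroup T) : Subgroup (T →ₜ* ℂˣ) where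
  carrier := {φ | ∀ t ∈ T1, φ t = 1}
  one_mem' _ _ := rfl
  mul_mem' {φ ψ} hφ hψ t ht := by
    rw [ContinuousMonoidHom.mul_apply, hφ t ht, hψ t ht, one_mul]
  inv_mem' {φ} hφ t ht := by
    change (φ t)⁻¹ = 1
    rw [hφ t ht, inv_one]

/-- All character groups carry the compact-open topology. The statement says:
* inflation is an isomorphism of topological groups from `Hom_c(T/T1, ℂˣ)` onto the group of
  unramified characters (those trivial on `T1`);
* the group of unramified characters is the identity component of `Hom_c(T, ℂˣ)`;
* it is open in `Hom_c(T, ℂˣ)`;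
* restriction induces an isomorphism of topological groups from the quotient of `Hom_c(T, ℂˣ)` by
  the unramified characters onto `Hom_c(T1, ℂˣ)`. -/
def UnramifiedIsIdentityComponent (T1 : Subgroup T) : Prop :=
  (∃ e : (T ⧸ T1 →ₜ* ℂˣ) ≃ₜ* unramifiedCharacters T1,
    ∀ (ψ : T ⧸ T1 →ₜ* ℂˣ) (t : T), (e ψ : T →ₜ* ℂˣ) t = ψ (QuotientGroup.mk t)) ∧
  unramifiedCharacters T1 = Subgroup.connectedComponentOfOne (T →ₜ* ℂˣ) ∧
  IsOpen (unramifiedCharacters T1 : Set (T →ₜ* ℂˣ)) ∧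
  ∃ e : ((T →ₜ* ℂˣ) ⧸ unramifiedCharacters T1) ≃ₜ* (T1 →ₜ* ℂˣ),
    ∀ (φ : T →ₜ* ℂˣ) (t : T1), e (QuotientGroup.mk φ) t = φ t

end Characters

/-! ## The criterion for compact kernels with a continuous section -/

/-! The topology of the torus is separated from the arithmetic of `C = C_E`. The input is a
continuous homomorphism `v` from `C` to `ℝ` or `ℤ` (the logarithm of the absolute value, or a
valuation) with compact kernel, such that a Galois-fixed `c` lies in the image of `C_F^1` exactly
when `v c = 0`.

Summing a character over its Galois orbit turns the condition on invariant characters into `v (t x)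
= 0` for all `x` (`mem_torusNormOne_iff`). So `T1` is a closed subset of a product of copies of the
compact group `ker v`, hence compact, and `t ↦ v ∘ t` identifies `T/T1` with a subgroup of `Hom(X,
ℝ)` or `Hom(X, ℤ)`. The projection `T → T/T1` splits continuously: over `ℝ` because `v` has a
Galois-fixed section, over `ℤ` because subgroups of finitely generated free groups are free. Thus
`T` is the product of `T1` and `T/T1`, and inflation, restriction and the quotient statement follow
formally (`UnramifiedIsIdentityComponent.of_section`).

Since `ℂˣ` has no small subgroups, a character that is close to `1` on the compact group `T1` is
trivial there; so the unramified characters form an open, hence clopen, subgroup that contains the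
identity component. Conversely, every character of `T/T1` is joined to `1` by a path: `T/T1` is
scaled by `u ∈ [0,1]` in the real case, logarithms of the values on a basis are scaled in the
discrete case.

For local fields the kernel of `v` is the group of elements of norm one or of units, and continuity
of the Galois action gives the rest. For global fields, three facts are needed. Compactness of `ker
v` (`IdeleClassGroup.isCompact_logAbsReal_eq_zero`) follows from the properties in
`HasProductFormula`, which come from Minkowski's theorem for number fields and from counting
functions with bounded poles for function fields. Galois-invariant classes descend to `F`
(`IdeleClassGroup.exists_isImage_of_galois_invariant`) by a trace argument on adeles and Hilbert 90.
Finally, absolute value one over `F` and over `E` are equivalent for classes from `F`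
(`IdeleClassGroup.logAbsReal_baseChange_eq_zero_iff`), by compactness in one direction and by
domination in the other. -/

/-- `ℂˣ` has no small subgroups: `z ^ 2 - 1 = (z - 1) * (z + 1)` and `‖z + 1‖ ≥ 3 / 2` near `1`, so
each squaring multiplies the distance to `1` by at least `3 / 2`. -/
theorem Units.eq_one_of_forall_pow_norm_sub_one_lt {z : ℂˣ}
    (h : ∀ n : ℕ, ‖((z ^ n : ℂˣ) : ℂ) - 1‖ < 1 / 2) : z = 1 := by
  have key (n : ℕ) : (3 / 2 : ℝ) ^ n * ‖(z : ℂ) - 1‖ ≤ ‖(z : ℂ) ^ 2 ^ n - 1‖ := by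
    induction n with
    | zero => simp
    | succ n ih =>
      have h1 := h (2 ^ n)
      rw [Units.val_pow_eq_pow_val] at h1
      have h2 : 3 / 2 ≤ ‖(z : ℂ) ^ 2 ^ n + 1‖ := by
        have h3 : ‖(2 : ℂ)‖ ≤ ‖(z : ℂ) ^ 2 ^ n + 1‖ + ‖(z : ℂ) ^ 2 ^ n - 1‖ := by
          refine le_trans (le_of_eq ?_) (norm_sub_le _ _)
          ring_nf
        rw [Complex.norm_ofNat] at h3
        linarith
      calc (3 / 2 : ℝ) ^ (n + 1) * ‖(z : ℂ) - 1‖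
          = (3 / 2) * ((3 / 2) ^ n * ‖(z : ℂ) - 1‖) := by ring
        _ ≤ ‖(z : ℂ) ^ 2 ^ n + 1‖ * ‖(z : ℂ) ^ 2 ^ n - 1‖ := by gcongr
        _ = ‖(z : ℂ) ^ 2 ^ (n + 1) - 1‖ := by rw [← norm_mul]; ring_nf
  by_contra hz
  have hpos : 0 < ‖(z : ℂ) - 1‖ := norm_pos_iff.mpr (sub_ne_zero.mpr fun h ↦ hz (Units.ext h))
  obtain ⟨n, hn⟩ := pow_unbounded_of_one_lt (1 / ‖(z : ℂ) - 1‖) (by norm_num : (1 : ℝ) < 3 / 2)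
  rw [div_lt_iff₀ hpos] at hn
  have h1 := h (2 ^ n)
  rw [Units.val_pow_eq_pow_val] at h1
  linarith [key n]

section Criterion

variable {T : Type*} [CommGroup T] [TopologicalSpace T] [IsTopologicalGroup T]

omit [IsTopologicalGroup T] in
-- Because `ℂˣ` has no small subgroups, triviality on `T1` is the same as mapping the compact set
-- `T1` into a small disc around `1`, a subbasic open condition in the compact-open topology.
theorem isOpen_unramifiedCharacters {T1 : Subgroup T} (hT1 : IsCompact (T1 : Set T)) :
    IsOpen (unramifiedCharacters T1 : Set (T →ₜ* ℂˣ)) := by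
  set V : Set ℂˣ := {z | ‖(z : ℂ) - 1‖ < 1 / 2}
  have hV : IsOpen V := isOpen_lt (by fun_prop) continuous_const
  have h : (unramifiedCharacters T1 : Set (T →ₜ* ℂˣ)) =
      ContinuousMonoidHom.toContinuousMap ⁻¹' {f | Set.MapsTo f T1 V} := by
    ext φ
    refine ⟨fun hφ t ht ↦ ?_, fun hφ t ht ↦ ?_⟩
    · change φ t ∈ V
      rw [hφ t ht]
      simp [V]
    · refine Units.eq_one_of_forall_pow_norm_sub_one_lt fun n ↦ ?_
      rw [← map_pow]
      exact hφ (pow_mem ht n)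
  rw [h]
  exact (ContinuousMap.isOpen_setOfPred_mapsTo hT1 hV).preimage
    (ContinuousMonoidHom.isInducing_toContinuousMap _ _).continuous

/-- If `T1` is compact, `T → T/T1` has a continuous section and all characters of `T/T1` are
joined to the trivial one, then the unramified characters are the identity component. -/
theorem UnramifiedIsIdentityComponent.of_section {T1 : Subgroup T} (hT1 : IsCompact (T1 : Set T))
    (s : T ⧸ T1 →ₜ* T) (hs : ∀ q, (QuotientGroup.mk (s q) : T ⧸ T1) = q)
    (hconn : ∀ φ : T ⧸ T1 →ₜ* ℂˣ, Joined 1 φ) : UnramifiedIsIdentityComponent T1 := by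
  let π : T →ₜ* T ⧸ T1 := ⟨QuotientGroup.mk' T1, QuotientGroup.continuous_mk⟩
  have hπ (t : T) : π t = QuotientGroup.mk t := rfl
  let ι : T1 →ₜ* T := ⟨T1.subtype, continuous_subtype_val⟩
  have hr (t : T) : t * (s (π t))⁻¹ ∈ T1 := by
    rw [← QuotientGroup.eq_one_iff, QuotientGroup.mk_mul, QuotientGroup.mk_inv, hs, hπ,
      mul_inv_cancel]
  have hs1 (t : T1) : π t = 1 := (QuotientGroup.eq_one_iff _).mpr t.2
  -- The projection onto `T1` along the image of `s`. It is the identity on `T1`, so composition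
  -- with it extends characters of `T1` to `T`.
  let r : T →ₜ* T1 :=
    ⟨{  toFun := fun t ↦ ⟨t * (s (π t))⁻¹, hr t⟩
        map_one' := by ext; simp
        map_mul' := fun a b ↦ by ext; simp [mul_mul_mul_comm, mul_comm (s (π b))⁻¹] },
      Continuous.subtype_mk (continuous_id.mul (s.continuous.comp π.continuous).inv) _⟩
  have hr' (t : T) : ((r t : T1) : T) = t * (s (π t))⁻¹ := rfl
  have hopen := isOpen_unramifiedCharacters hT1
  let e : (T ⧸ T1 →ₜ* ℂˣ) ≃ₜ* unramifiedCharacters T1 :=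
    { toFun := fun ψ ↦ ⟨ψ.comp π, fun t ht ↦ by
        rw [ContinuousMonoidHom.coe_comp, Function.comp_apply, hs1 ⟨t, ht⟩, map_one]⟩
      invFun := fun φ ↦ φ.1.comp s
      left_inv := fun ψ ↦ by
        ext q
        simp [hπ, hs]
      right_inv := fun φ ↦ by
        ext t
        have h := φ.2 _ (hr t)
        rw [map_mul, map_inv, mul_inv_eq_one] at h
        simp [h]
      map_mul' := fun ψ ψ' ↦ rfl
      continuous_toFun := (ContinuousMonoidHom.continuous_comp_left π).subtype_mk _
      continuous_invFun :=
        (ContinuousMonoidHom.continuous_comp_left s).comp continuous_subtype_val }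
  refine ⟨⟨e, fun ψ t ↦ rfl⟩, ?_, hopen, ?_⟩
  · apply SetLike.coe_injective
    change _ = connectedComponent (1 : T →ₜ* ℂˣ)
    refine Set.Subset.antisymm (fun φ hφ ↦ ?_) ?_
    · have h1 : Joined (1 : T ⧸ T1 →ₜ* ℂˣ) (e.symm ⟨φ, hφ⟩) := hconn _
      have h2 := h1.map (continuous_subtype_val.comp e.continuous_toFun)
      have h3 : (e.toMulEquiv 1 : T →ₜ* ℂˣ) = 1 := by rw [map_one]; rfl
      have h4 : (e.toMulEquiv (e.symm ⟨φ, hφ⟩) : T →ₜ* ℂˣ) = φ :=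
        congrArg Subtype.val (e.apply_symm_apply _)
      change Joined (e.toMulEquiv 1 : T →ₜ* ℂˣ) (e.toMulEquiv (e.symm ⟨φ, hφ⟩) : T →ₜ* ℂˣ) at h2
      rw [h3, h4] at h2
      exact pathComponent_subset_component _ h2
    · exact IsClopen.connectedComponent_subset ⟨Subgroup.isClosed_of_isOpen _ hopen, hopen⟩
        (one_mem (unramifiedCharacters T1))
  · let ρ : (T →ₜ* ℂˣ) →* (T1 →ₜ* ℂˣ) :=
      { toFun := fun φ ↦ φ.comp ι, map_one' := rfl, map_mul' := fun _ _ ↦ rfl }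
    have hρ : Continuous ρ := ContinuousMonoidHom.continuous_comp_left ι
    have hρ1 : unramifiedCharacters T1 ≤ ρ.ker := fun φ hφ ↦ by
      ext t
      exact congrArg _ (hφ t t.2)
    have hnormal : (unramifiedCharacters T1).Normal := ⟨fun φ hφ ψ ↦ by rwa [mul_inv_cancel_comm]⟩
    exact ⟨
      { toFun := QuotientGroup.lift (unramifiedCharacters T1) ρ hρ1
        invFun := fun φ ↦ QuotientGroup.mk (φ.comp r)
        left_inv := fun q ↦ by
          induction q using QuotientGroup.induction_on with
          | H φ =>
          refine QuotientGroup.eq.mpr fun t ht ↦ ?_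
          rw [ContinuousMonoidHom.mul_apply]
          change ((φ (r t : T1)))⁻¹ * φ t = 1
          rw [hr', hs1 ⟨t, ht⟩]
          simp
        right_inv := fun φ ↦ by
          ext t
          change ((φ (r t) : ℂˣ) : ℂ) = φ t
          congr 2
          ext
          rw [hr', hs1 t]
          simp
        map_mul' := map_mul (QuotientGroup.lift (unramifiedCharacters T1) ρ hρ1)
        continuous_toFun := hρ.quotient_lift _
        continuous_invFun :=
          QuotientGroup.continuous_mk.comp (ContinuousMonoidHom.continuous_comp_left r) },
      fun φ t ↦ rfl⟩

end Criterion

/-! ## Tori with values in a group with compact kernel of the absolute value -/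

section TorusCriterion

variable {C : Type*} [CommGroup C] [TopologicalSpace C]

/-- A continuous homomorphism to `ℝ` vanishes on compact subgroups. -/
theorem eq_zero_of_isCompact_of_continuous {S : Submonoid C} (hS : IsCompact (S : Set C))
    {f : C → ℝ} (hf : Continuous f) (hmul : ∀ a b, f (a * b) = f a + f b) {c : C} (hc : c ∈ S) :
    f c = 0 := by
  have hone : f 1 = 0 := by
    have := hmul 1 1
    rw [mul_one] at this
    linarith
  have hpow (n : ℕ) : f (c ^ n) = n * f c := by
    induction n with
    | zero => simp [hone]
    | succ n ih => rw [pow_succ, hmul, ih]; push_cast; ring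
  obtain ⟨B, hB⟩ := (hS.image hf).isBounded.exists_norm_le
  by_contra h
  obtain ⟨n, hn⟩ := exists_nat_gt (B / |f c|)
  rw [div_lt_iff₀ (abs_pos.mpr h)] at hn
  have := hB _ ⟨_, pow_mem hc n, rfl⟩
  rw [hpow, Real.norm_eq_abs, abs_mul, Nat.abs_cast] at this
  linarith

variable {Γ X : Type*} [AddCommGroup X] [Group Γ] [DistribMulAction Γ X]
  {act : Γ → C →* C} {N : Subgroup C}

namespace torusPoints

omit [TopologicalSpace C] in
theorem map_zero (t : torusPoints X act) : t.1 0 = 1 := by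
  have := t.2.1 0 0
  rwa [add_zero, left_eq_mul] at this

/-- A `Γ`-homomorphism on `X`, viewed as an additive homomorphism to `Additive C`. -/
def toAddMonoidHom (t : torusPoints X act) : X →+ Additive C where
  toFun x := Additive.ofMul (t.1 x)
  map_zero' := congrArg _ (map_zero t)
  map_add' x y := congrArg _ (t.2.1 x y)

omit [TopologicalSpace C] in
theorem map_sum {ι : Type*} (t : torusPoints X act) (s : Finset ι) (f : ι → X) :
    t.1 (∑ i ∈ s, f i) = ∏ i ∈ s, t.1 (f i) :=
  congrArg Additive.toMul (_root_.map_sum (toAddMonoidHom t) f s)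

end torusPoints

omit [TopologicalSpace C] in
-- The orbit sum of `x` is an invariant character, and `v` of the value of `t` there is `∑ γ, v (act
-- γ (t x))`; `hact` says that this sum detects whether `v (t x)` vanishes.
theorem mem_torusNormOne_iff [Fintype Γ] {A : Type*} [AddCommGroup A] {v : C → A}
    (hmul : ∀ a b, v (a * b) = v a + v b)
    (hN : ∀ c, (∀ γ, act γ c = c) → (c ∈ N ↔ v c = 0))
    (hact : ∀ c, ∑ γ, v (act γ c) = 0 → v c = 0) (t : torusPoints X act) :
    t ∈ torusNormOne X act N ↔ ∀ x, v (t.1 x) = 0 := by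
  have hone : v 1 = 0 := by
    have := hmul 1 1
    rwa [mul_one, left_eq_add] at this
  have hprod {ι : Type _} (s : Finset ι) (f : ι → C) : v (∏ i ∈ s, f i) = ∑ i ∈ s, v (f i) := by
    classical
    induction s using Finset.induction_on with
    | empty => simpa using hone
    | insert a s ha ih => rw [Finset.prod_insert ha, Finset.sum_insert ha, hmul, ih]
  have hfix (χ : X) (hχ : ∀ γ : Γ, γ • χ = χ) (γ : Γ) : act γ (t.1 χ) = t.1 χ := by
    rw [← t.2.2, hχ]
  refine ⟨fun h x ↦ hact _ ?_, fun h χ hχ ↦ (hN _ (hfix χ hχ)).mpr (h χ)⟩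
  have hχ (γ : Γ) : γ • (∑ δ : Γ, δ • x) = ∑ δ : Γ, δ • x := by
    rw [Finset.smul_sum]
    exact Fintype.sum_equiv (Equiv.mulLeft γ) _ _ fun δ ↦ by simp [mul_smul]
  have h1 := (hN _ (hfix _ hχ)).mp (h _ hχ)
  rw [torusPoints.map_sum, hprod] at h1
  simpa only [t.2.2] using h1

variable [IsTopologicalGroup C] [T2Space C]

omit [IsTopologicalGroup C] in
-- Tychonoff: additivity and equivariance are closed conditions on a product of copies of the
-- compact set where `v` vanishes.
theorem isCompact_torusNormOne [ContinuousMul C] {A : Type*} [Zero A] {v : C → A}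
    (hcpt : IsCompact {c | v c = 0}) (hcont : ∀ γ, Continuous (act γ))
    (hmem : ∀ t : torusPoints X act, t ∈ torusNormOne X act N ↔ ∀ x, v (t.1 x) = 0) :
    IsCompact (torusNormOne X act N : Set (torusPoints X act)) := by
  rw [Topology.IsEmbedding.subtypeVal.isCompact_iff]
  have h : Subtype.val '' (torusNormOne X act N : Set (torusPoints X act)) =
      (torusPoints X act : Set (X → C)) ∩ Set.univ.pi fun _ ↦ {c | v c = 0} := by
    ext t
    constructor
    · rintro ⟨t, ht, rfl⟩
      exact ⟨t.2, fun x _ ↦ (hmem t).mp ht x⟩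
    · rintro ⟨ht, h⟩
      exact ⟨⟨t, ht⟩, (hmem ⟨t, ht⟩).mpr fun x ↦ h x trivial, rfl⟩
  rw [h]
  refine (isCompact_univ_pi fun _ ↦ hcpt).inter_left ?_
  have : (torusPoints X act : Set (X → C)) =
      (⋂ x, ⋂ y, {t | t (x + y) = t x * t y}) ∩ ⋂ γ : Γ, ⋂ x, {t | t (γ • x) = act γ (t x)} := by
    ext t
    simp only [Set.mem_inter_iff, Set.mem_iInter]
    rfl
  rw [this]
  refine IsClosed.inter (isClosed_iInter fun x ↦ isClosed_iInter fun y ↦ ?_)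
    (isClosed_iInter fun γ ↦ isClosed_iInter fun x ↦ ?_)
  · exact isClosed_eq (by fun_prop) (by fun_prop)
  · exact isClosed_eq (by fun_prop) ((hcont γ).comp (by fun_prop))

/-- The Archimedean case: `C` is the product of `ℝ` and a compact group. -/
theorem UnramifiedIsIdentityComponent.torus_of_real_section [Finite Γ]
    {v : C → ℝ} (hv : Continuous v) (hmul : ∀ a b, v (a * b) = v a + v b)
    (hcpt : IsCompact {c | v c = 0}) (hcont : ∀ γ, Continuous (act γ))
    {s : ℝ → C} (hs : Continuous s) (hadd : ∀ a b, s (a + b) = s a * s b)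
    (hvs : ∀ r, v (s r) = r) (hfix : ∀ γ r, act γ (s r) = s r)
    (hN : ∀ c, (∀ γ, act γ c = c) → (c ∈ N ↔ v c = 0)) :
    UnramifiedIsIdentityComponent (torusNormOne X act N) := by
  have := Fintype.ofFinite Γ
  have hone : v 1 = 0 := by
    have := hmul 1 1
    rw [mul_one] at this
    linarith
  have hs0 : s 0 = 1 := by
    have := hadd 0 0
    rwa [add_zero, left_eq_mul] at this
  have hvinv (c : C) : v c⁻¹ = - v c := by
    have := hmul c c⁻¹
    rw [mul_inv_cancel, hone] at this
    linarith
  let S : Submonoid C :=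
    { carrier := {c | v c = 0}
      one_mem' := hone
      mul_mem' := fun {a b} (ha : v a = 0) (hb : v b = 0) ↦ by
        change v (a * b) = 0
        rw [hmul, ha, hb, add_zero] }
  -- `v ∘ act γ` is a continuous homomorphism to `ℝ`, so it vanishes on the compact kernel of `v`.
  have hker (γ : Γ) (c : C) (hc : v c = 0) : v (act γ c) = 0 :=
    eq_zero_of_isCompact_of_continuous (S := S) hcpt (hv.comp (hcont γ))
      (fun a b ↦ by simp [hmul]) hc
  -- `c` is moved into the kernel of `v` by a factor from the section, which `γ` fixes.
  have hinv (γ : Γ) (c : C) : v (act γ c) = v c := by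
    have h1 := hker γ (c * s (-v c)) (by rw [hmul, hvs, add_neg_cancel])
    rw [map_mul, hfix, hmul, hvs] at h1
    linarith
  have hmem := mem_torusNormOne_iff (X := X) hmul hN fun c hc ↦ by
    simp only [hinv, Finset.sum_const, Finset.card_univ, nsmul_eq_mul] at hc
    exact (mul_eq_zero.mp hc).resolve_left (by exact_mod_cast Fintype.card_ne_zero)
  -- For `u = 1` this gives the section of `T → T/T1`, for `u = 0` the trivial map; in between it is
  -- the homotopy that contracts characters of the quotient.
  let σ (u : ℝ) : torusPoints X act →* torusPoints X act :=
    { toFun := fun t ↦ ⟨fun x ↦ s (u * v (t.1 x)),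
        fun x y ↦ by simp only [t.2.1, hmul, mul_add, hadd],
        fun γ x ↦ by simp only [t.2.2, hinv, hfix]⟩
      map_one' := by
        ext x
        change s (u * v 1) = 1
        rw [hone, mul_zero, hs0]
      map_mul' := fun t t' ↦ by
        ext x
        change s (u * v (t.1 x * t'.1 x)) = _ * _
        rw [hmul, mul_add, hadd] }
  have hσc : Continuous fun p : ℝ × torusPoints X act ↦ σ p.1 p.2 := by
    refine Continuous.subtype_mk (continuous_pi fun x ↦ hs.comp (continuous_fst.mul (hv.comp ?_))) _
    exact (continuous_apply x).comp (continuous_subtype_val.comp continuous_snd)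
  have hσ1 (u : ℝ) : torusNormOne X act N ≤ (σ u).ker := fun t ht ↦ by
    ext x
    change s (u * v (t.1 x)) = 1
    rw [(hmem t).mp ht x, mul_zero, hs0]
  let σ' (u : ℝ) : torusPoints X act ⧸ torusNormOne X act N →ₜ* torusPoints X act :=
    ⟨QuotientGroup.lift _ (σ u) (hσ1 u),
      Continuous.quotient_lift (hσc.comp (Continuous.prodMk_right u)) _⟩
  -- Joint continuity is needed for a path in the compact-open topology. It descends because the
  -- product of the identity with an open quotient map is again a quotient map.
  have hσ'c : Continuous fun p : ℝ × (torusPoints X act ⧸ torusNormOne X act N) ↦ σ' p.1 p.2 := by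
    have hq := IsOpenQuotientMap.id.prodMap (QuotientGroup.isOpenQuotientMap_mk
      (N := torusNormOne X act N)) (f := (id : ℝ → ℝ))
    rw [hq.isQuotientMap.continuous_iff]
    exact hσc
  have hsec (q) : (QuotientGroup.mk (σ' 1 q) : torusPoints X act ⧸ torusNormOne X act N) = q := by
    induction q using QuotientGroup.induction_on with
    | H t =>
    refine QuotientGroup.eq.mpr ((hmem _).mpr fun x ↦ ?_)
    change v ((s (1 * v (t.1 x)))⁻¹ * t.1 x) = 0
    rw [hmul, hvinv, hvs]
    ring
  refine .of_section (isCompact_torusNormOne hcpt hcont hmem) (σ' 1) hsec fun φ ↦ ?_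
  have hpath : Continuous fun u : unitInterval ↦
      φ.comp (ContinuousMonoidHom.comp ⟨QuotientGroup.mk' _, QuotientGroup.continuous_mk⟩ (σ' u)) :=
    ContinuousMonoidHom.continuous_of_continuous_uncurry _
      (φ.continuous.comp (QuotientGroup.continuous_mk.comp
        (hσ'c.comp ((continuous_subtype_val.comp continuous_fst).prodMk continuous_snd))))
  refine ⟨⟨⟨_, hpath⟩, ?_, ?_⟩⟩
  · ext q
    induction q using QuotientGroup.induction_on with
    | H t =>
    have : σ 0 t = 1 := by
      ext x
      change s (0 * v (t.1 x)) = 1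
      rw [zero_mul, hs0]
    change ((φ (QuotientGroup.mk (σ 0 t)) : ℂˣ) : ℂ) = (1 : ℂˣ)
    rw [this, QuotientGroup.mk_one, map_one]
  · ext q
    change ((φ (QuotientGroup.mk (σ' 1 q)) : ℂˣ) : ℂ) = φ q
    rw [hsec]

end TorusCriterion


/-! ### Tori with values in a group with an integer-valued absolute value -/

section TorusCriterionDiscrete

variable {C : Type*} [CommGroup C] [TopologicalSpace C] [IsTopologicalGroup C] [T2Space C]
  {Γ X : Type*} [AddCommGroup X] [Group Γ] [DistribMulAction Γ X]
  {act : Γ → C →* C} {N : Subgroup C}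

/-- The non-Archimedean case: `C` is the product of a discrete cyclic and a compact group. -/
theorem UnramifiedIsIdentityComponent.torus_of_discrete [Finite Γ] [Module.Free ℤ X]
    [Module.Finite ℤ X] {v : C → ℤ} (hv : Continuous v) (hmul : ∀ a b, v (a * b) = v a + v b)
    (hcpt : IsCompact {c | v c = 0}) (hcont : ∀ γ, Continuous (act γ))
    (hneg : (∀ c, v c = 0) ∨ ∃ c, v c < 0 ∧ ∀ γ, v (act γ c) < 0)
    (hN : ∀ c, (∀ γ, act γ c = c) → (c ∈ N ↔ v c = 0)) :
    UnramifiedIsIdentityComponent (torusNormOne X act N) := by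
  have := Fintype.ofFinite Γ
  let V : Additive C →+ ℤ := AddMonoidHom.mk' (fun c ↦ v c.toMul) fun a b ↦ hmul _ _
  have hV (c : C) : v c = V (Additive.ofMul c) := rfl
  have hker (γ : Γ) (c : C) (hc : v c = 0) : v (act γ c) = 0 := by
    let S : Submonoid C :=
      { carrier := {c | v c = 0}
        one_mem' := V.map_zero
        mul_mem' := fun {a b} (ha : v a = 0) (hb : v b = 0) ↦ by
          change v (a * b) = 0
          rw [hmul, ha, hb, add_zero] }
    exact_mod_cast eq_zero_of_isCompact_of_continuous (S := S) hcpt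
      (f := fun c ↦ (v (act γ c) : ℝ)) (continuous_of_discreteTopology.comp (hv.comp (hcont γ)))
      (fun a b ↦ by simp [hmul]) hc
  -- Each `v ∘ act γ` vanishes on `ker v`, so it is proportional to `v`. The element from `hneg`,
  -- negative together with all its conjugates, gives the ratios the same sign, so their sum cannot
  -- cancel.
  have hact (c : C) (hc : ∑ γ, v (act γ c) = 0) : v c = 0 := by
    rcases hneg with h | ⟨c0, h0, hγ⟩
    · exact h c
    have key (γ : Γ) : v c0 * v (act γ c) = v c * v (act γ c0) := by
      -- Cross-multiplied exponents give an element of `ker v`; applying `v ∘ act γ` to it yields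
      -- the proportionality.
      have h1 : v (c ^ v c0 * c0 ^ (-v c)) = 0 := by
        simp only [hV, ofMul_mul, ofMul_zpow, map_add, map_zsmul, smul_eq_mul]
        ring
      have h2 := hker γ _ h1
      rw [map_mul, map_zpow, map_zpow] at h2
      simp only [hV, ofMul_mul, ofMul_zpow, map_add, map_zsmul, smul_eq_mul] at h2
      simp only [hV]
      linarith
    have h1 : v c * ∑ γ, v (act γ c0) = 0 := by
      rw [Finset.mul_sum, ← Finset.sum_congr rfl fun γ _ ↦ key γ, ← Finset.mul_sum, hc, mul_zero]
    refine (mul_eq_zero.mp h1).resolve_right (ne_of_lt ?_)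
    exact Finset.sum_neg (fun γ _ ↦ hγ γ) ⟨1, Finset.mem_univ _⟩
  have hmem := mem_torusNormOne_iff (X := X) hmul hN hact
  have hT1 := isCompact_torusNormOne hcpt hcont hmem
  let T := torusPoints X act
  let T1 := torusNormOne X act N
  let ℓ : Additive T →+ (X →ₗ[ℤ] ℤ) :=
    { toFun := fun t ↦ (V.comp (torusPoints.toAddMonoidHom t.toMul)).toIntLinearMap
      map_zero' := by
        ext x
        exact V.map_zero
      map_add' := fun t t' ↦ by
        ext x
        exact hmul _ _ }
  have hℓ (t : T) (x : X) : ℓ (Additive.ofMul t) x = v (t.1 x) := rfl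
  have hℓ1 (t : T) : t ∈ T1 ↔ ℓ (Additive.ofMul t) = 0 := by
    rw [hmem]
    exact ⟨fun h ↦ LinearMap.ext h, fun h x ↦ by rw [← hℓ, h, LinearMap.zero_apply]⟩
  -- Since `X` is finitely generated, finitely many of the open conditions `v (t x) = 0` define
  -- `T1`.
  have hopen : IsOpen (T1 : Set T) := by
    obtain ⟨G, hG⟩ := Module.Finite.fg_top (R := ℤ) (M := X)
    have : (T1 : Set T) = ⋂ x ∈ G, {t | v (t.1 x) = 0} := by
      ext t
      simp only [Set.mem_iInter]
      rw [SetLike.mem_coe, hmem]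
      refine ⟨fun h x _ ↦ h x, fun h x ↦ ?_⟩
      have h1 : Submodule.span ℤ (G : Set X) ≤ LinearMap.ker (ℓ (Additive.ofMul t)) :=
        Submodule.span_le.mpr h
      exact h1 (hG ▸ Submodule.mem_top)
    rw [this]
    refine isOpen_biInter_finset fun x _ ↦ ?_
    exact (isOpen_discrete ({0} : Set ℤ)).preimage
      (hv.comp ((continuous_apply x).comp continuous_subtype_val))
  have hdisc : DiscreteTopology (T ⧸ T1) := QuotientGroup.discreteTopology hopen
  -- The range lies in the dual of a finite free `ℤ`-module, so it is free and `T` surjects onto it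
  -- with a splitting; continuity is automatic since `T/T1` is discrete.
  obtain ⟨g, hg⟩ := Module.projective_lifting_property ℓ.toIntLinearMap.rangeRestrict
    (LinearMap.id) (LinearMap.surjective_rangeRestrict _)
  let p : T →* Multiplicative (LinearMap.range ℓ.toIntLinearMap) :=
    AddMonoidHom.toMultiplicativeRight (ℓ.toIntLinearMap.rangeRestrict.toAddMonoidHom)
  have hp1 : T1 ≤ p.ker := fun t ht ↦ by
    refine Subtype.ext ?_
    exact (hℓ1 t).mp ht
  let p' : T ⧸ T1 →* Multiplicative (LinearMap.range ℓ.toIntLinearMap) := QuotientGroup.lift T1 p hp1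
  let σ : Multiplicative (LinearMap.range ℓ.toIntLinearMap) →* T :=
    AddMonoidHom.toMultiplicativeLeft g.toAddMonoidHom
  have hpσ (r) : p (σ r) = r := LinearMap.congr_fun hg r.toAdd
  have hsec (q : T ⧸ T1) : (QuotientGroup.mk (σ (p' q)) : T ⧸ T1) = q := by
    induction q using QuotientGroup.induction_on with
    | H t =>
    refine QuotientGroup.eq.mpr ((hℓ1 _).mpr ?_)
    have h1 : p ((σ (p t))⁻¹ * t) = 1 := by rw [map_mul, map_inv, hpσ, inv_mul_cancel]
    exact congrArg Subtype.val h1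
  refine .of_section hT1 ⟨σ.comp p', continuous_of_discreteTopology⟩ hsec fun φ ↦ ?_
  let b := Module.Free.chooseBasis ℤ (LinearMap.range ℓ.toIntLinearMap)
  -- A logarithm of `φ`: any choice of logarithms on a basis extends linearly, and scaling it by `u`
  -- contracts `φ` to the trivial character.
  let lam : LinearMap.range ℓ.toIntLinearMap →ₗ[ℤ] ℂ := b.constr ℤ fun i ↦
    Complex.log (φ (QuotientGroup.mk (σ (Multiplicative.ofAdd (b i)))))
  have hexp (z w : ℂ) : Units.mk0 (Complex.exp (z + w)) (Complex.exp_ne_zero _) =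
      Units.mk0 (Complex.exp z) (Complex.exp_ne_zero _) *
        Units.mk0 (Complex.exp w) (Complex.exp_ne_zero _) := Units.ext (Complex.exp_add z w)
  let E : ℂ →+ Additive ℂˣ := AddMonoidHom.mk'
    (fun z ↦ Additive.ofMul (Units.mk0 (Complex.exp z) (Complex.exp_ne_zero z))) hexp
  have hE (z : ℂ) : (((E z).toMul : ℂˣ) : ℂ) = Complex.exp z := rfl
  have hlam : E.toIntLinearMap ∘ₗ lam = (AddMonoidHom.toMultiplicativeLeft.symm
      (φ.toMonoidHom.comp ((QuotientGroup.mk' T1).comp σ))).toIntLinearMap := by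
    refine b.ext fun i ↦ ?_
    refine congrArg Additive.ofMul (Units.ext ?_)
    change Complex.exp (lam (b i)) = φ (QuotientGroup.mk (σ (Multiplicative.ofAdd (b i))))
    rw [Module.Basis.constr_basis, Complex.exp_log (Units.ne_zero _)]
  let ψ (u : ℝ) : T ⧸ T1 →ₜ* ℂˣ :=
    ⟨{  toFun := fun q ↦ (E (u * lam (p' q).toAdd)).toMul
        map_one' := by
          have h : p' 1 = 1 := map_one p'
          rw [h]
          change (E (u * lam 0)).toMul = 1
          rw [LinearMap.map_zero, mul_zero, map_zero, toMul_zero]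
        map_mul' := fun a b ↦ by
          have h : p' (a * b) = p' a * p' b := map_mul p' a b
          rw [h]
          change (E (u * lam ((p' a).toAdd + (p' b).toAdd))).toMul = _
          rw [map_add, mul_add, map_add, toMul_add] }, continuous_of_discreteTopology⟩
  have hψ (u : ℝ) (q : T ⧸ T1) : ((ψ u q : ℂˣ) : ℂ) = Complex.exp (u * lam (p' q).toAdd) := rfl
  have hpath : Continuous fun u : unitInterval ↦ ψ u := by
    refine ContinuousMonoidHom.continuous_of_continuous_uncurry _ ?_
    refine continuous_prod_of_discrete_right.mpr fun q ↦ ?_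
    refine Units.continuous_iff.mpr ⟨?_, ?_⟩
    · change Continuous fun u : unitInterval ↦ Complex.exp ((u : ℝ) * lam (p' q).toAdd)
      fun_prop
    · have h (u : unitInterval) : (((ψ u q)⁻¹ : ℂˣ) : ℂ) =
          Complex.exp (-((u : ℝ) * lam (p' q).toAdd)) := by
        rw [Units.val_inv_eq_inv_val, hψ, Complex.exp_neg]
      change Continuous fun u : unitInterval ↦ (((ψ u q)⁻¹ : ℂˣ) : ℂ)
      simp only [h]
      fun_prop
  refine ⟨⟨⟨_, hpath⟩, ?_, ?_⟩⟩
  · ext q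
    simp [hψ]
  · ext q
    change ((ψ 1 q : ℂˣ) : ℂ) = φ q
    rw [hψ, Complex.ofReal_one, one_mul, ← hE]
    have h1 := LinearMap.congr_fun hlam (p' q).toAdd
    refine congrArg (fun z : Additive ℂˣ ↦ (z.toMul : ℂ)) h1 |>.trans ?_
    change ((φ (QuotientGroup.mk (σ (p' q))) : ℂˣ) : ℂ) = φ q
    rw [hsec]

end TorusCriterionDiscrete


/-! ## Local fields -/

/-- The unit topology comes from the closed embedding `u ↦ (u, u⁻¹)`, so bounds for `u` and for
`u⁻¹` are both required. -/
theorem Units.isCompact_of_val_of_inv {M : Type*} [Monoid M] [TopologicalSpace M] [T1Space M]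
    [ContinuousMul M] {S : Set Mˣ} (hS : IsClosed S) {A B : Set M} (hA : IsCompact A)
    (hB : IsCompact B) (h : ∀ u ∈ S, (u : M) ∈ A ∧ ((u⁻¹ : Mˣ) : M) ∈ B) : IsCompact S := by
  refine ((Units.isClosedEmbedding_embedProduct (α := M)).isCompact_preimage
    (hA.prod (hB.image MulOpposite.continuous_op))).of_isClosed_subset hS fun u hu ↦ ?_
  exact ⟨(h u hu).1, _, (h u hu).2, rfl⟩

/-! ### Archimedean local fields -/

section Arch

variable {F E : Type*} [RCLike F] [RCLike E]

theorem continuous_log_norm_units : Continuous fun c : Eˣ ↦ Real.log ‖(c : E)‖ :=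
  Continuous.log (by fun_prop) fun c ↦ norm_ne_zero_iff.mpr c.ne_zero

theorem log_norm_units_mul (a b : Eˣ) :
    Real.log ‖((a * b : Eˣ) : E)‖ = Real.log ‖(a : E)‖ + Real.log ‖(b : E)‖ := by
  rw [Units.val_mul, norm_mul, Real.log_mul] <;> simp

theorem isCompact_norm_units_eq_one : IsCompact {c : Eˣ | ‖(c : E)‖ = 1} := by
  refine Units.isCompact_of_val_of_inv (isClosed_eq (by fun_prop) continuous_const)
    (isCompact_sphere (0 : E) 1) (isCompact_sphere (0 : E) 1) fun u hu ↦ ?_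
  have hu : ‖(u : E)‖ = 1 := hu
  simp [hu]

theorem log_norm_units_eq_zero {c : Eˣ} : Real.log ‖(c : E)‖ = 0 ↔ ‖(c : E)‖ = 1 := by
  have h : 0 < ‖(c : E)‖ := norm_pos_iff.mpr c.ne_zero
  rw [Real.log_eq_zero]
  constructor
  · rintro (h' | h' | h') <;> linarith
  · exact fun h ↦ Or.inr (Or.inl h)

theorem RingHom.map_ofReal_of_continuous {φ : F →+* E} (hφ : Continuous φ) (r : ℝ) :
    φ (r : F) = (r : E) := by
  have := map_real_smul φ hφ r 1
  rwa [map_one, RCLike.real_smul_eq_coe_mul, RCLike.real_smul_eq_coe_mul, mul_one, mul_one] at this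

/-- Polar decomposition: `φ` fixes the positive real factor `‖x‖`, and `log ‖φ ·‖` vanishes on the
compact group of elements of norm one. This treats all pairs among `ℝ` and `ℂ` at once. -/
theorem RingHom.norm_map_of_continuous {φ : F →+* E} (hφ : Continuous φ) (x : F) :
    ‖φ x‖ = ‖x‖ := by
  have key (u : Fˣ) (hu : ‖(u : F)‖ = 1) : ‖φ u‖ = 1 := by
    let S : Submonoid Fˣ :=
      { carrier := {c | ‖(c : F)‖ = 1}
        one_mem' := by simp
        mul_mem' := fun {a b} (ha : ‖(a : F)‖ = 1) (hb : ‖(b : F)‖ = 1) ↦ by simp [ha, hb] }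
    refine (log_norm_units_eq_zero (c := Units.map (φ : F →* E) u)).mp ?_
    exact eq_zero_of_isCompact_of_continuous (S := S) isCompact_norm_units_eq_one
      (f := fun c ↦ Real.log ‖(Units.map (φ : F →* E) c : E)‖)
      (continuous_log_norm_units.comp (hφ.units_map (φ : F →* E)))
      (fun a b ↦ by rw [map_mul, log_norm_units_mul]) hu
  rcases eq_or_ne x 0 with rfl | hx
  · simp
  have hn : ((‖x‖ : ℝ) : F) ≠ 0 := by simpa using hx
  have h1 := key (Units.mk0 (x / (‖x‖ : ℝ)) (div_ne_zero hx hn)) (by simp [hx])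
  rw [Units.val_mk0, map_div₀, φ.map_ofReal_of_continuous hφ, norm_div, div_eq_one_iff_eq] at h1
  · simpa using h1
  · simpa using hx

end Arch

/-- Here `v` is `log ‖·‖` and the exponential provides the section; its values are real, hence fixed
by the Galois group, whose elements are continuous as linear maps in finite dimension. -/
theorem UnramifiedIsIdentityComponent.torus_of_rclike (F : Type*) [RCLike F] (E : Type*) [RCLike E]
    [Algebra F E] [FiniteDimensional F E] [IsGalois F E] (hcont : Continuous (algebraMap F E))
    (X : Type*) [AddCommGroup X] [DistribMulAction (E ≃ₐ[F] E) X] :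
    UnramifiedIsIdentityComponent (T := torusPoints X (localGaloisAct F E))
      (torusNormOne X (localGaloisAct F E) (localNormOneImage E (archLocalAbs F))) := by
  have : ContinuousSMul F E := continuousSMul_of_algebraMap F E hcont
  have hγ (γ : E ≃ₐ[F] E) : Continuous (γ : E →+* E) :=
    LinearMap.continuous_of_finiteDimensional γ.toLinearMap
  have habs (x : F) : archLocalAbs F x = ‖x‖ ^ Module.finrank ℝ F := rfl
  have hfin : Module.finrank ℝ F ≠ 0 := Module.finrank_pos.ne'
  refine .torus_of_real_section (v := fun c : Eˣ ↦ Real.log ‖(c : E)‖)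
    continuous_log_norm_units log_norm_units_mul ?_
    (fun γ ↦ (hγ γ).units_map (γ : E →* E))
    (s := fun r ↦ Units.mk0 ((Real.exp r : ℝ) : E) (by simp)) ?_ ?_ ?_ ?_ ?_
  · simpa only [log_norm_units_eq_zero] using isCompact_norm_units_eq_one
  · refine Units.continuous_iff.mpr ⟨?_, ?_⟩
    · change Continuous fun r : ℝ ↦ ((Real.exp r : ℝ) : E)
      fun_prop
    · have h (r : ℝ) : (((Units.mk0 ((Real.exp r : ℝ) : E) (by simp))⁻¹ : Eˣ) : E) =
          ((Real.exp (-r) : ℝ) : E) := by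
        rw [Units.val_inv_eq_inv_val, Units.val_mk0, Real.exp_neg, RCLike.ofReal_inv]
      simp only [h]
      fun_prop
  · intro a b
    ext
    simp [Real.exp_add]
  · intro r
    simp
  · intro γ r
    ext
    exact RingHom.map_ofReal_of_continuous (hγ γ) _
  · intro c hc
    rw [log_norm_units_eq_zero]
    constructor
    · rintro ⟨u, hu, rfl⟩
      have hu1 := congrArg Units.val (MonoidHom.mem_ker.mp hu)
      change ‖(u : F)‖ ^ _ = 1 at hu1
      change ‖algebraMap F E u‖ = 1
      rw [RingHom.norm_map_of_continuous hcont]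
      exact (pow_eq_one_iff_of_nonneg (norm_nonneg _) hfin).mp hu1
    · intro h1
      obtain ⟨x, hx⟩ := (IsGalois.mem_range_algebraMap_iff_fixed (c : E)).mpr
        fun γ ↦ congrArg Units.val (hc γ)
      have hx0 : x ≠ 0 := by
        rintro rfl
        exact c.ne_zero (by rw [← hx, map_zero])
      refine ⟨Units.mk0 x hx0, ?_, Units.ext hx⟩
      rw [← hx, RingHom.norm_map_of_continuous hcont] at h1
      refine MonoidHom.mem_ker.mpr (Units.ext ?_)
      change ‖x‖ ^ _ = 1
      rw [h1, one_pow]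

/-! ### Non-Archimedean local fields -/

section Nonarch

open ValuativeRel IsNonarchimedeanLocalField Filter Topology

variable {F E : Type*} [Field F] [ValuativeRel F] [TopologicalSpace F]
  [IsNonarchimedeanLocalField F] [Field E] [ValuativeRel E] [TopologicalSpace E]
  [IsNonarchimedeanLocalField E]

/-- The normalized additive valuation on the units of a local field, up to sign. -/
noncomputable def logVal (c : Fˣ) : ℤ :=
  WithZero.log (valueGroupWithZeroIsoInt F (valuation F c))

theorem iso_valuation_ne_zero (c : Fˣ) : valueGroupWithZeroIsoInt F (valuation F c) ≠ 0 := by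
  simp

theorem logVal_mul (a b : Fˣ) : logVal (a * b) = logVal a + logVal b := by
  rw [logVal, Units.val_mul, map_mul, map_mul,
    WithZero.log_mul (iso_valuation_ne_zero a) (iso_valuation_ne_zero b)]
  rfl

theorem logVal_lt_zero_iff {c : Fˣ} : logVal c < 0 ↔ valuation F c < 1 := by
  rw [logVal, WithZero.log_lt_iff_lt_exp (iso_valuation_ne_zero c), WithZero.exp_zero,
    ← map_one (valueGroupWithZeroIsoInt F), (valueGroupWithZeroIsoInt F).strictMono.lt_iff_lt]

theorem logVal_eq_zero_iff {c : Fˣ} : logVal c = 0 ↔ valuation F c = 1 := by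
  rw [logVal, ← WithZero.exp_eq_one, WithZero.exp_log (iso_valuation_ne_zero c),
    EmbeddingLike.map_eq_one_iff]

theorem continuous_logVal : Continuous (logVal : Fˣ → ℤ) := by
  refine IsLocallyConstant.continuous ((IsLocallyConstant.iff_eventually_eq _).mpr fun c ↦ ?_)
  have h := (valuation F).locally_const (x := (c : F)) (by simp)
  filter_upwards [Units.continuous_val.continuousAt.eventually h] with d hd
  rw [logVal, logVal, hd]

theorem t2Space_of_isNonarchimedeanLocalField : T2Space F := by
  refine IsTopologicalAddGroup.t2Space_of_zero_sep fun x hx ↦ ?_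
  refine ⟨{y | valuation F y < valuation F x}, ?_, fun h ↦ (lt_irrefl (valuation F x) h).elim⟩
  exact (IsValuativeTopology.hasBasis_nhds_zero' F).mem_of_mem (by simpa using hx)

theorem isCompact_logVal_eq_zero : IsCompact {c : Fˣ | logVal c = 0} := by
  have := t2Space_of_isNonarchimedeanLocalField (F := F)
  refine Units.isCompact_of_val_of_inv
    ((isClosed_discrete ({0} : Set ℤ)).preimage continuous_logVal)
    (isCompact_closedBall F 1) (isCompact_closedBall F 1) fun u hu ↦ ?_
  have hu : valuation F (u : F) = 1 := logVal_eq_zero_iff.mp hu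
  simp [hu]

/-- Describes the maximal ideal as the set of topologically nilpotent elements, a property that
every continuous ring homomorphism preserves. -/
theorem tendsto_pow_zero_iff_valuation_lt_one {x : F} :
    Tendsto (fun n : ℕ ↦ x ^ n) atTop (𝓝 0) ↔ valuation F x < 1 := by
  rw [(IsValuativeTopology.hasBasis_nhds_zero' F).tendsto_right_iff]
  have : MulArchimedean (ValueGroupWithZero F) :=
    .comap (valueGroupWithZeroIsoInt F).toMonoidHom (valueGroupWithZeroIsoInt F).strictMono
  refine ⟨fun h ↦ ?_, fun h γ hγ ↦ ?_⟩
  · obtain ⟨n, hn⟩ := (h 1 one_ne_zero).exists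
    by_contra! h1
    rw [Set.mem_ofPred_eq, map_pow] at hn
    exact hn.not_ge (one_le_pow_of_one_le' h1 n)
  · obtain ⟨n, hn⟩ := exists_pow_lt₀ h (Units.mk0 γ hγ)
    filter_upwards [eventually_ge_atTop n] with m hm
    rw [map_pow]
    exact (pow_le_pow_right_of_le_one' h.le hm).trans_lt hn

theorem valuation_map_lt_one {φ : F →+* E} (hφ : Continuous φ) {x : F} (hx : valuation F x < 1) :
    valuation E (φ x) < 1 := by
  rw [← tendsto_pow_zero_iff_valuation_lt_one] at hx ⊢
  simpa [Function.comp_def] using (hφ.tendsto 0).comp hx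

/-- Units go to units because the unit group is compact; for a nonzero non-unit, `x` or `x⁻¹` is
topologically nilpotent and remains so. No ramification index enters. -/
theorem valuation_map_eq_one_iff {φ : F →+* E} (hφ : Continuous φ) {x : F} :
    valuation E (φ x) = 1 ↔ valuation F x = 1 := by
  rcases eq_or_ne x 0 with rfl | hx
  · simp
  refine ⟨fun h ↦ ?_, fun h ↦ ?_⟩
  · by_contra h1
    rcases lt_or_gt_of_ne h1 with h1 | h1
    · exact (valuation_map_lt_one hφ h1).ne h
    · have h2 : valuation F x⁻¹ < 1 := by
        rw [map_inv₀]
        exact inv_lt_one_of_one_lt₀ h1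
      have h3 := (valuation_map_lt_one hφ h2).ne
      rw [map_inv₀, map_inv₀, h, inv_one] at h3
      exact h3 rfl
  · let S : Submonoid Fˣ :=
      { carrier := {c | logVal c = 0}
        one_mem' := by simp [logVal_eq_zero_iff]
        mul_mem' := fun {a b} (ha : logVal a = 0) (hb : logVal b = 0) ↦ by
          change logVal (a * b) = 0
          rw [logVal_mul, ha, hb, add_zero] }
    have h1 := eq_zero_of_isCompact_of_continuous (S := S) isCompact_logVal_eq_zero
      (f := fun c ↦ (logVal (Units.map (φ : F →* E) c) : ℝ))
      (continuous_of_discreteTopology.comp (continuous_logVal.comp (hφ.units_map (φ : F →* E))))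
      (fun a b ↦ by rw [map_mul, logVal_mul]; push_cast; rfl)
      (c := Units.mk0 x hx) (logVal_eq_zero_iff.mpr h)
    exact logVal_eq_zero_iff.mp (Int.cast_eq_zero.mp h1)

/-- The value group is countable and closed balls are compact. This is the hypothesis of the open
mapping theorem used for continuity of automorphisms. -/
theorem sigmaCompactSpace_of_isNonarchimedeanLocalField : SigmaCompactSpace F := by
  have : Countable (ValueGroupWithZero F) :=
    have : Countable ℤᵐ⁰ := inferInstanceAs (Countable (Option ℤ))
    (valueGroupWithZeroIsoInt F).injective.countable
  exact SigmaCompactSpace.of_countable _ (Set.countable_range fun γ ↦ {x | valuation F x ≤ γ})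
    (by rintro _ ⟨γ, rfl⟩; exact isCompact_closedBall F γ)
    (Set.eq_univ_of_forall fun x ↦ ⟨_, ⟨valuation F x, rfl⟩, le_refl (valuation F x)⟩)

/-- By the open mapping theorem for σ-compact groups, a basis makes `E` a topological quotient of `F
^ n`, where linear maps are visibly continuous. It is applied to Galois automorphisms. -/
theorem continuous_of_isNonarchimedeanLocalField [Algebra F E] [FiniteDimensional F E]
    (hcont : Continuous (algebraMap F E)) (f : E →ₗ[F] E) : Continuous f := by
  have := sigmaCompactSpace_of_isNonarchimedeanLocalField (F := F)
  have := t2Space_of_isNonarchimedeanLocalField (F := E)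
  have : ContinuousSMul F E := continuousSMul_of_algebraMap F E hcont
  let b := Module.finBasis F E
  let g : (Fin (Module.finrank F E) → F) →+ E := b.equivFun.symm.toLinearMap.toAddMonoidHom
  have hg : Continuous g := b.equivFun.symm.toLinearMap.continuous_on_pi
  have hopen := AddMonoidHom.isOpenMap_of_sigmaCompact g b.equivFun.symm.surjective hg
  have hq : IsQuotientMap g := hopen.isQuotientMap hg b.equivFun.symm.surjective
  rw [hq.continuous_iff]
  exact (f ∘ₗ b.equivFun.symm.toLinearMap).continuous_on_pi

end Nonarch

open ValuativeRel in
theorem UnramifiedIsIdentityComponent.torus_of_isNonarchimedeanLocalField (F : Type*) [Field F] [ValuativeRel F] [TopologicalSpace F]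
    [IsNonarchimedeanLocalField F] (E : Type*) [Field E] [ValuativeRel E] [TopologicalSpace E]
    [IsNonarchimedeanLocalField E] [Algebra F E] [FiniteDimensional F E] [IsGalois F E]
    (hcont : Continuous (algebraMap F E))
    (X : Type*) [AddCommGroup X] [Module.Free ℤ X] [Module.Finite ℤ X]
    [DistribMulAction (E ≃ₐ[F] E) X] :
    UnramifiedIsIdentityComponent (T := torusPoints X (localGaloisAct F E))
      (torusNormOne X (localGaloisAct F E) (localNormOneImage E (nonarchLocalAbs F))) := by
  have := t2Space_of_isNonarchimedeanLocalField (F := E)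
  have hγ (γ : E ≃ₐ[F] E) : Continuous (γ : E →+* E) :=
    continuous_of_isNonarchimedeanLocalField hcont γ.toLinearMap
  have habs (x : F) : nonarchLocalAbs F x = 1 ↔ valuation F x = 1 := by
    refine (WithZeroMulInt.toNNReal_eq_one_iff _ (residueCard_ne_zero F) ?_).trans
      (map_eq_one_iff _ (IsNonarchimedeanLocalField.valueGroupWithZeroIsoInt F).injective)
    exact_mod_cast (Finite.one_lt_card (α := IsLocalRing.ResidueField (valuation F).integer)).ne'
  refine .torus_of_discrete (v := logVal) continuous_logVal logVal_mul isCompact_logVal_eq_zero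
    (fun γ ↦ (hγ γ).units_map (γ : E →* E)) (Or.inr ?_) fun c hc ↦ ?_
  -- Any nonzero element of the maximal ideal serves: its conjugates remain topologically nilpotent.
  · obtain ⟨x, hx0, hx⟩ := Valuation.IsNontrivial.exists_lt_one (v := valuation E)
    have hx0 : x ≠ 0 := by simpa using hx0
    exact ⟨Units.mk0 x hx0, logVal_lt_zero_iff.mpr hx, fun γ ↦
      logVal_lt_zero_iff.mpr (valuation_map_lt_one (hγ γ) hx)⟩
  · rw [logVal_eq_zero_iff]
    constructor
    · rintro ⟨u, hu, rfl⟩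
      have hu1 : nonarchLocalAbs F u = 1 := congrArg Units.val (MonoidHom.mem_ker.mp hu)
      exact (valuation_map_eq_one_iff hcont).mpr ((habs _).mp hu1)
    · intro h1
      obtain ⟨x, hx⟩ := (IsGalois.mem_range_algebraMap_iff_fixed (c : E)).mpr
        fun γ ↦ congrArg Units.val (hc γ)
      have hx0 : x ≠ 0 := by
        rintro rfl
        exact c.ne_zero (by rw [← hx, map_zero])
      rw [← hx] at h1
      exact ⟨Units.mk0 x hx0, MonoidHom.mem_ker.mpr
        (Units.ext ((habs x).mpr ((valuation_map_eq_one_iff hcont).mp h1))), Units.ext hx⟩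


/-! ## Non-Archimedean places -/

namespace NonarchPlace

variable {K : Type*} [Field K]

/-- The normalized valuation of a place. -/
noncomputable abbrev val (v : NonarchPlace K) : Valuation K ℤᵐ⁰ := v.prime.valuation K

theorem one_lt_q (v : NonarchPlace K) : 1 < v.q := Finite.one_lt_card

theorem one_lt_q' (v : NonarchPlace K) : 1 < (v.q : ℝ≥0) := by exact_mod_cast v.one_lt_q

theorem one_lt_q_real (v : NonarchPlace K) : 1 < (v.q : ℝ) := by exact_mod_cast v.one_lt_q

theorem valued_algebraMap (v : NonarchPlace K) (x : K) :
    Valued.v (algebraMap K v.Completion x) = v.val x :=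
  HeightOneSpectrum.valuedAdicCompletion_eq_valuation' _ _

theorem normAbs_eq (v : NonarchPlace K) (x : v.Completion) :
    v.normAbs x = WithZeroMulInt.toNNReal v.q_ne_zero (Valued.v x) := rfl

theorem normAbs_algebraMap (v : NonarchPlace K) (x : K) :
    v.normAbs (algebraMap K v.Completion x) = WithZeroMulInt.toNNReal v.q_ne_zero (v.val x) := by
  rw [normAbs_eq, valued_algebraMap]

theorem toNNReal_exp (v : NonarchPlace K) (n : ℤ) :
    (WithZeroMulInt.toNNReal v.q_ne_zero (WithZero.exp n) : ℝ) = (v.q : ℝ) ^ n := by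
  rw [WithZeroMulInt.toNNReal_neg_apply _ WithZero.exp_ne_zero, WithZero.toAdd_unzero_eq_log,
    WithZero.log_exp]
  push_cast
  rfl

theorem normAbs_eq_zpow (v : NonarchPlace K) {x : v.Completion} (hx : x ≠ 0) :
    (v.normAbs x : ℝ) = (v.q : ℝ) ^ (WithZero.log (Valued.v x)) := by
  rw [normAbs_eq, ← toNNReal_exp, WithZero.exp_log ((Valuation.ne_zero_iff _).mpr hx)]

theorem normAbs_le_one_iff (v : NonarchPlace K) {x : v.Completion} :
    v.normAbs x ≤ 1 ↔ Valued.v x ≤ 1 :=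
  WithZeroMulInt.toNNReal_le_one_iff v.one_lt_q'

theorem exists_uniformizer (v : NonarchPlace K) : ∃ π : K, π ≠ 0 ∧ v.val π = WithZero.exp (-1) := by
  obtain ⟨π, hπ⟩ := v.prime.valuation_exists_uniformizer K
  refine ⟨π, ?_, hπ⟩
  rintro rfl
  rw [map_zero] at hπ
  exact WithZero.exp_ne_zero hπ.symm

theorem valuationSubring_val (v : NonarchPlace K) : v.val.valuationSubring = v.ring := by
  ext x
  exact v.valuation_le_one_iff x

/-- A normalized valuation with the same valuation ring as `v` is that of `v`. -/
theorem eq_val_of_valuationSubring_eq (v : NonarchPlace K) {u : Valuation K ℤᵐ⁰}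
    (hu : ∃ ϖ, u ϖ = WithZero.exp (-1)) (h : u.valuationSubring = v.ring) : u = v.val := by
  have heq : u.IsEquiv v.val :=
    (Valuation.isEquiv_iff_valuationSubring _ _).mpr (h.trans v.valuationSubring_val.symm)
  obtain ⟨π, hπ0, hπ⟩ := v.exists_uniformizer
  have hπ1 : u π < 1 := by
    rw [heq.lt_one_iff_lt_one, hπ, ← WithZero.exp_zero]
    exact WithZero.exp_lt_exp.mpr (by norm_num)
  -- Up to a power of the uniformizer `π`, `x` is a unit for `v`, hence for the equivalent valuation
  -- `u`.
  have hpow (x : K) (hx : x ≠ 0) : u x = u π ^ (-WithZero.log (v.val x)) := by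
    have h1 : v.val (x * π ^ (WithZero.log (v.val x))) = 1 := by
      rw [map_mul, map_zpow₀, hπ, ← WithZero.exp_zsmul, smul_eq_mul, mul_neg_one, WithZero.exp_neg,
        WithZero.exp_log ((Valuation.ne_zero_iff _).mpr hx),
        mul_inv_cancel₀ ((Valuation.ne_zero_iff _).mpr hx)]
    rw [← heq.eq_one_iff_eq_one, map_mul, map_zpow₀] at h1
    rw [zpow_neg]
    exact eq_inv_of_mul_eq_one_left h1
  obtain ⟨ϖ, hϖ⟩ := hu
  have hϖ0 : ϖ ≠ 0 := by
    rintro rfl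
    rw [map_zero] at hϖ
    exact WithZero.exp_ne_zero hϖ.symm
  -- `exp (-1)` is a power of `u π`, so the logarithm of `u π` divides `-1`; it is negative since
  -- `π` is not a unit.
  have huπ : u π = WithZero.exp (-1) := by
    have h1 := hpow ϖ hϖ0
    have h2 : u π = WithZero.exp (WithZero.log (u π)) :=
      (WithZero.exp_log ((Valuation.ne_zero_iff _).mpr hπ0)).symm
    rw [hϖ, h2, ← WithZero.exp_zsmul, WithZero.exp_inj, smul_eq_mul] at h1
    rw [h2, ← WithZero.exp_zero, WithZero.exp_lt_exp] at hπ1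
    rw [h2]
    congr 1
    rcases Int.eq_one_or_neg_one_of_mul_eq_neg_one h1.symm with h3 | h3
    · rw [h3, one_mul] at h1
      exact h1.symm
    · rw [h3] at h1
      lia
  ext x
  rcases eq_or_ne x 0 with rfl | hx
  · simp
  rw [hpow x hx, huπ, ← WithZero.exp_zsmul, smul_eq_mul, neg_mul_neg, mul_one,
    WithZero.exp_log ((Valuation.ne_zero_iff _).mpr hx)]

/-- The normalized absolute value on `K`. -/
noncomputable def abv (v : NonarchPlace K) : AbsoluteValue K ℝ := v.prime.adicAbv v.one_lt_q'

theorem abv_eq (v : NonarchPlace K) (x : K) :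
    v.abv x = WithZeroMulInt.toNNReal v.q_ne_zero (v.val x) := rfl

theorem normAbs_algebraMap_eq_abv (v : NonarchPlace K) (x : K) :
    (v.normAbs (algebraMap K v.Completion x) : ℝ) = v.abv x := by
  rw [normAbs_algebraMap, abv_eq]

theorem abv_lt_one_iff (v : NonarchPlace K) {x : K} : v.abv x < 1 ↔ v.val x < 1 := by
  rw [abv_eq, ← NNReal.coe_one, NNReal.coe_lt_coe]
  exact WithZeroMulInt.toNNReal_lt_one_iff v.one_lt_q'

theorem abv_le_one_iff (v : NonarchPlace K) {x : K} : v.abv x ≤ 1 ↔ v.val x ≤ 1 := by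
  rw [abv_eq, ← NNReal.coe_one, NNReal.coe_le_coe]
  exact WithZeroMulInt.toNNReal_le_one_iff v.one_lt_q'

theorem abv_eq_zpow (v : NonarchPlace K) {x : K} (hx : x ≠ 0) :
    v.abv x = (v.q : ℝ) ^ (WithZero.log (v.val x)) := by
  rw [abv_eq, ← toNNReal_exp, WithZero.exp_log ((Valuation.ne_zero_iff _).mpr hx)]

theorem abv_isNontrivial (v : NonarchPlace K) : v.abv.IsNontrivial := by
  obtain ⟨π, hπ0, hπ⟩ := v.exists_uniformizer
  refine ⟨π, hπ0, (v.abv_lt_one_iff.mpr ?_).ne⟩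
  rw [hπ, ← WithZero.exp_zero]
  exact WithZero.exp_lt_exp.mpr (by norm_num)

theorem eq_of_abv_isEquiv {v w : NonarchPlace K} (h : v.abv.IsEquiv w.abv) : v = w := by
  ext x
  rw [← valuation_le_one_iff, ← valuation_le_one_iff, ← abv_le_one_iff, ← abv_le_one_iff]
  have := h x 1
  rwa [map_one, map_one] at this

/-- Weak approximation at finitely many non-Archimedean places. -/
theorem weak_approximation (S : Set (NonarchPlace K)) [Finite S] (y : S → K) {ε : ℝ} (hε : 0 < ε) :
    ∃ x : K, ∀ v : S, v.1.abv (x - y v) < ε := by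
  classical
  have := Fintype.ofFinite S
  have hd := AbsoluteValue.denseRange_algebraMap_pi (v := fun v : S ↦ v.1.abv)
    (fun v ↦ v.1.abv_isNontrivial) fun v w hvw h ↦ hvw (Subtype.ext (eq_of_abv_isEquiv h))
  obtain ⟨x, hx⟩ := Metric.denseRange_iff.mp hd (fun v ↦ WithAbs.toAbs v.1.abv (y v)) ε hε
  refine ⟨x, fun v ↦ ?_⟩
  rw [dist_comm, dist_pi_lt_iff hε] at hx
  have := hx v
  rw [dist_eq_norm, WithAbs.norm_eq_apply_ofAbs] at this
  exact this

/-- The valuation ring of a discrete valuation with values in `ℤ` is a discrete valuation ring. -/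
theorem _root_.Valuation.isDiscreteValuationRing_of_int (u : Valuation K ℤᵐ⁰)
    (h : ∃ x, x ≠ 0 ∧ u x ≠ 1) : IsDiscreteValuationRing u.valuationSubring := by
  have : u.IsNontrivial := ⟨by
    obtain ⟨x, hx, hx'⟩ := h
    exact ⟨x, by simpa using hx, hx'⟩⟩
  infer_instance

theorem mem_of_isIntegral (v : NonarchPlace K) {R : Type*} [CommRing R] [Algebra R K]
    (hR : ∀ r : R, algebraMap R K r ∈ v.ring) {x : K} (hx : IsIntegral R x) : x ∈ v.ring := by
  let φ : R →+* v.ring := (algebraMap R K).codRestrict v.ring.toSubring hR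
  have hx' : IsIntegral v.ring x := by
    obtain ⟨p, hp, h⟩ := hx
    refine ⟨p.map φ, hp.map φ, ?_⟩
    rw [Polynomial.eval₂_map]
    exact h
  obtain ⟨y, rfl⟩ := IsIntegrallyClosed.isIntegral_iff.mp hx'
  exact y.2

theorem ring_ne_top (v : NonarchPlace K) : ∃ x : K, x ∉ v.ring := by
  obtain ⟨π, hπ0, hπ⟩ := v.exists_uniformizer
  refine ⟨π⁻¹, (v.valuation_lt_one_iff hπ0).mp ?_⟩
  rw [hπ, ← WithZero.exp_zero]
  exact WithZero.exp_lt_exp.mpr (by norm_num)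

/-- The place of `K` below a place `w` of an algebraic extension `L`. -/
def under (K : Type*) {L : Type*} [Field K] [Field L] [Algebra K L] [Algebra.IsIntegral K L]
    (w : NonarchPlace L) : NonarchPlace K where
  ring := w.ring.comap (algebraMap K L)
  isDVR := by
    have h : (w.val.comap (algebraMap K L)).valuationSubring = w.ring.comap (algebraMap K L) := by
      ext x
      exact w.valuation_le_one_iff _
    rw [← h]
    refine Valuation.isDiscreteValuationRing_of_int _ ?_
    -- If the restricted valuation were trivial, all of `K` would lie in `w.ring`, and so would `L`,
    -- being integral over `K`.
    by_contra! hall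
    obtain ⟨x, hx⟩ := w.ring_ne_top
    refine hx (w.mem_of_isIntegral (R := K) (fun r ↦ ?_) (Algebra.IsIntegral.isIntegral x))
    rw [← w.valuation_le_one_iff]
    rcases eq_or_ne r 0 with rfl | hr
    · simp
    · exact (hall r hr).le
  finite_residue := by
    let f : w.ring.comap (algebraMap K L) →+* w.ring :=
      ((algebraMap K L).comp (w.ring.comap (algebraMap K L)).subtype).codRestrict
        w.ring.toSubring fun x ↦ x.2
    have : IsLocalHom f := ⟨fun x hx ↦ by
      have hx0 : (x : K) ≠ 0 := by
        intro h
        have : f x = 0 := Subtype.ext (by change algebraMap K L x = 0; rw [h, map_zero])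
        rw [this] at hx
        exact not_isUnit_zero hx
      have hinv : (algebraMap K L x)⁻¹ ∈ w.ring := by
        obtain ⟨y, hy⟩ := isUnit_iff_exists_inv.mp hx
        have hy' : algebraMap K L x * y = 1 := congrArg Subtype.val hy
        rw [← eq_inv_of_mul_eq_one_right hy']
        exact y.2
      rw [← map_inv₀] at hinv
      exact isUnit_iff_exists_inv.mpr ⟨⟨(x : K)⁻¹, hinv⟩, Subtype.ext (mul_inv_cancel₀ hx0)⟩⟩
    exact Finite.of_injective _ (IsLocalRing.ResidueField.map f).injective

/-- Density of `K` in the completion makes the residue field of `v.ring`, finite by definition,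
surject onto that of the completed ring. -/
theorem finite_residueField_integers (v : NonarchPlace K) :
    Finite (IsLocalRing.ResidueField v.Integers) := by
  let g : v.ring →+* IsLocalRing.ResidueField v.Integers :=
    (IsLocalRing.residue v.Integers).comp (algebraMap v.ring v.Integers)
  have hg (a : v.ring) : g a = 0 ↔ v.val (a : K) < 1 := by
    change IsLocalRing.residue _ _ = 0 ↔ _
    rw [IsLocalRing.residue_eq_zero_iff]
    refine (Valuation.mem_maximalIdeal_iff _ _).trans ?_
    rw [← valued_algebraMap]
    rfl
  have hsurj : Function.Surjective g := by
    intro y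
    obtain ⟨y, rfl⟩ := IsLocalRing.residue_surjective y
    have hnhds : {z : v.Completion | Valued.v z < 1} ∈ nhds 0 := by
      have h1 := (Valued.isOpen_ball v.Completion 1).mem_nhds (x := 0) (by simp)
      refine Filter.mem_of_superset h1 fun z hz ↦ ?_
      simpa [Valuation.restrict_lt_one_iff] using hz
    obtain ⟨x, hx⟩ := (HeightOneSpectrum.denseRange_algebraMap K v.prime).mem_nhds
      ((continuous_sub_right (y : v.Completion)).continuousAt (x := (y : v.Completion))
        (by rw [sub_self]; exact hnhds))
    have hx : Valued.v (algebraMap K v.Completion x - y) < 1 := hx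
    have hx1 : v.val x ≤ 1 := by
      rw [← valued_algebraMap, ← sub_add_cancel (algebraMap K v.Completion x) (y : v.Completion)]
      exact (Valuation.map_add _ _ _).trans (max_le hx.le y.2)
    refine ⟨⟨x, (v.valuation_le_one_iff x).mp hx1⟩, ?_⟩
    change IsLocalRing.residue _ _ = _
    rw [← sub_eq_zero, ← map_sub, IsLocalRing.residue_eq_zero_iff]
    exact (Valuation.mem_maximalIdeal_iff _ _).mpr hx
  let g' : IsLocalRing.ResidueField v.ring →+* IsLocalRing.ResidueField v.Integers :=
    Ideal.Quotient.lift _ g fun a ha ↦ by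
      rw [hg, ← not_le]
      intro h
      have h1 : v.val (a : K) = 1 := le_antisymm ((v.valuation_le_one_iff _).mpr a.2) h
      have ha0 : (a : K) ≠ 0 := by
        intro h
        rw [h, map_zero] at h1
        exact zero_ne_one h1
      have h2 : (a : K)⁻¹ ∈ v.ring := by
        rw [← v.valuation_le_one_iff, map_inv₀, h1, inv_one]
      refine (IsLocalRing.mem_maximalIdeal _).mp ha
        (isUnit_iff_exists_inv.mpr ⟨⟨(a : K)⁻¹, h2⟩, Subtype.ext (mul_inv_cancel₀ ha0)⟩)
  exact Finite.of_surjective g' (Ideal.Quotient.lift_surjective_of_surjective _ _ hsurj)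

theorem isCompact_integers (v : NonarchPlace K) : IsCompact (v.Integers : Set v.Completion) := by
  let := Valuation.IsRankOneDiscrete.rankOne
    (Valued.v : Valuation (v.prime.adicCompletion K) ℤᵐ⁰) v.one_lt_q'
  have h1 : IsDiscreteValuationRing (Valued.integer v.Completion) :=
    inferInstanceAs (IsDiscreteValuationRing (v.prime.adicCompletionIntegers K))
  have h2 : Finite (IsLocalRing.ResidueField (Valued.integer v.Completion)) :=
    v.finite_residueField_integers
  have h3 : CompleteSpace (Valued.integer v.Completion) :=
    (Valued.isClosed_integer v.Completion).completeSpace_coe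
  exact isCompact_iff_compactSpace.mpr
    (Valued.integer.compactSpace_iff_completeSpace_and_isDiscreteValuationRing_and_finite_residueField.mpr
      ⟨h3, h1, h2⟩)

theorem isOpen_integers (v : NonarchPlace K) : IsOpen (v.Integers : Set v.Completion) :=
  Valued.isOpen_valuationSubring _

end NonarchPlace


/-! ## Function fields of one variable over `𝔽_p` -/

/-- `b` is linearly independent over `k[x]`. -/
def PolyIndependent {k K ι : Type*} [Field k] [Field K] [Algebra k K] [Fintype ι] (x : K)
    (b : ι → K) : Prop :=
  ∀ f : ι → Polynomial k, ∑ i, Polynomial.aeval x (f i) * b i = 0 → f = 0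

/-- `K` is a field of transcendence degree one over `k`, and for all transcendental `x` there is
a bound for the size of families that are linearly independent over `k[x]`. -/
class IsFunctionField (k K : Type*) [Field k] [Field K] [Algebra k K] : Prop where
  exists_transcendental : ∃ x : K, Transcendental k x
  exists_max_polyIndependent (x : K) (hx : Transcendental k x) :
    ∃ (N : ℕ) (u : Fin N → K), PolyIndependent (k := k) x u ∧
      ∀ (M : ℕ) (b : Fin M → K), PolyIndependent (k := k) x b → M ≤ N

open IntermediateField in
open scoped IntermediateField.algebraAdjoinAdjoin in
-- Clearing denominators passes from `k[x]` to its fraction field `k(x)`; hence the degree of `K`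
-- over `k(x)` bounds the size of independent families.
theorem PolyIndependent.linearIndependent {k K ι : Type*} [Field k] [Field K] [Algebra k K]
    [Fintype ι] {x : K} {b : ι → K} (h : PolyIndependent (k := k) x b) :
    LinearIndependent k⟮x⟯ b := by
  rw [← LinearIndependent.iff_fractionRing (Algebra.adjoin k {x}), Fintype.linearIndependent_iff]
  intro g hg i
  have hmem (i) : ∃ f : Polynomial k, Polynomial.aeval x f = (g i : K) := by
    exact (Algebra.adjoin_singleton_eq_range_aeval k x).le (g i).2
  choose f hf using hmem
  have := h f (by simp only [hf]; exact hg)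
  ext
  rw [← hf, this]
  simp

open IntermediateField in
-- In transcendence degree one every transcendental `x`, not just the given `t`, is a transcendence
-- basis; then `K` is algebraic and essentially of finite type over `k(x)`, so of finite degree.
theorem IsFunctionField.of_trdeg {k K : Type*} [Field k] [Field K] [Algebra k K]
    [Algebra.EssFiniteType k K] {t : K}
    (ht : IsTranscendenceBasis k fun _ : Unit ↦ t) : IsFunctionField k K where
  exists_transcendental :=
    ⟨t, (algebraicIndependent_unique_type_iff (x := fun _ : Unit ↦ t)).mp ht.1⟩
  exists_max_polyIndependent x hx := by
    have h1 : IsTranscendenceBasis k fun _ : Unit ↦ x := by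
      refine AlgebraicIndependent.isTranscendenceBasis_of_lift_trdeg_le_of_finite
        ((algebraicIndependent_unique_type_iff (x := fun _ : Unit ↦ x)).mpr hx) ?_
      rw [← ht.lift_cardinalMk_eq_trdeg]
    have h2 : Algebra.IsAlgebraic k⟮x⟯ K := by
      have := h1.isAlgebraic_field
      rwa [Set.range_const] at this
    have h3 : Algebra.EssFiniteType k⟮x⟯ K := Algebra.EssFiniteType.of_comp k _ _
    have h4 : FiniteDimensional k⟮x⟯ K := Algebra.finite_of_essFiniteType_of_isAlgebraic
    let s : Set ℕ := {M | ∃ b : Fin M → K, PolyIndependent (k := k) x b}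
    have hs (M : ℕ) (hM : M ∈ s) : M ≤ Module.finrank k⟮x⟯ K := by
      obtain ⟨b, hb⟩ := hM
      simpa using hb.linearIndependent.fintype_card_le_finrank
    have hs0 : 0 ∈ s := ⟨Fin.elim0, fun f _ ↦ Subsingleton.elim _ _⟩
    obtain ⟨u, hu⟩ := Nat.sSup_mem ⟨0, hs0⟩ ⟨_, hs⟩
    exact ⟨sSup s, u, hu, fun M b hb ↦ le_csSup ⟨_, hs⟩ ⟨b, hb⟩⟩

theorem RatFunc.essFiniteType (k : Type*) [Field k] : Algebra.EssFiniteType k (RatFunc k) := by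
  have : Algebra.EssFiniteType (Polynomial k) (RatFunc k) :=
    .of_isLocalization _ (nonZeroDivisors (Polynomial k))
  exact .comp k (Polynomial k) _

theorem RatFunc.isTranscendenceBasis (k : Type*) [Field k] : IsTranscendenceBasis k
    fun _ : Unit ↦ (algebraMap (Polynomial k) (RatFunc k) Polynomial.X) := by
  have h1 : IsTranscendenceBasis k fun _ : Unit ↦ (Polynomial.X : Polynomial k) :=
    .polynomial Unit k
  have : Algebra.IsAlgebraic (Polynomial k) (RatFunc k) :=
    IsLocalization.isAlgebraic _ (nonZeroDivisors (Polynomial k))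
  exact h1.algebraMap_comp (A := RatFunc k)

theorem IsFunctionField.of_ratFunc (k K : Type*) [Field k] [Field K] [Algebra k K]
    [Algebra (RatFunc k) K] [IsScalarTower k (RatFunc k) K] [FiniteDimensional (RatFunc k) K] :
    IsFunctionField k K := by
  have := RatFunc.essFiniteType k
  have : Algebra.EssFiniteType k K := .comp k (RatFunc k) _
  have h := (RatFunc.isTranscendenceBasis k).algebraMap_comp (A := K)
  exact .of_trdeg (t := algebraMap (RatFunc k) K (algebraMap (Polynomial k) _ Polynomial.X)) h

namespace IsFunctionField

open Polynomial in
/-- If `x⁻¹ A ⊆ A`, then the index of `x⁻¹ A` in `A` is at most `p ^ N`. -/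
theorem card_quotient_le {p : ℕ} [Fact p.Prime] {K : Type*} [Field K] [Algebra (ZMod p) K]
    {x : K} (hx : x ≠ 0) {N : ℕ}
    (hN : ∀ (M : ℕ) (b : Fin M → K), PolyIndependent (k := ZMod p) x b → M ≤ N)
    (A : Submodule (ZMod p) K) (hA : ∀ a ∈ A, x⁻¹ * a ∈ A) (B : Submodule (ZMod p) A)
    (hB : ∀ b : A, b ∈ B ↔ x * b ∈ A) :
    Finite (A ⧸ B) ∧ Nat.card (A ⧸ B) ≤ p ^ N := by
  -- Representatives of classes that are independent modulo `x⁻¹ A` are independent over `𝔽_p[x]`,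
  -- so the dimension of the quotient is at most `N`.
  have key (s : Finset (A ⧸ B)) (hs : LinearIndependent (ZMod p) ((↑) : s → A ⧸ B)) :
      s.card ≤ N := by
    choose b hb using fun i : Fin s.card ↦ B.mkQ_surjective (s.equivFin.symm i : A ⧸ B)
    have hs' := hs.comp _ s.equivFin.symm.injective
    refine hN _ (fun i ↦ b i) fun f hf ↦ ?_
    by_contra hf0
    obtain ⟨i₀, hi₀⟩ := Function.ne_iff.mp hf0
    obtain ⟨i₁, hi₁0, hi₁⟩ := Finset.exists_max_image (Finset.univ.filter fun i ↦ f i ≠ 0)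
      (fun i ↦ (f i).natDegree) ⟨i₀, by simpa using hi₀⟩
    set D := (f i₁).natDegree with hD
    have hD' (i) : (f i).natDegree ≤ D := by
      by_cases hi : f i = 0
      · simp [hi]
      · exact hi₁ i (by simpa using hi)
    have hmem (g : (ZMod p)[X]) (a : A) : aeval x⁻¹ g * a ∈ A := by
      induction g using Polynomial.induction_on' with
      | add g h hg hh => rw [map_add, add_mul]; exact add_mem hg hh
      | monomial n c =>
        have hpow : x⁻¹ ^ n * (a : K) ∈ A := by
          induction n with
          | zero => simp
          | succ n ih => rw [pow_succ', mul_assoc]; exact hA _ ih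
        rw [aeval_monomial, mul_assoc, ← Algebra.smul_def]
        exact A.smul_mem _ hpow
    -- Dividing a relation by `x ^ D`, with `D` the largest degree, gives polynomials in `x⁻¹`,
    -- which preserve `A`. Their constant terms are the coefficients of degree `D`, and only these
    -- survive modulo `x⁻¹ A`.
    have hrefl (i) : aeval x⁻¹ (reflect D (f i)) * x ^ D = aeval x (f i) := by
      let := invertibleOfNonzero hx
      have := eval₂_reflect_mul_pow (algebraMap (ZMod p) K) x D (f i) (hD' i)
      rwa [invOf_eq_inv] at this
    have h1 : ∑ i, aeval x⁻¹ (reflect D (f i)) * (b i : K) = 0 := by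
      have : (∑ i, aeval x⁻¹ (reflect D (f i)) * (b i : K)) * x ^ D = 0 := by
        rw [← hf, Finset.sum_mul]
        exact Finset.sum_congr rfl fun i _ ↦ by rw [← hrefl]; ring
      exact (mul_eq_zero.mp this).resolve_right (pow_ne_zero _ hx)
    have h2 : ∑ i, (f i).coeff D • b i ∈ B := by
      rw [hB]
      have h3 (i) : aeval x⁻¹ (reflect D (f i)) =
          aeval x⁻¹ (divX (reflect D (f i))) * x⁻¹ + algebraMap _ K ((f i).coeff D) := by
        conv_lhs => rw [← divX_mul_X_add (reflect D (f i))]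
        simp [coeff_reflect]
      have h4 : x * ((∑ i, (f i).coeff D • b i : A) : K) =
          -∑ i, aeval x⁻¹ (divX (reflect D (f i))) * (b i : K) := by
        simp only [h3, add_mul, Finset.sum_add_distrib] at h1
        rw [eq_neg_iff_add_eq_zero, ← mul_zero x, ← h1, mul_add, add_comm, Finset.mul_sum,
          AddSubmonoidClass.coe_finsetSum, Finset.mul_sum, Finset.mul_sum]
        congr 1
        · refine Finset.sum_congr rfl fun i _ ↦ ?_
          field_simp
        · refine Finset.sum_congr rfl fun i _ ↦ ?_
          rw [Submodule.coe_smul, Algebra.smul_def]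
      rw [h4]
      exact neg_mem (sum_mem fun i _ ↦ hmem _ _)
    have h5 : ∑ i, (f i).coeff D • (s.equivFin.symm i : A ⧸ B) = 0 := by
      rw [← (Submodule.Quotient.mk_eq_zero B).mpr h2, ← Submodule.mkQ_apply, map_sum]
      exact Finset.sum_congr rfl fun i _ ↦ by rw [map_smul, hb]
    have h6 := Fintype.linearIndependent_iff.mp hs' _ h5 i₁
    rw [hD] at h6
    exact (Finset.mem_filter.mp hi₁0).2 (leadingCoeff_eq_zero.mp h6)
  have hrank : Module.rank (ZMod p) (A ⧸ B) ≤ N := rank_le key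
  have hfin : Module.Finite (ZMod p) (A ⧸ B) :=
    Module.rank_lt_aleph0_iff.mp (hrank.trans_lt Cardinal.natCast_lt_aleph0)
  refine ⟨Module.finite_of_finite (ZMod p), ?_⟩
  rw [Module.natCard_eq_pow_finrank (K := ZMod p), Nat.card_zmod]
  exact Nat.pow_le_pow_right (Fact.out : p.Prime).pos (Module.finrank_le_of_rank_le hrank)

end IsFunctionField


/-! ### Counting elements with bounded poles -/

namespace NonarchPlace

variable {K : Type*} [Field K]

theorem mem_maximalIdeal_pow_iff (v : NonarchPlace K) (n : ℕ) (a : v.ring) :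
    a ∈ IsLocalRing.maximalIdeal v.ring ^ n ↔ v.val (a : K) ≤ WithZero.exp (-(n : ℤ)) := by
  have h := v.prime.intValuation_le_pow_iff_mem a n
  rw [← HeightOneSpectrum.valuation_of_algebraMap (K := K)] at h
  exact h.symm

theorem card_quotient_maximalIdeal_pow (v : NonarchPlace K) (n : ℕ) :
    Nat.card (v.ring ⧸ IsLocalRing.maximalIdeal v.ring ^ n) = v.q ^ n := by
  have : (IsLocalRing.maximalIdeal v.ring).IsPrime := inferInstance
  exact cardQuot_pow_of_prime (P := IsLocalRing.maximalIdeal v.ring)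
    (IsDiscreteValuationRing.not_a_field v.ring)

instance (v : NonarchPlace K) (n : ℕ) : Finite (v.ring ⧸ IsLocalRing.maximalIdeal v.ring ^ n) :=
  Nat.finite_of_card_ne_zero (by
    rw [card_quotient_maximalIdeal_pow]
    exact pow_ne_zero _ (zero_lt_one.trans v.one_lt_q).ne')

theorem abv_lt_zpow_iff (v : NonarchPlace K) {x : K} {n : ℤ} :
    v.abv x < (v.q : ℝ) ^ n ↔ v.val x < WithZero.exp n := by
  rw [abv_eq, ← toNNReal_exp, NNReal.coe_lt_coe]
  exact (WithZeroMulInt.toNNReal_strictMono v.one_lt_q').lt_iff_lt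

theorem exists_forall_val_sub_le {S : Set (NonarchPlace K)} [Finite S] (y : S → K) (n : S → ℤ) :
    ∃ x : K, ∀ v : S, v.1.val (x - y v) ≤ WithZero.exp (n v) := by
  have h : ∀ᶠ ε : ℝ in nhdsWithin 0 (Set.Ioi 0), ∀ v : S, ε < (v.1.q : ℝ) ^ n v := by
    rw [Filter.eventually_all]
    exact fun v ↦ nhdsWithin_le_nhds (eventually_lt_nhds
      (zpow_pos (zero_lt_one.trans v.1.one_lt_q_real) _))
  obtain ⟨ε, hε, hε0⟩ := (h.and self_mem_nhdsWithin).exists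
  obtain ⟨x, hx⟩ := weak_approximation S y hε0
  exact ⟨x, fun v ↦ (v.1.abv_lt_zpow_iff.mp ((hx v).trans (hε v))).le⟩

/-- The elements with prescribed bounds at all places. -/
def boundedBy (D : NonarchPlace K → ℤ) : AddSubgroup K where
  carrier := {z | ∀ v : NonarchPlace K, v.val z ≤ WithZero.exp (D v)}
  zero_mem' v := by simp
  add_mem' hx hy v := (Valuation.map_add _ _ _).trans (max_le (hx v) (hy v))
  neg_mem' hx v := by rw [Valuation.map_neg]; exact hx v

/-- Scaling by a power of a uniformizer puts the elements bounded by `D'` into the valuation ring,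
and the stronger bound `D` follows from vanishing modulo a power of the maximal ideal. So the
quotient injects into a product of finite rings. -/
theorem card_le_card_inf_boundedBy_mul (G : AddSubgroup K) [Finite G] {D D' : NonarchPlace K → ℤ}
    (hG : G ≤ boundedBy D') (S : Finset (NonarchPlace K)) (n : NonarchPlace K → ℕ)
    (hn : ∀ v ∈ S, D' v ≤ D v + n v) (hS : ∀ v ∉ S, D' v ≤ D v) :
    Nat.card G ≤ Nat.card (G ⊓ boundedBy D : AddSubgroup K) * ∏ v ∈ S, v.q ^ n v := by
  classical
  choose π hπ0 hπ using fun v : NonarchPlace K ↦ v.exists_uniformizer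
  have hval (v : NonarchPlace K) (m : ℤ) (z : K) :
      v.val (π v ^ m * z) = WithZero.exp (-m) * v.val z := by
    rw [map_mul, map_zpow₀, hπ, ← WithZero.exp_zsmul, smul_eq_mul, mul_neg_one]
  have hint (v : NonarchPlace K) (z : G) : π v ^ (D' v) * (z : K) ∈ v.ring := by
    rw [← valuation_le_one_iff, hval, WithZero.exp_neg,
      inv_mul_le_one₀ (zero_lt_iff.mpr WithZero.exp_ne_zero)]
    exact hG z.2 v
  let f : G →+ ∀ v : S, v.1.ring ⧸ IsLocalRing.maximalIdeal v.1.ring ^ n v :=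
    { toFun z v := Ideal.Quotient.mk _ ⟨_, hint v z⟩
      map_zero' := by
        ext v
        simp [← ZeroMemClass.zero_def]
      map_add' z w := by
        ext v
        rw [Pi.add_apply, ← map_add]
        congr 1
        ext
        simp [mul_add] }
  have hker : Nat.card f.ker ≤ Nat.card (G ⊓ boundedBy D : AddSubgroup K) := by
    have : Finite (G ⊓ boundedBy D : AddSubgroup K) :=
      Finite.of_injective _ (AddSubgroup.inclusion_injective (inf_le_left : G ⊓ boundedBy D ≤ G))
    refine Nat.card_le_card_of_injective (fun z ↦ ⟨z.1.1, z.1.2, fun v ↦ ?_⟩) ?_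
    · by_cases hv : v ∈ S
      · have h1 : f z.1 ⟨v, hv⟩ = 0 := by rw [z.2]; rfl
        have h2 := (v.mem_maximalIdeal_pow_iff _ _).mp (Ideal.Quotient.eq_zero_iff_mem.mp h1)
        rw [hval, WithZero.exp_neg, inv_mul_le_iff₀ (zero_lt_iff.mpr WithZero.exp_ne_zero),
          ← WithZero.exp_add] at h2
        refine h2.trans (WithZero.exp_le_exp.mpr ?_)
        have := hn v hv
        dsimp only
        lia
      · exact (hG z.1.2 v).trans (WithZero.exp_le_exp.mpr (hS v hv))
    · intro z w h
      exact Subtype.ext (Subtype.ext (Subtype.mk.inj h))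
  have hrange : Nat.card (G ⧸ f.ker) ≤ ∏ v ∈ S, v.q ^ n v := by
    rw [Nat.card_congr (QuotientAddGroup.quotientKerEquivRange f).toEquiv]
    refine (Nat.card_le_card_of_injective _ Subtype.val_injective).trans_eq ?_
    rw [Nat.card_pi, ← Finset.prod_coe_sort S]
    exact Finset.prod_congr rfl fun v _ ↦ v.1.card_quotient_maximalIdeal_pow _
  rw [AddSubgroup.card_eq_card_quotient_mul_card_addSubgroup f.ker, mul_comm]
  exact Nat.mul_le_mul hker hrange

/-- The norm `∏ q_v ^ (D v)` of a divisor. -/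
noncomputable def divisorNorm (D : NonarchPlace K →₀ ℤ) : ℝ := D.prod fun v n ↦ (v.q : ℝ) ^ n

theorem divisorNorm_add (D D' : NonarchPlace K →₀ ℤ) :
    divisorNorm (D + D') = divisorNorm D * divisorNorm D' :=
  Finsupp.prod_add_index' (fun _ ↦ zpow_zero _)
    fun v _ _ ↦ zpow_add₀ (zero_lt_one.trans v.one_lt_q_real).ne' _ _

theorem divisorNorm_zero : divisorNorm (0 : NonarchPlace K →₀ ℤ) = 1 := Finsupp.prod_zero_index

theorem divisorNorm_pos (D : NonarchPlace K →₀ ℤ) : 0 < divisorNorm D :=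
  Finset.prod_pos fun v _ ↦ zpow_pos (zero_lt_one.trans v.one_lt_q_real) _

theorem divisorNorm_neg (D : NonarchPlace K →₀ ℤ) : divisorNorm (-D) = (divisorNorm D)⁻¹ := by
  rw [← mul_eq_one_iff_eq_inv₀ (divisorNorm_pos D).ne', ← divisorNorm_add, neg_add_cancel,
    divisorNorm_zero]

theorem divisorNorm_nsmul (n : ℕ) (D : NonarchPlace K →₀ ℤ) :
    divisorNorm (n • D) = divisorNorm D ^ n := by
  induction n with
  | zero => rw [zero_smul, divisorNorm_zero, pow_zero]
  | succ n ih => rw [succ_nsmul, divisorNorm_add, ih, pow_succ]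

theorem card_mul_divisorNorm_le (G : AddSubgroup K) [Finite G] {D D' : NonarchPlace K →₀ ℤ}
    (hD : D ≤ D') (hG : G ≤ boundedBy D') :
    Nat.card G * divisorNorm D ≤
      Nat.card (G ⊓ boundedBy D : AddSubgroup K) * divisorNorm D' := by
  have h := card_le_card_inf_boundedBy_mul G hG (D' - D).support (fun v ↦ ((D' - D) v).toNat)
    (D := D) (fun v _ ↦ by have := hD v; simp only [Finsupp.sub_apply]; lia)
    (fun v hv ↦ by
      have := Finsupp.notMem_support_iff.mp hv
      rw [Finsupp.sub_apply] at this
      lia)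
  have h2 : ((∏ v ∈ (D' - D).support, v.q ^ ((D' - D) v).toNat : ℕ) : ℝ) =
      divisorNorm (D' - D) := by
    rw [divisorNorm, Finsupp.prod, Nat.cast_prod]
    refine Finset.prod_congr rfl fun v _ ↦ ?_
    have := hD v
    rw [Nat.cast_pow, ← zpow_natCast, Int.toNat_of_nonneg (by simpa using this)]
  rw [← sub_add_cancel D' D, divisorNorm_add, ← mul_assoc, ← h2]
  refine mul_le_mul_of_nonneg_right ?_ (divisorNorm_pos D).le
  exact_mod_cast h

end NonarchPlace


/-! ### Finiteness of zeros and poles in function fields -/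

open NonarchPlace

namespace IsFunctionField

variable {p : ℕ} [Fact p.Prime] {K : Type*} [Field K] [Algebra (ZMod p) K]

theorem algebraMap_mem (V : ValuationSubring K) (a : ZMod p) : algebraMap (ZMod p) K a ∈ V := by
  rw [← ZMod.natCast_zmod_val a, map_natCast]
  exact natCast_mem V _

theorem val_eq_one_of_isAlgebraic (v : NonarchPlace K) {x : K} (hx : IsAlgebraic (ZMod p) x)
    (hx0 : x ≠ 0) : v.val x = 1 := by
  have h (y : K) (hy : IsAlgebraic (ZMod p) y) : v.val y ≤ 1 :=
    (v.valuation_le_one_iff y).mpr (v.mem_of_isIntegral (algebraMap_mem v.ring) hy.isIntegral)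
  have h1 := h x⁻¹ hx.inv
  rw [map_inv₀, inv_le_one₀ (zero_lt_iff.mpr ((Valuation.ne_zero_iff _).mpr hx0))] at h1
  exact le_antisymm (h x hx) h1

/-- The `𝔽_p`-subspace of elements that are integral for all valuation subrings in a family. -/
def integralAt {ι : Type*} (V : ι → ValuationSubring K) : Submodule (ZMod p) K where
  carrier := {z | ∀ i, z ∈ V i}
  add_mem' ha hb i := add_mem (ha i) (hb i)
  zero_mem' i := zero_mem _
  smul_mem' c z hz i := by
    rw [Algebra.smul_def]
    exact mul_mem (algebraMap_mem _ _) (hz i)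

/-- The fundamental inequality `∑ e f ≤ n` for the poles of `x`. -/
theorem prod_q_pow_le {x : K} (hx0 : x ≠ 0) {N : ℕ}
    (hN : ∀ (M : ℕ) (b : Fin M → K), PolyIndependent (k := ZMod p) x b → M ≤ N)
    (S : Finset (NonarchPlace K)) (e : NonarchPlace K → ℕ)
    (hS : ∀ v ∈ S, WithZero.exp (e v : ℤ) ≤ v.val x) : ∏ v ∈ S, v.q ^ e v ≤ p ^ N := by
  let A : Submodule (ZMod p) K := integralAt fun v : S ↦ v.1.ring
  have hxinv (v : S) : v.1.val x⁻¹ ≤ WithZero.exp (-(e v : ℤ)) := by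
    rw [map_inv₀, WithZero.exp_neg]
    exact inv_anti₀ (zero_lt_iff.mpr WithZero.exp_ne_zero) (hS v v.2)
  have hA (a) (ha : a ∈ A) : x⁻¹ * a ∈ A := by
    refine fun v ↦ mul_mem ?_ (ha v)
    rw [← valuation_le_one_iff]
    refine (hxinv v).trans ?_
    rw [← WithZero.exp_zero]
    exact WithZero.exp_le_exp.mpr (by lia)
  let B : Submodule (ZMod p) A :=
    (A.comap (LinearMap.mulLeft (ZMod p) x)).comap A.subtype
  obtain ⟨hfin, hcard⟩ := card_quotient_le hx0 hN A hA B fun b ↦ Iff.rfl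
  let f : A →+ ∀ v : S, v.1.ring ⧸ IsLocalRing.maximalIdeal v.1.ring ^ e v :=
    { toFun z v := Ideal.Quotient.mk _ ⟨_, z.2 v⟩
      map_zero' := rfl
      map_add' z w := rfl }
  have hf : B.toAddSubgroup ≤ f.ker := by
    intro z hz
    ext v
    refine Ideal.Quotient.eq_zero_iff_mem.mpr ?_
    rw [mem_maximalIdeal_pow_iff]
    have h1 : v.1.val (x * z) ≤ 1 := (v.1.valuation_le_one_iff _).mpr (hz v)
    have h2 : (z : K) = x⁻¹ * (x * z) := by field_simp
    change v.1.val (z : K) ≤ _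
    rw [h2, map_mul]
    exact (mul_le_mul' (hxinv v) h1).trans_eq (mul_one _)
  -- Weak approximation: the semilocal ring `A` surjects onto the product of the truncated valuation
  -- rings, so the size of `A` modulo `x⁻¹ A` bounds the product.
  have hsurj : Function.Surjective (QuotientAddGroup.lift B.toAddSubgroup f hf) := by
    intro y
    choose r hr using fun v ↦ Ideal.Quotient.mk_surjective (y v)
    obtain ⟨z, hz⟩ := exists_forall_val_sub_le (S := (S : Set (NonarchPlace K)))
      (fun v ↦ (r v : K)) (fun v ↦ -(e v : ℤ))
    have hz' (v : S) : z - r v ∈ v.1.ring := by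
      rw [← valuation_le_one_iff]
      refine (hz v).trans ?_
      rw [← WithZero.exp_zero]
      exact WithZero.exp_le_exp.mpr (by lia)
    have hzA : z ∈ A := fun v ↦ by
      rw [← sub_add_cancel z (r v : K)]
      exact add_mem (hz' v) (r v).2
    refine ⟨QuotientAddGroup.mk (⟨z, hzA⟩ : A), ?_⟩
    ext v
    rw [← hr v]
    refine (Ideal.Quotient.eq).mpr ?_
    rw [mem_maximalIdeal_pow_iff]
    exact hz v
  have : Finite (A ⧸ B.toAddSubgroup) := hfin
  have h1 := Nat.card_le_card_of_surjective _ hsurj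
  rw [Nat.card_pi] at h1
  rw [← Finset.prod_coe_sort S]
  refine le_trans (le_of_eq (Finset.prod_congr rfl fun v _ ↦ ?_)) (h1.trans hcard)
  exact (v.1.card_quotient_maximalIdeal_pow _).symm

/-- Each pole contributes a factor of at least `2` to a product bounded by `p ^ N`; `p ^ N` poles
would already be too many. -/
theorem finite_poles_of_transcendental [IsFunctionField (ZMod p) K] {x : K}
    (hx : Transcendental (ZMod p) x) : {v : NonarchPlace K | 1 < v.val x}.Finite := by
  obtain ⟨N, -, -, hN⟩ := exists_max_polyIndependent x hx
  by_contra hinf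
  obtain ⟨S, hS, hcard⟩ := (Set.Infinite.exists_subset_card_eq hinf (p ^ N))
  have hx0 : x ≠ 0 := by
    rintro rfl
    exact hx (isAlgebraic_zero)
  have h1 := prod_q_pow_le hx0 hN S (fun _ ↦ 1) (fun v hv ↦ by
    have h2 : 1 < v.val x := hS hv
    have h3 : WithZero.exp (WithZero.log (v.val x)) = v.val x :=
      WithZero.exp_log (ne_zero_of_lt h2)
    rw [← h3, ← WithZero.exp_zero, WithZero.exp_lt_exp] at h2
    rw [← h3, WithZero.exp_le_exp]
    lia)
  have h2 : 2 ^ S.card ≤ ∏ v ∈ S, v.q ^ 1 := by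
    rw [← Finset.prod_const]
    exact Finset.prod_le_prod' fun v _ ↦ by rw [pow_one]; exact v.one_lt_q
  rw [hcard] at h2
  exact absurd (h2.trans h1) (not_le.mpr Nat.lt_two_pow_self)

theorem finite_setOf_val_ne_one [IsFunctionField (ZMod p) K] {x : K} (hx0 : x ≠ 0) :
    {v : NonarchPlace K | v.val x ≠ 1}.Finite := by
  by_cases hx : IsAlgebraic (ZMod p) x
  · refine Set.finite_empty.subset fun v hv ↦ hv (val_eq_one_of_isAlgebraic v hx hx0)
  · have hx' : Transcendental (ZMod p) x⁻¹ := fun h ↦ hx (inv_inv x ▸ h.inv)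
    refine ((finite_poles_of_transcendental hx).union
      (finite_poles_of_transcendental hx')).subset fun v hv ↦ ?_
    rcases lt_or_gt_of_ne hv with h | h
    · right
      change 1 < v.val x⁻¹
      rw [map_inv₀, one_lt_inv₀ (zero_lt_iff.mpr ((Valuation.ne_zero_iff _).mpr hx0))]
      exact h
    · exact Or.inl h

end IsFunctionField


/-! ### Existence of poles -/

open NonarchPlace

namespace IsFunctionField

variable {p : ℕ} [Fact p.Prime] {K : Type*} [Field K] [Algebra (ZMod p) K]
  [IsFunctionField (ZMod p) K]

instance (V : ValuationSubring K) : V.valuation.IsTrivialOn (ZMod p) where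
  eq_one a ha := by
    have h (b : ZMod p) : V.valuation (algebraMap (ZMod p) K b) ≤ 1 :=
      (V.valuation_le_one_iff _).mpr (algebraMap_mem V b)
    have h1 := h a⁻¹
    rw [map_inv₀, map_inv₀, inv_le_one₀ (zero_lt_iff.mpr ((Valuation.ne_zero_iff _).mpr
      (by simpa using ha)))] at h1
    exact le_antisymm (h a) h1

/-- A rank one property of `V`: the powers of `w` satisfy a nontrivial relation over `𝔽_p[x]`, and
if `w` were larger than all the powers of `x` that bound its coefficients, the term of highest
degree in `w` would dominate strictly. -/
theorem exists_pow_mul_mem {x : K} (hx : Transcendental (ZMod p) x) (V : ValuationSubring K)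
    (hV : x ∉ V) (w : K) : ∃ n : ℕ, x⁻¹ ^ n * w ∈ V := by
  obtain ⟨N, -, -, hN⟩ := exists_max_polyIndependent x hx
  have h1 : ¬ PolyIndependent (k := ZMod p) x fun i : Fin (N + 1) ↦ w ^ (i : ℕ) :=
    fun h ↦ absurd (hN _ _ h) (by lia)
  simp only [PolyIndependent, not_forall] at h1
  obtain ⟨f, hf, hf0⟩ := h1
  obtain ⟨i₀, hi₀⟩ := Function.ne_iff.mp hf0
  obtain ⟨i₁, hi₁0, hi₁⟩ := Finset.exists_max_image (Finset.univ.filter fun i ↦ f i ≠ 0) id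
    ⟨i₀, by simpa using hi₀⟩
  replace hi₁0 : f i₁ ≠ 0 := (Finset.mem_filter.mp hi₁0).2
  set u := V.valuation with hu
  have hux : 1 < u x := by
    rw [← not_le, hu, V.valuation_le_one_iff]
    exact hV
  have hpow {g : Polynomial (ZMod p)} (hg : g ≠ 0) :
      u (Polynomial.aeval x g) = u x ^ g.natDegree :=
    Polynomial.valuation_aeval_eq_valuation_X_pow_natDegree_of_one_lt_valuation_X x hux hg
  set n := ∑ i, (f i).natDegree with hn
  have hle (i) : u (Polynomial.aeval x (f i)) ≤ u x ^ n := by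
    by_cases hi : f i = 0
    · simp [hi]
    · rw [hpow hi]
      exact pow_le_pow_right₀ hux.le
        (Finset.single_le_sum (f := fun i ↦ (f i).natDegree) (fun _ _ ↦ Nat.zero_le _)
          (Finset.mem_univ i))
  have hge : 1 ≤ u (Polynomial.aeval x (f i₁)) := by
    rw [hpow hi₁0]
    exact one_le_pow₀ hux.le
  refine ⟨n, ?_⟩
  rw [← V.valuation_le_one_iff, ← hu, map_mul, map_pow, map_inv₀, ← not_lt]
  intro hlt
  have hw : u x ^ n < u w := by
    rwa [inv_pow, ← div_eq_inv_mul, one_lt_div₀ (pow_pos (zero_lt_one.trans hux) n)] at hlt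
  have hw1 : 1 < u w := (one_le_pow₀ hux.le).trans_lt hw
  rw [← Finset.add_sum_erase _ _ (Finset.mem_univ i₁), ← eq_neg_iff_add_eq_zero] at hf
  have h2 : u (∑ i ∈ Finset.univ.erase i₁, Polynomial.aeval x (f i) * w ^ (i : ℕ)) <
      u w ^ (i₁ : ℕ) := by
    refine u.map_sum_lt (pow_pos (zero_lt_one.trans hw1) _).ne' fun i hi ↦ ?_
    by_cases hi0 : f i = 0
    · rw [hi0, map_zero, zero_mul, map_zero]
      exact pow_pos (zero_lt_one.trans hw1) _
    · have h3 : i < i₁ := lt_of_le_of_ne (hi₁ i (by simpa using hi0)) (Finset.ne_of_mem_erase hi)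
      rw [map_mul, map_pow]
      calc u (Polynomial.aeval x (f i)) * u w ^ (i : ℕ) ≤ u x ^ n * u w ^ (i : ℕ) :=
            mul_le_mul_left (hle i) _
        _ < u w * u w ^ (i : ℕ) := by
            exact mul_lt_mul_of_pos_right hw (pow_pos (zero_lt_one.trans hw1) _)
        _ = u w ^ ((i : ℕ) + 1) := (pow_succ' _ _).symm
        _ ≤ u w ^ (i₁ : ℕ) := pow_le_pow_right₀ hw1.le h3
  rw [← u.map_neg, ← hf, map_mul, map_pow] at h2
  exact absurd h2 (not_lt.mpr (le_mul_of_one_le_left' hge))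

theorem finite_quotient_span {x : K} (hx : Transcendental (ZMod p) x) (V : ValuationSubring K)
    (y : V) (hy : (y : K) = x⁻¹) : Finite (V ⧸ Ideal.span {y}) := by
  have hx0 : x ≠ 0 := by
    rintro rfl
    exact hx isAlgebraic_zero
  obtain ⟨N, -, -, hN⟩ := exists_max_polyIndependent x hx
  let A : Submodule (ZMod p) K := integralAt fun _ : Unit ↦ V
  let B : Submodule (ZMod p) A :=
    (A.comap (LinearMap.mulLeft (ZMod p) x)).comap A.subtype
  obtain ⟨hfin, -⟩ := card_quotient_le hx0 hN A (fun a ha i ↦ mul_mem (hy ▸ y.2) (ha i)) B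
    fun b ↦ Iff.rfl
  let f : A →+ V ⧸ Ideal.span {y} :=
    { toFun z := Ideal.Quotient.mk _ ⟨_, z.2 ()⟩
      map_zero' := rfl
      map_add' z w := rfl }
  have hf : B.toAddSubgroup ≤ f.ker := by
    intro z hz
    refine Ideal.Quotient.eq_zero_iff_mem.mpr (Ideal.mem_span_singleton'.mpr ⟨⟨_, hz ()⟩, ?_⟩)
    ext
    change x * (z : K) * y = z
    rw [hy]
    field_simp
  have hsurj : Function.Surjective (QuotientAddGroup.lift B.toAddSubgroup f hf) := by
    intro z
    obtain ⟨r, rfl⟩ := Ideal.Quotient.mk_surjective z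
    exact ⟨QuotientAddGroup.mk (⟨r, fun _ ↦ r.2⟩ : A), rfl⟩
  have : Finite (A ⧸ B.toAddSubgroup) := hfin
  exact Finite.of_surjective _ hsurj

/-- Every nonzero ideal contains a power of `x⁻¹`, and `V` modulo that power is finite, so that
power and finitely many further elements generate the ideal. -/
theorem isNoetherianRing_of_notMem {x : K} (hx : Transcendental (ZMod p) x)
    (V : ValuationSubring K) (hV : x ∉ V) : IsNoetherianRing V := by
  have hxV : x⁻¹ ∈ V := (V.mem_or_inv_mem x).resolve_left hV
  rw [isNoetherianRing_iff_ideal_fg]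
  intro I
  by_cases hI : I = ⊥
  · exact hI ▸ Submodule.fg_bot
  obtain ⟨z, hzI, hz0⟩ := Submodule.exists_mem_ne_zero_of_ne_bot hI
  have hz0' : (z : K) ≠ 0 := by simpa using hz0
  obtain ⟨n, hn⟩ := exists_pow_mul_mem hx V hV (z : K)⁻¹
  -- `x⁻¹ ^ (n + 1)` lies in `I`
  let y : V := ⟨x⁻¹, hxV⟩ ^ (n + 1)
  have hyI : y ∈ I := by
    have : y = ⟨x⁻¹, hxV⟩ * ⟨_, hn⟩ * z := by
      ext
      change x⁻¹ ^ (n + 1) = x⁻¹ * (x⁻¹ ^ n * (z : K)⁻¹) * z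
      rw [pow_succ', mul_assoc, mul_assoc, inv_mul_cancel₀ hz0', mul_one]
    rw [this]
    exact I.mul_mem_left _ hzI
  have hfin : Finite (V ⧸ Ideal.span {y}) := by
    refine finite_quotient_span (x := x ^ (n + 1)) (p := p) ?_ V y ?_
    · exact fun h ↦ hx (h.of_pow n.succ_pos)
    · change x⁻¹ ^ (n + 1) = _
      rw [inv_pow]
  refine Submodule.fg_of_fg_map_of_fg_inf_ker (Submodule.mkQ (Ideal.span {y})) ?_ ?_
  · exact IsNoetherian.noetherian _
  · rw [Submodule.ker_mkQ, inf_eq_right.mpr]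
    · exact ⟨{y}, by simp [Ideal.span]⟩
    · rwa [Ideal.span_singleton_le_iff_mem]

/-- Every transcendental element has a pole. -/
theorem exists_pole {x : K} (hx : Transcendental (ZMod p) x) :
    ∃ v : NonarchPlace K, 1 < v.val x := by
  have hxR : x ∉ (integralClosure (ZMod p) K).toSubring := fun h ↦
    hx (IsIntegral.isAlgebraic h)
  have : IsIntegrallyClosedIn (integralClosure (ZMod p) K).toSubring K :=
    inferInstanceAs (IsIntegrallyClosedIn (integralClosure (ZMod p) K) K)
  -- The integral closure of `𝔽_p` is the intersection of the valuation rings that contain it, so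
  -- some valuation ring omits `x`; being Noetherian and not a field, it is a place.
  obtain ⟨V, -, hV⟩ := Subring.exists_le_valuationSubring_of_isIntegrallyClosedIn hxR
  have hxV : x⁻¹ ∈ V := (V.mem_or_inv_mem x).resolve_left hV
  have := isNoetherianRing_of_notMem hx V hV
  have hx0 : x ≠ 0 := fun h ↦ hV (h ▸ zero_mem V)
  have hy : (⟨x⁻¹, hxV⟩ : V) ∈ IsLocalRing.maximalIdeal V := by
    rw [IsLocalRing.mem_maximalIdeal, mem_nonunits_iff, isUnit_iff_exists_inv]
    rintro ⟨z, hz⟩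
    have : x⁻¹ * (z : K) = 1 := congrArg Subtype.val hz
    rw [inv_mul_eq_one₀ hx0] at this
    exact hV (this ▸ z.2)
  have hfield : ¬ IsField V := fun h ↦ by
    have := (IsLocalRing.isField_iff_maximalIdeal_eq.mp h).le hy
    rw [Ideal.mem_bot] at this
    exact hx0 (inv_eq_zero.mp (congrArg Subtype.val this))
  have hdvr : IsDiscreteValuationRing V :=
    ((IsDiscreteValuationRing.TFAE V hfield).out 0 1 : _ ↔ ValuationRing V).mpr inferInstance
  have hres : Finite (IsLocalRing.ResidueField V) := by
    have := finite_quotient_span hx V ⟨x⁻¹, hxV⟩ rfl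
    refine Finite.of_surjective (Ideal.Quotient.factor (S := Ideal.span {(⟨x⁻¹, hxV⟩ : V)})
      (T := IsLocalRing.maximalIdeal V) ?_) (Ideal.Quotient.factor_surjective _)
    rwa [Ideal.span_singleton_le_iff_mem]
  refine ⟨⟨V, hdvr, hres⟩, ?_⟩
  rw [← not_le, valuation_le_one_iff]
  exact hV

end IsFunctionField


/-! ### Divisors and the product formula for function fields -/

open NonarchPlace

namespace IsFunctionField

variable {p : ℕ} [Fact p.Prime] {K : Type*} [Field K] [Algebra (ZMod p) K]
  [IsFunctionField (ZMod p) K]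

variable (p) in
/-- The divisor of `x`, with poles counted positively. -/
noncomputable def divisor (x : K) : NonarchPlace K →₀ ℤ :=
  Finsupp.ofSupportFinite (fun v ↦ WithZero.log (v.val x)) (by
    rcases eq_or_ne x 0 with rfl | hx
    · refine Set.finite_empty.subset fun v hv ↦ hv ?_
      simp
    · refine (finite_setOf_val_ne_one (p := p) hx).subset fun v hv h ↦ hv ?_
      simp [h])

theorem divisor_apply (x : K) (v : NonarchPlace K) :
    divisor p x v = WithZero.log (v.val x) := rfl

theorem exp_divisor {x : K} (hx : x ≠ 0) (v : NonarchPlace K) :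
    WithZero.exp (divisor p x v) = v.val x :=
  WithZero.exp_log ((Valuation.ne_zero_iff _).mpr hx)

theorem divisor_inv (x : K) : divisor p x⁻¹ = -divisor p x := by
  ext v
  rw [Finsupp.neg_apply, divisor_apply, map_inv₀, WithZero.log_inv, divisor_apply]

variable (p) in
/-- The divisor of poles of `x`. -/
noncomputable def poleDivisor (x : K) : NonarchPlace K →₀ ℤ :=
  (divisor p x).mapRange (max · 0) (max_self 0)

theorem poleDivisor_apply (x : K) (v : NonarchPlace K) :
    poleDivisor p x v = max (WithZero.log (v.val x)) 0 := rfl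

theorem poleDivisor_nonneg (x : K) : 0 ≤ poleDivisor p x := fun _ ↦ le_max_right _ _

theorem val_le_exp_poleDivisor (x : K) (v : NonarchPlace K) :
    v.val x ≤ WithZero.exp (poleDivisor p x v) := by
  rcases eq_or_ne x 0 with rfl | hx
  · simp
  · rw [← exp_divisor (p := p) hx, WithZero.exp_le_exp]
    exact le_max_left _ _

theorem divisor_eq_sub (x : K) : divisor p x = poleDivisor p x - poleDivisor p x⁻¹ := by
  ext v
  rw [Finsupp.sub_apply, poleDivisor_apply, poleDivisor_apply, map_inv₀, WithZero.log_inv,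
    divisor_apply]
  lia

theorem divisorNorm_poleDivisor_le {x : K} (hx : x ≠ 0) {N : ℕ}
    (hN : ∀ (M : ℕ) (b : Fin M → K), PolyIndependent (k := ZMod p) x b → M ≤ N) :
    divisorNorm (poleDivisor p x) ≤ (p : ℝ) ^ N := by
  have h := prod_q_pow_le hx hN (poleDivisor p x).support (fun v ↦ (poleDivisor p x v).toNat)
    (fun v hv ↦ by
      rw [Finsupp.mem_support_iff, poleDivisor_apply] at hv
      rw [← exp_divisor (p := p) hx, WithZero.exp_le_exp, divisor_apply, poleDivisor_apply]
      lia)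
  have h2 : ((∏ v ∈ (poleDivisor p x).support, v.q ^ (poleDivisor p x v).toNat : ℕ) : ℝ) =
      divisorNorm (poleDivisor p x) := by
    rw [divisorNorm, Finsupp.prod, Nat.cast_prod]
    refine Finset.prod_congr rfl fun v _ ↦ ?_
    rw [Nat.cast_pow, ← zpow_natCast, Int.toNat_of_nonneg (poleDivisor_nonneg x v)]
  rw [← h2]
  exact_mod_cast h

omit [IsFunctionField (ZMod p) K] in
theorem val_aeval_le (v : NonarchPlace K) {x : K} {m : ℤ} (hm : 0 ≤ m)
    (hx : v.val x ≤ WithZero.exp m) {f : Polynomial (ZMod p)} {n : ℕ} (hf : f.natDegree ≤ n) :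
    v.val (Polynomial.aeval x f) ≤ WithZero.exp (n * m) := by
  rw [Polynomial.aeval_eq_sum_range' (Nat.lt_succ_of_le hf)]
  refine Valuation.map_sum_le _ fun i hi ↦ ?_
  rw [Algebra.smul_def, map_mul, map_pow]
  have h1 : v.val (algebraMap (ZMod p) K (f.coeff i)) ≤ 1 :=
    (v.valuation_le_one_iff _).mpr (algebraMap_mem _ _)
  refine (mul_le_mul' h1 (pow_le_pow_left₀ zero_le hx i)).trans ?_
  rw [one_mul, ← WithZero.exp_nsmul, WithZero.exp_le_exp, nsmul_eq_mul]
  exact mul_le_mul_of_nonneg_right (by exact_mod_cast Nat.lt_succ_iff.mp (Finset.mem_range.mp hi)) hm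

/-- The sums `∑ f_i(x) u_i` with `deg f_i < n` and a maximal independent family `u` form a group of
order `p ^ (N * n)`, at least the `n`-th power of the norm of the pole divisor. The poles of the
`u_i` are removed at the cost of a factor independent of `n`. -/
theorem exists_card_ge_mul_pow {x : K} (hx : Transcendental (ZMod p) x) :
    ∃ c : ℝ, 0 < c ∧ ∀ n : ℕ, ∃ G : AddSubgroup K, Finite G ∧
      G ≤ boundedBy (n • poleDivisor p x) ∧ c * divisorNorm (poleDivisor p x) ^ n ≤ Nat.card G := by
  obtain ⟨N, u, hu, hN⟩ := exists_max_polyIndependent x hx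
  have hx0 : x ≠ 0 := by
    rintro rfl
    exact hx isAlgebraic_zero
  set P := poleDivisor p x with hP
  set D₀ : NonarchPlace K →₀ ℤ := ∑ i, poleDivisor p (u i) with hD₀
  have hD₀0 : 0 ≤ D₀ := Finset.sum_nonneg fun i _ ↦ poleDivisor_nonneg _
  refine ⟨(divisorNorm D₀)⁻¹, inv_pos.mpr (divisorNorm_pos _), fun n ↦ ?_⟩
  let φ : (Fin N → Polynomial.degreeLT (ZMod p) n) →+ K :=
    { toFun f := ∑ i, Polynomial.aeval x (f i : Polynomial (ZMod p)) * u i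
      map_zero' := by simp
      map_add' f g := by simp [add_mul, Finset.sum_add_distrib] }
  have hφ : Function.Injective φ := by
    refine (injective_iff_map_eq_zero φ).mpr fun f hf ↦ ?_
    have := hu (fun i ↦ f i) hf
    ext i : 2
    exact congrFun this i
  have : Finite (Polynomial.degreeLT (ZMod p) n) :=
    Finite.of_equiv _ (Polynomial.degreeLTEquiv (ZMod p) n).symm.toEquiv
  have hcard : Nat.card φ.range = (p ^ N) ^ n := by
    rw [← Nat.card_congr (AddMonoidHom.ofInjective hφ).toEquiv, Nat.card_fun,
      Nat.card_congr (Polynomial.degreeLTEquiv (ZMod p) n).toEquiv, Nat.card_fun, Nat.card_zmod,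
      Nat.card_fin, Nat.card_fin, ← pow_mul, ← pow_mul, mul_comm]
  have hfin : Finite φ.range := Finite.of_equiv _ (AddMonoidHom.ofInjective hφ).toEquiv
  have hle : φ.range ≤ boundedBy ⇑(n • P + D₀) := by
    rintro _ ⟨f, rfl⟩ v
    change v.val (∑ i, Polynomial.aeval x (f i : Polynomial (ZMod p)) * u i) ≤ _
    refine v.val.map_sum_le fun i _ ↦ ?_
    rw [map_mul]
    have h1 : v.val (Polynomial.aeval x (f i : Polynomial (ZMod p))) ≤ WithZero.exp (n * P v) := by
      refine val_aeval_le v (poleDivisor_nonneg x v) (val_le_exp_poleDivisor x v) ?_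
      exact Polynomial.natDegree_le_of_degree_le (Polynomial.mem_degreeLT.mp (f i).2).le
    refine (mul_le_mul' h1 (val_le_exp_poleDivisor (p := p) (u i) v)).trans ?_
    rw [← WithZero.exp_add, WithZero.exp_le_exp, Finsupp.add_apply, Finsupp.smul_apply,
      nsmul_eq_mul]
    refine add_le_add_right ?_ _
    rw [hD₀, Finsupp.finsetSum_apply]
    exact Finset.single_le_sum (f := fun i ↦ poleDivisor p (u i) v)
      (fun i _ ↦ poleDivisor_nonneg _ v) (Finset.mem_univ i)
  refine ⟨φ.range ⊓ boundedBy ⇑(n • P), Finite.of_injective _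
    (AddSubgroup.inclusion_injective inf_le_left), inf_le_right, ?_⟩
  have h := card_mul_divisorNorm_le φ.range (le_add_of_nonneg_right hD₀0) hle
  rw [divisorNorm_add, hcard, mul_comm (divisorNorm (n • P)), ← mul_assoc,
    mul_le_mul_iff_left₀ (divisorNorm_pos _)] at h
  rw [inv_mul_le_iff₀ (divisorNorm_pos _), mul_comm]
  refine le_trans ?_ h
  push_cast
  exact pow_le_pow_left₀ (divisorNorm_pos _).le (divisorNorm_poleDivisor_le hx0 hN) n

theorem isAlgebraic_of_mem_boundedBy_zero {x : K} (hx : x ∈ boundedBy (0 : NonarchPlace K → ℤ)) :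
    IsAlgebraic (ZMod p) x := by
  by_contra h
  obtain ⟨v, hv⟩ := exists_pole h
  exact absurd (hx v) (by simpa using hv)

theorem nonempty_nonarchPlace (p : ℕ) [Fact p.Prime] (K : Type*) [Field K] [Algebra (ZMod p) K]
    [IsFunctionField (ZMod p) K] : Nonempty (NonarchPlace K) := by
  obtain ⟨t, ht⟩ := exists_transcendental (k := ZMod p) (K := K)
  obtain ⟨v, -⟩ := exists_pole ht
  exact ⟨v⟩

/-- Elements without poles are algebraic over `𝔽_p`; nonzero ones are units at every place, so such
elements inject into any one residue field. -/
theorem finite_boundedBy_zero (p : ℕ) [Fact p.Prime] (K : Type*) [Field K] [Algebra (ZMod p) K]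
    [IsFunctionField (ZMod p) K] : Finite (boundedBy (0 : NonarchPlace K → ℤ)) := by
  obtain ⟨v⟩ := nonempty_nonarchPlace p K
  let f (z : boundedBy (0 : NonarchPlace K → ℤ)) : v.ring :=
    ⟨z, (v.valuation_le_one_iff _).mp (by simpa using z.2 v)⟩
  refine Finite.of_injective (fun z ↦ IsLocalRing.residue v.ring (f z)) fun z w h ↦ ?_
  rw [← sub_eq_zero, ← map_sub, IsLocalRing.residue_eq_zero_iff, ← pow_one
    (IsLocalRing.maximalIdeal v.ring), mem_maximalIdeal_pow_iff] at h
  have h1 : v.val ((z - w : boundedBy (0 : NonarchPlace K → ℤ)) : K) ≤ WithZero.exp (-1) := h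
  by_contra hzw
  rw [val_eq_one_of_isAlgebraic (p := p) v
    (isAlgebraic_of_mem_boundedBy_zero (z - w).2)
      (fun h0 ↦ hzw (sub_eq_zero.mp (Subtype.ext h0))),
    ← WithZero.exp_zero, WithZero.exp_le_exp] at h1
  lia

theorem card_le_mul_divisorNorm (p : ℕ) [Fact p.Prime] {K : Type*} [Field K] [Algebra (ZMod p) K]
    [IsFunctionField (ZMod p) K] (G : AddSubgroup K) [Finite G] {D : NonarchPlace K →₀ ℤ}
    (hD : 0 ≤ D) (hG : G ≤ boundedBy D) :
    (Nat.card G : ℝ) ≤ Nat.card (boundedBy (0 : NonarchPlace K → ℤ)) * divisorNorm D := by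
  have := finite_boundedBy_zero p K
  have h := card_mul_divisorNorm_le G hD hG
  rw [divisorNorm_zero, mul_one] at h
  refine h.trans (mul_le_mul_of_nonneg_right ?_ (divisorNorm_pos _).le)
  exact_mod_cast Nat.card_le_card_of_injective _ (AddSubgroup.inclusion_injective
    (inf_le_right : G ⊓ boundedBy ⇑(0 : NonarchPlace K →₀ ℤ) ≤ _))

/-- Multiplication by `y` maps `L(D)` into `L(D + (y))`. -/
theorem map_mulLeft_le_boundedBy {G : AddSubgroup K} {D : NonarchPlace K →₀ ℤ}
    (hG : G ≤ boundedBy D) {y : K} (hy : y ≠ 0) :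
    G.map (AddMonoidHom.mulLeft y) ≤ boundedBy ⇑(D + divisor p y) := by
  rintro _ ⟨z, hz, rfl⟩ v
  rw [Finsupp.add_apply, WithZero.exp_add, exp_divisor hy, mul_comm]
  change v.val (y * z) ≤ _
  rw [map_mul]
  exact mul_le_mul' le_rfl (hG hz v)

theorem card_map_mulLeft (G : AddSubgroup K) {y : K} (hy : y ≠ 0) :
    Nat.card (G.map (AddMonoidHom.mulLeft y)) = Nat.card G :=
  (Nat.card_congr (G.equivMapOfInjective _ (mul_right_injective₀ hy)).toEquiv).symm

theorem le_of_forall_mul_pow_le {a b c C : ℝ} (hc : 0 < c) (hb : 0 < b)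
    (h : ∀ n : ℕ, c * a ^ n ≤ C * b ^ n) : a ≤ b := by
  by_contra! hab
  have h1 : 1 < a / b := (one_lt_div hb).mpr hab
  obtain ⟨n, hn⟩ := pow_unbounded_of_one_lt (C / c) h1
  have h2 := h n
  rw [div_lt_iff₀ hc, div_pow, div_mul_eq_mul_div, lt_div_iff₀ (pow_pos hb n)] at hn
  linarith

/-- Multiplication by `y ^ (-n)` moves elements with poles bounded by `n` times the poles of `y` to
elements bounded by `n` times its zeros. The lower count on one side and the upper count on the
other grow like `n`-th powers of the two norms, so large `n` compares the norms. -/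
theorem divisorNorm_poleDivisor_le_inv {y : K} (hy : Transcendental (ZMod p) y) :
    divisorNorm (poleDivisor p y) ≤ divisorNorm (poleDivisor p y⁻¹) := by
  have hy0 : y ≠ 0 := by
    rintro rfl
    exact hy isAlgebraic_zero
  obtain ⟨c, hc, h⟩ := exists_card_ge_mul_pow hy
  refine le_of_forall_mul_pow_le hc (divisorNorm_pos _)
    (C := Nat.card (boundedBy (0 : NonarchPlace K → ℤ))) fun n ↦ ?_
  obtain ⟨G, hGfin, hG, hcard⟩ := h n
  refine hcard.trans ?_
  have h1 := map_mulLeft_le_boundedBy (p := p) (D := n • poleDivisor p y) hG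
    (pow_ne_zero n (inv_ne_zero hy0))
  have h2 : n • poleDivisor p y + divisor p (y⁻¹ ^ n) = n • poleDivisor p y⁻¹ := by
    have h3 : divisor p (y⁻¹ ^ n) = n • divisor p y⁻¹ := by
      ext v
      rw [Finsupp.smul_apply, divisor_apply, map_pow, WithZero.log_pow, divisor_apply]
    rw [h3, ← nsmul_add, divisor_eq_sub, inv_inv]
    congr 1
    abel
  rw [h2] at h1
  have : Finite (G.map (AddMonoidHom.mulLeft (y⁻¹ ^ n))) :=
    Finite.of_equiv _ (G.equivMapOfInjective _
      (mul_right_injective₀ (pow_ne_zero n (inv_ne_zero hy0)))).toEquiv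
  have h4 := card_le_mul_divisorNorm p _ (nsmul_nonneg (poleDivisor_nonneg _) n) h1
  rwa [card_map_mulLeft _ (pow_ne_zero n (inv_ne_zero hy0)), divisorNorm_nsmul] at h4

/-- The product formula. -/
theorem divisorNorm_divisor {y : K} (hy : y ≠ 0) : divisorNorm (divisor p y) = 1 := by
  by_cases h : IsAlgebraic (ZMod p) y
  · have : divisor p y = 0 := by
      ext v
      rw [divisor_apply, val_eq_one_of_isAlgebraic v h hy, WithZero.log_one, Finsupp.zero_apply]
    rw [this, divisorNorm_zero]
  · have h' : Transcendental (ZMod p) y⁻¹ := fun hi ↦ h (inv_inv y ▸ hi.inv)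
    have h1 := divisorNorm_poleDivisor_le_inv h
    have h2 := divisorNorm_poleDivisor_le_inv h'
    rw [inv_inv] at h2
    rw [divisor_eq_sub, sub_eq_add_neg, divisorNorm_add, divisorNorm_neg, ← h1.antisymm h2,
      mul_inv_cancel₀ (divisorNorm_pos _).ne']

end IsFunctionField


/-! ### Properties common to all global fields; Riemann's inequality -/

open NonarchPlace

/-- The basic facts about the places of a global field: the product formula, Minkowski's theorem
(an idele of large absolute value dominates a nonzero element of `K`), and the finiteness of the
number of places with bounded residue field. -/
class HasProductFormula (K : Type*) [Field K] : Prop where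
  nonempty_nonarchPlace : Nonempty (NonarchPlace K)
  finite_setOf_val_ne_one (x : K) (hx : x ≠ 0) : {v : NonarchPlace K | v.val x ≠ 1}.Finite
  prod_eq_one (x : K) (hx : x ≠ 0) :
    (∏ᶠ v : InfinitePlace K, v x ^ v.mult) * ∏ᶠ v : NonarchPlace K, v.abv x = 1
  exists_dominated : ∃ C : ℝ, ∀ a : Ideles K, C < a.absValue → ∃ x : K, x ≠ 0 ∧
    (∀ v : InfinitePlace K, v x ≤ ‖Adeles.infEval v a.1‖) ∧
    ∀ v : NonarchPlace K, v.val x ≤ Valued.v (Adeles.nonarchEval v a.1)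
  finite_setOf_q_le (B : ℕ) : {v : NonarchPlace K | v.q ≤ B}.Finite

namespace NonarchPlace

/-- Fermat's little theorem in the residue field. It provides explicit functions that vanish at
prescribed places, and an element whose zeros include all the places with residue field of a given
order where `x` is integral. -/
theorem val_pow_q_sub_self_lt_one {K : Type*} [Field K] (v : NonarchPlace K) {x : K}
    (hx : v.val x ≤ 1) : v.val (x ^ v.q - x) < 1 := by
  let x' : v.ring := ⟨x, (v.valuation_le_one_iff x).mp hx⟩
  have h : x' ^ v.q - x' ∈ IsLocalRing.maximalIdeal v.ring := by
    have := Fintype.ofFinite (IsLocalRing.ResidueField v.ring)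
    rw [← IsLocalRing.residue_eq_zero_iff, map_sub, map_pow, q, Nat.card_eq_fintype_card,
      FiniteField.pow_card, sub_self]
  rw [← pow_one (IsLocalRing.maximalIdeal v.ring), mem_maximalIdeal_pow_iff] at h
  refine lt_of_le_of_lt h ?_
  rw [← WithZero.exp_zero, WithZero.exp_lt_exp]
  lia

end NonarchPlace

theorem Ideles.nonarchEval_ne_zero {K : Type*} [Field K] (a : Ideles K) (v : NonarchPlace K) :
    Adeles.nonarchEval v a.1 ≠ 0 :=
  ((Units.isUnit a).map (Adeles.nonarchEval v)).ne_zero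

theorem Ideles.infEval_ne_zero {K : Type*} [Field K] (a : Ideles K) (v : InfinitePlace K) :
    Adeles.infEval v a.1 ≠ 0 :=
  ((Units.isUnit a).map (Adeles.infEval v)).ne_zero

/-- The divisor of an idele, with poles counted positively. -/
noncomputable def Ideles.divisor {K : Type*} [Field K] (a : Ideles K) : NonarchPlace K →₀ ℤ :=
  Finsupp.ofSupportFinite (fun v ↦ WithZero.log (Valued.v (Adeles.nonarchEval v a.1))) (by
    refine (finite_mulSupport_normAbs a).subset fun v hv h ↦ hv ?_
    dsimp only at h
    rw [normAbs_eq_zpow _ (a.nonarchEval_ne_zero v)] at h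
    exact (zpow_eq_one_iff_right₀ (zero_lt_one.trans v.one_lt_q_real).le
      v.one_lt_q_real.ne').mp h)

theorem Ideles.exp_divisor {K : Type*} [Field K] (a : Ideles K) (v : NonarchPlace K) :
    WithZero.exp (a.divisor v) = Valued.v (Adeles.nonarchEval v a.1) :=
  WithZero.exp_log ((Valuation.ne_zero_iff _).mpr (a.nonarchEval_ne_zero v))

theorem Ideles.normAbs_nonarchEval {K : Type*} [Field K] (a : Ideles K) (v : NonarchPlace K) :
    (v.normAbs (Adeles.nonarchEval v a.1) : ℝ) = (v.q : ℝ) ^ a.divisor v :=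
  normAbs_eq_zpow _ (a.nonarchEval_ne_zero v)

theorem finprod_zpow_eq_divisorNorm {K : Type*} [Field K] (D : NonarchPlace K →₀ ℤ) :
    ∏ᶠ v : NonarchPlace K, (v.q : ℝ) ^ D v = divisorNorm D := by
  refine finprod_eq_prod_of_mulSupport_subset _ fun v hv ↦ ?_
  rw [Finset.mem_coe, Finsupp.mem_support_iff]
  intro h
  exact hv (by simp [h])

theorem Ideles.absValue_eq {K : Type*} [Field K] (a : Ideles K) : a.absValue =
    (∏ᶠ v : InfinitePlace K, ‖Adeles.infEval v a.1‖ ^ v.mult) * divisorNorm a.divisor := by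
  simp only [absValue, normAbs_nonarchEval, finprod_zpow_eq_divisorNorm]

namespace IsFunctionField

variable {p : ℕ} [Fact p.Prime] {K : Type*} [Field K] [Algebra (ZMod p) K]
  [IsFunctionField (ZMod p) K]

/-- A weak form of Riemann's inequality. -/
theorem exists_card_ge_mul (p : ℕ) [Fact p.Prime] (K : Type*) [Field K] [Algebra (ZMod p) K]
    [IsFunctionField (ZMod p) K] : ∃ c : ℝ, 0 < c ∧ ∀ D : NonarchPlace K →₀ ℤ,
      ∃ G : AddSubgroup K, Finite G ∧ G ≤ boundedBy D ∧ c * divisorNorm D ≤ Nat.card G := by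
  classical
  obtain ⟨t, ht⟩ := exists_transcendental (k := ZMod p) (K := K)
  obtain ⟨c, hc, h⟩ := exists_card_ge_mul_pow ht
  refine ⟨c, hc, fun D ↦ ?_⟩
  set P := poleDivisor p t with hP
  -- `t ^ q_v - t` vanishes at `v` if `t` is integral there, so this power cancels the pole that `D`
  -- permits at `v`.
  let g (v : NonarchPlace K) : Polynomial (ZMod p) := (.X ^ v.q - .X) ^ (D v).toNat
  have hg (v) : g v ≠ 0 :=
    pow_ne_zero _ (FiniteField.X_pow_card_sub_X_ne_zero _ v.one_lt_q)
  let f : Polynomial (ZMod p) := ∏ v ∈ D.support, g v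
  have hf : f ≠ 0 := Finset.prod_ne_zero_iff.mpr fun v _ ↦ hg v
  let y : K := Polynomial.aeval t f
  have hy : y ≠ 0 := fun hy ↦ hf (transcendental_iff.mp ht f hy)
  have hPpole (v : NonarchPlace K) (hv : P v ≠ 0) : 1 ≤ P v := by
    have := poleDivisor_nonneg (p := p) t v
    rw [Finsupp.zero_apply] at this
    lia
  have hint (v : NonarchPlace K) (hv : P v = 0) (f : Polynomial (ZMod p)) :
      v.val (Polynomial.aeval t f) ≤ 1 := by
    have := val_aeval_le v (x := t) (m := 0) le_rfl
      ((val_le_exp_poleDivisor (p := p) t v).trans_eq (by rw [← hP, hv])) (f := f) le_rfl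
    simpa using this
  let m : ℕ := f.natDegree + ∑ v ∈ D.support, (D v).natAbs
  -- Multiplication by `y` moves all permitted poles to the poles of `t`, where the count for
  -- multiples of `P` is known.
  have hA : D + divisor p y ≤ m • P := by
    intro v
    rw [Finsupp.add_apply, Finsupp.smul_apply, nsmul_eq_mul]
    by_cases hv : P v = 0
    · rw [hv, mul_zero, ← le_neg_iff_add_nonpos_left, ← WithZero.exp_le_exp, exp_divisor hy]
      by_cases hD : 0 < D v
      · have hvs : v ∈ D.support := Finsupp.mem_support_iff.mpr hD.ne'
        have h1 : y = Polynomial.aeval t (g v) *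
            Polynomial.aeval t (∏ v ∈ D.support.erase v, g v) := by
          rw [← map_mul, Finset.mul_prod_erase _ _ hvs]
        have h2 : v.val (Polynomial.aeval t (g v)) ≤ WithZero.exp (-D v) := by
          have h3 : v.val (t ^ v.q - t) ≤ WithZero.exp (-1) := by
            have h4 := v.val_pow_q_sub_self_lt_one (x := t) (by simpa using hint v hv .X)
            rcases eq_or_ne (t ^ v.q - t) 0 with h0 | h0
            · simp [h0]
            · rw [← exp_divisor (p := p) h0] at h4 ⊢
              rw [← WithZero.exp_zero, WithZero.exp_lt_exp] at h4
              rw [WithZero.exp_le_exp]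
              lia
          simp only [g, map_pow, map_sub, Polynomial.aeval_X]
          refine (pow_le_pow_left₀ zero_le h3 _).trans_eq ?_
          rw [← WithZero.exp_nsmul, nsmul_eq_mul, Int.toNat_of_nonneg hD.le, mul_neg_one]
        rw [h1, map_mul]
        exact (mul_le_mul' h2 (hint v hv _)).trans_eq (mul_one _)
      · refine (hint v hv f).trans ?_
        rw [← WithZero.exp_zero, WithZero.exp_le_exp]
        lia
    · have h1 : divisor p y v ≤ f.natDegree * P v := by
        rw [← WithZero.exp_le_exp, exp_divisor hy]
        exact val_aeval_le v (poleDivisor_nonneg t v) (val_le_exp_poleDivisor t v) le_rfl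
      have h2 : D v ≤ (∑ v ∈ D.support, (D v).natAbs : ℕ) := by
        by_cases hvs : v ∈ D.support
        · have := Finset.single_le_sum (f := fun v ↦ (D v).natAbs) (fun _ _ ↦ Nat.zero_le _) hvs
          lia
        · rw [Finsupp.notMem_support_iff.mp hvs]
          lia
      have h3 := le_mul_of_one_le_right (Int.natCast_nonneg (∑ v ∈ D.support, (D v).natAbs))
        (hPpole v hv)
      simp only [m]
      push_cast at *
      rw [add_mul]
      linarith
  obtain ⟨G, hGfin, hG, hcard⟩ := h m
  set A := D + divisor p y with hAdef
  have hnorm : divisorNorm A = divisorNorm D := by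
    rw [hAdef, divisorNorm_add, divisorNorm_divisor hy, mul_one]
  have h1 := card_mul_divisorNorm_le G hA hG
  rw [divisorNorm_nsmul, hnorm] at h1
  -- Passing from `m • P` down to `A` loses at most the ratio of the norms, and by the product
  -- formula `A` has the same norm as `D`. Division by `y` then returns from `A` to `D`.
  have h2 : c * divisorNorm D ≤ Nat.card (G ⊓ boundedBy A : AddSubgroup K) := by
    refine le_of_mul_le_mul_right (le_trans ?_ h1) (pow_pos (divisorNorm_pos P) m)
    rw [mul_right_comm]
    exact mul_le_mul_of_nonneg_right hcard (divisorNorm_pos _).le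
  have : Finite (G ⊓ boundedBy A : AddSubgroup K) :=
    Finite.of_injective _ (AddSubgroup.inclusion_injective inf_le_left)
  have h3 := map_mulLeft_le_boundedBy (p := p) (inf_le_right : G ⊓ boundedBy A ≤ _)
    (inv_ne_zero hy)
  rw [divisor_inv, hAdef, add_neg_cancel_right] at h3
  refine ⟨_, ?_, h3, ?_⟩
  · exact Finite.of_equiv _ (AddSubgroup.equivMapOfInjective _ _
      (mul_right_injective₀ (inv_ne_zero hy))).toEquiv
  · rwa [card_map_mulLeft _ (inv_ne_zero hy)]

omit [IsFunctionField (ZMod p) K] in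
theorem pow_sub_self_ne_zero {t : K} (ht : Transcendental (ZMod p) t) {q : ℕ} (hq : 1 < q) :
    t ^ q - t ≠ 0 := by
  intro h
  refine FiniteField.X_pow_card_sub_X_ne_zero (ZMod p) hq (transcendental_iff.mp ht _ ?_)
  rw [map_sub, map_pow, Polynomial.aeval_X, h]

/-- Such a place is a pole of `t` or a zero of `t ^ q - t` for one of finitely many `q`. -/
theorem finite_setOf_q_le (p : ℕ) [Fact p.Prime] (K : Type*) [Field K] [Algebra (ZMod p) K]
    [IsFunctionField (ZMod p) K] (B : ℕ) : {v : NonarchPlace K | v.q ≤ B}.Finite := by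
  obtain ⟨t, ht⟩ := exists_transcendental (k := ZMod p) (K := K)
  have h1 : (⋃ q ∈ Set.Ioc 1 B, {v : NonarchPlace K | v.val (t ^ q - t) ≠ 1}).Finite :=
    (Set.finite_Ioc 1 B).biUnion fun q hq ↦
      finite_setOf_val_ne_one (p := p) (pow_sub_self_ne_zero ht hq.1)
  refine ((finite_poles_of_transcendental ht).union h1).subset fun v hv ↦ ?_
  rw [Set.mem_union]
  refine or_iff_not_imp_left.mpr fun hvt ↦ ?_
  rw [Set.mem_iUnion₂]
  exact ⟨v.q, ⟨v.one_lt_q, hv⟩, (v.val_pow_q_sub_self_lt_one (not_lt.mp hvt)).ne⟩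

theorem isEmpty_infinitePlace (p : ℕ) [Fact p.Prime] (K : Type*) [Field K] [Algebra (ZMod p) K] :
    IsEmpty (InfinitePlace K) := ⟨fun v ↦ by
  have h1 : (p : K) = 0 := by
    rw [← map_natCast (algebraMap (ZMod p) K), CharP.cast_eq_zero, map_zero]
  have h2 : (p : ℂ) = 0 := by rw [← map_natCast v.embedding, h1, map_zero]
  exact (Fact.out : p.Prime).ne_zero (by exact_mod_cast h2)⟩

theorem hasProductFormula (p : ℕ) [Fact p.Prime] (K : Type*) [Field K] [Algebra (ZMod p) K]
    [IsFunctionField (ZMod p) K] : HasProductFormula K := by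
  have hemp := isEmpty_infinitePlace p K
  refine ⟨nonempty_nonarchPlace p K,
    fun x hx ↦ IsFunctionField.finite_setOf_val_ne_one (p := p) hx, fun x hx ↦ ?_, ?_,
    finite_setOf_q_le p K⟩
  · rw [finprod_of_isEmpty, one_mul, ← divisorNorm_divisor (p := p) hx,
      ← finprod_zpow_eq_divisorNorm]
    exact finprod_congr fun v ↦ v.abv_eq_zpow hx
  · obtain ⟨c, hc, h⟩ := exists_card_ge_mul p K
    -- Beyond this bound, Riemann's inequality gives a group with more than one element.
    refine ⟨c⁻¹, fun a ha ↦ ?_⟩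
    obtain ⟨G, hfin, hG, hcard⟩ := h a.divisor
    rw [Ideles.absValue_eq, finprod_of_isEmpty, one_mul, inv_lt_iff_one_lt_mul₀' hc] at ha
    have h1 : 1 < Nat.card G := by exact_mod_cast ha.trans_le hcard
    have := Finite.one_lt_card_iff_nontrivial.mp h1
    obtain ⟨x, hx⟩ := exists_ne (0 : G)
    refine ⟨x, by simpa using hx, fun v ↦ hemp.elim v, fun v ↦ ?_⟩
    rw [← a.exp_divisor]
    exact hG x.2 v

end IsFunctionField


/-! ## Number fields -/

namespace NonarchPlace

variable {K : Type*} [Field K] [NumberField K]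

theorem isDiscreteValuationRing_of_heightOne (P : HeightOneSpectrum (𝓞 K)) :
    IsDiscreteValuationRing (P.valuation K).valuationSubring := by
  refine Valuation.isDiscreteValuationRing_of_int _ ?_
  obtain ⟨π, hπ⟩ := P.valuation_exists_uniformizer K
  refine ⟨π, ?_, ?_⟩
  · rintro rfl
    rw [map_zero] at hπ
    exact WithZero.exp_ne_zero hπ.symm
  · rw [hπ, ← WithZero.exp_zero]
    exact fun h ↦ absurd (WithZero.exp_injective h) (by norm_num)

/-- The map from the ring of integers to the residue field at a maximal ideal. -/
noncomputable def residueMap (P : HeightOneSpectrum (𝓞 K)) :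
    𝓞 K →+* IsLocalRing.ResidueField (P.valuation K).valuationSubring :=
  (IsLocalRing.residue _).comp ((algebraMap (𝓞 K) K).codRestrict
    (P.valuation K).valuationSubring.toSubring fun x ↦ P.valuation_le_one x)

theorem residueMap_eq_zero_iff (P : HeightOneSpectrum (𝓞 K)) (x : 𝓞 K) :
    residueMap P x = 0 ↔ x ∈ P.asIdeal := by
  rw [residueMap, RingHom.comp_apply, IsLocalRing.residue_eq_zero_iff,
    ← P.valuation_lt_one_iff_mem (K := K)]
  exact Valuation.mem_maximalIdeal_iff _ _

theorem residueMap_surjective (P : HeightOneSpectrum (𝓞 K)) :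
    Function.Surjective (residueMap P) := by
  intro y
  obtain ⟨y, rfl⟩ := IsLocalRing.residue_surjective y
  obtain ⟨a, ha⟩ := P.exists_valuation_sub_lt_of_integer (x := (y : K)) y.2 1
  refine ⟨a, ?_⟩
  rw [residueMap, RingHom.comp_apply, ← sub_eq_zero, ← map_sub, IsLocalRing.residue_eq_zero_iff]
  exact (Valuation.mem_maximalIdeal_iff _ _).mpr ha

/-- The place given by a maximal ideal of the ring of integers. -/
noncomputable def ofHeightOne (P : HeightOneSpectrum (𝓞 K)) : NonarchPlace K where
  ring := (P.valuation K).valuationSubring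
  isDVR := isDiscreteValuationRing_of_heightOne P
  finite_residue := by
    have : Finite (𝓞 K ⧸ P.asIdeal) := Ideal.finiteQuotientOfFreeOfNeBot _ P.ne_bot
    exact Finite.of_surjective (Ideal.Quotient.lift P.asIdeal (residueMap P)
      fun a ha ↦ (residueMap_eq_zero_iff P a).mpr ha)
      (Ideal.Quotient.lift_surjective_of_surjective _ _ (residueMap_surjective P))

theorem val_ofHeightOne (P : HeightOneSpectrum (𝓞 K)) :
    (ofHeightOne P).val = P.valuation K :=
  (eq_val_of_valuationSubring_eq (ofHeightOne P) (P.valuation_exists_uniformizer K) rfl).symm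

theorem q_ofHeightOne (P : HeightOneSpectrum (𝓞 K)) :
    (ofHeightOne P).q = Ideal.absNorm P.asIdeal := by
  have hker : RingHom.ker (residueMap P) = P.asIdeal := by
    ext x
    exact residueMap_eq_zero_iff P x
  rw [Ideal.absNorm_apply, Submodule.cardQuot_apply, ← hker]
  exact (Nat.card_congr
    (RingHom.quotientKerEquivOfSurjective (residueMap_surjective P)).toEquiv).symm

omit [NumberField K] in
theorem algebraMap_mem (v : NonarchPlace K) (x : 𝓞 K) : algebraMap (𝓞 K) K x ∈ v.ring :=
  v.mem_of_isIntegral (R := ℤ) (fun r ↦ intCast_mem v.ring r) x.2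

/-- A place contracts to a maximal ideal of `𝓞 K`, whose localization lies in the valuation ring.
Equality holds because a discrete valuation ring has no proper overring except the whole field. -/
theorem ofHeightOne_bijective :
    Function.Bijective (ofHeightOne : HeightOneSpectrum (𝓞 K) → NonarchPlace K) := by
  constructor
  · intro P Q h
    ext x
    rw [← P.valuation_lt_one_iff_mem (K := K), ← Q.valuation_lt_one_iff_mem (K := K),
      ← val_ofHeightOne, ← val_ofHeightOne, h]
  · intro v
    let φ : 𝓞 K →+* v.ring :=
      (algebraMap (𝓞 K) K).codRestrict v.ring.toSubring v.algebraMap_mem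
    have hφ (x : 𝓞 K) (hx : x ∉ (IsLocalRing.maximalIdeal v.ring).comap φ) :
        (algebraMap (𝓞 K) K x)⁻¹ ∈ v.ring := by
      rw [Ideal.mem_comap, IsLocalRing.mem_maximalIdeal, mem_nonunits_iff, not_not,
        isUnit_iff_exists_inv] at hx
      obtain ⟨y, hy⟩ := hx
      have : algebraMap (𝓞 K) K x * y = 1 := congrArg Subtype.val hy
      rw [← eq_inv_of_mul_eq_one_right this]
      exact y.2
    let P : HeightOneSpectrum (𝓞 K) := ⟨(IsLocalRing.maximalIdeal v.ring).comap φ,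
      inferInstance, by
      intro hbot
      obtain ⟨x, hx⟩ := v.ring_ne_top
      obtain ⟨a, b, hb, rfl⟩ := IsFractionRing.div_surjective (A := 𝓞 K) x
      refine hx ?_
      rw [div_eq_mul_inv]
      refine mul_mem (v.algebraMap_mem a) (hφ b ?_)
      rw [hbot]
      exact nonZeroDivisors.ne_zero hb⟩
    have hle (x : K) (hx : P.valuation K x ≤ 1) : x ∈ v.ring := by
      obtain ⟨n, ⟨d, hd⟩, h⟩ := P.exists_primeCompl_mul_eq_of_integer x hx
      have hd0 : algebraMap (𝓞 K) K d ≠ 0 := by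
        intro h0
        rw [FaithfulSMul.algebraMap_eq_zero_iff] at h0
        exact hd (h0 ▸ zero_mem _)
      rw [eq_div_of_mul_eq hd0 h, div_eq_mul_inv]
      exact mul_mem (v.algebraMap_mem n) (hφ d hd)
    refine ⟨P, ?_⟩
    ext x
    refine ⟨hle x, fun hx ↦ ?_⟩
    by_contra hx'
    replace hx' : 1 < P.valuation K x := not_le.mp hx'
    obtain ⟨z, hz⟩ := v.ring_ne_top
    -- An element `x` of the larger ring outside the localization has powers that exceed any `z`, so
    -- every `z` would lie in `v.ring`.
    obtain ⟨n, hn⟩ := MulArchimedean.arch (P.valuation K z) hx'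
    have hx0 : x ≠ 0 := by
      rintro rfl
      simp at hx'
    have h1 : P.valuation K (z * (x ^ n)⁻¹) ≤ 1 := by
      rw [← div_eq_mul_inv, map_div₀, map_pow, div_le_one₀ (pow_pos (zero_lt_one.trans hx') n)]
      exact hn
    have h2 := mul_mem (hle _ h1) (pow_mem hx n)
    rw [inv_mul_cancel_right₀ (pow_ne_zero n hx0)] at h2
    exact hz h2

/-- The places of a number field are its finite places. -/
noncomputable def equivFinitePlace : FinitePlace K ≃ NonarchPlace K :=
  FinitePlace.equivHeightOneSpectrum.trans (Equiv.ofBijective _ ofHeightOne_bijective)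

theorem abv_equivFinitePlace (w : FinitePlace K) (x : K) : (equivFinitePlace w).abv x = w x := by
  rw [← FinitePlace.norm_embedding_eq, FinitePlace.norm_embedding,
    NumberField.HeightOneSpectrum.adicAbv_def]
  change (ofHeightOne w.maximalIdeal).abv x = _
  rw [abv_eq, val_ofHeightOne]
  have h (a b : ℕ) (ha : (a : ℝ≥0) ≠ 0) (hb : (b : ℝ≥0) ≠ 0) (hab : a = b) (y : ℤᵐ⁰) :
    WithZeroMulInt.toNNReal ha y = WithZeroMulInt.toNNReal hb y := by subst hab; rfl
  rw [h _ _ _ _ (q_ofHeightOne w.maximalIdeal)]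

theorem abv_eq_one_iff {K : Type*} [Field K] (v : NonarchPlace K) {x : K} :
    v.abv x = 1 ↔ v.val x = 1 := by
  rw [le_antisymm_iff, le_antisymm_iff (a := v.val x), abv_le_one_iff,
    ← not_lt (a := v.abv x) (b := 1), ← not_lt (a := v.val x) (b := 1), abv_lt_one_iff]

theorem finite_setOf_val_ne_one_of_numberField {x : K} (hx : x ≠ 0) :
    {v : NonarchPlace K | v.val x ≠ 1}.Finite := by
  refine ((FinitePlace.hasFiniteMulSupport hx).image equivFinitePlace).subset fun v hv ↦ ?_
  refine ⟨equivFinitePlace.symm v, ?_, equivFinitePlace.apply_symm_apply v⟩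
  rw [Function.mem_mulSupport, ← abv_equivFinitePlace, Equiv.apply_symm_apply, ne_eq,
    abv_eq_one_iff]
  exact hv

theorem prod_abv_eq_one_of_numberField {x : K} (hx : x ≠ 0) :
    (∏ᶠ v : InfinitePlace K, v x ^ v.mult) * ∏ᶠ v : NonarchPlace K, v.abv x = 1 := by
  rw [finprod_eq_prod_of_fintype, ← prod_abs_eq_one hx,
    ← finprod_comp_equiv (equivFinitePlace (K := K))]
  simp only [abv_equivFinitePlace]

/-- `q_v` vanishes in the residue field and divides `B!`, so `B!` is a non-unit at all these places.
-/
theorem finite_setOf_q_le_of_numberField (B : ℕ) : {v : NonarchPlace K | v.q ≤ B}.Finite := by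
  have h0 : ((B.factorial : ℕ) : K) ≠ 0 := Nat.cast_ne_zero.mpr B.factorial_ne_zero
  refine (finite_setOf_val_ne_one_of_numberField h0).subset fun v hv ↦ ?_
  have h2 : (v.q : IsLocalRing.ResidueField v.ring) = 0 := by
    have := Fintype.ofFinite (IsLocalRing.ResidueField v.ring)
    rw [q, Nat.card_eq_fintype_card, Nat.cast_card_eq_zero]
  have h3 : (B.factorial : v.ring) ∈ IsLocalRing.maximalIdeal v.ring := by
    obtain ⟨c, hc⟩ := Nat.dvd_factorial (zero_lt_one.trans v.one_lt_q) hv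
    rw [← IsLocalRing.residue_eq_zero_iff, map_natCast, hc, Nat.cast_mul, h2, zero_mul]
  rw [← pow_one (IsLocalRing.maximalIdeal v.ring), mem_maximalIdeal_pow_iff] at h3
  refine (lt_of_le_of_lt (b := WithZero.exp (-1)) h3 ?_).ne
  rw [← WithZero.exp_zero, WithZero.exp_lt_exp]
  lia

end NonarchPlace


/-! ### Minkowski's theorem in terms of places -/

namespace NonarchPlace

open scoped nonZeroDivisors
open NumberField.mixedEmbedding MeasureTheory

variable {K : Type*} [Field K] [NumberField K]

/-- The maximal ideal of the ring of integers that corresponds to a place. -/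
noncomputable def heightOne (v : NonarchPlace K) : HeightOneSpectrum (𝓞 K) :=
  (Equiv.ofBijective _ ofHeightOne_bijective).symm v

theorem ofHeightOne_heightOne (v : NonarchPlace K) : ofHeightOne v.heightOne = v :=
  (Equiv.ofBijective _ ofHeightOne_bijective).apply_symm_apply v

theorem valuation_heightOne (v : NonarchPlace K) : v.heightOne.valuation K = v.val := by
  rw [← val_ofHeightOne, ofHeightOne_heightOne]

theorem absNorm_heightOne (v : NonarchPlace K) : Ideal.absNorm v.heightOne.asIdeal = v.q := by
  rw [← q_ofHeightOne, ofHeightOne_heightOne]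

open scoped Classical in
/-- Minkowski's theorem for an integral ideal. -/
theorem exists_ne_zero_of_minkowskiBound_lt {J : Ideal (𝓞 K)} (hJ : J ≠ ⊥)
    {f : InfinitePlace K → ℝ≥0}
    (h : (minkowskiBound K (1 : (FractionalIdeal (𝓞 K)⁰ K)ˣ)).toReal * Ideal.absNorm J <
      ∏ w, (f w : ℝ) ^ w.mult) :
    ∃ x ∈ J, x ≠ 0 ∧ ∀ w : InfinitePlace K, w (algebraMap (𝓞 K) K x) < f w := by
  have hJ0 : (J : FractionalIdeal (𝓞 K)⁰ K) ≠ 0 := FractionalIdeal.coeIdeal_ne_zero.mpr hJ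
  have h1 : minkowskiBound K (Units.mk0 (J : FractionalIdeal (𝓞 K)⁰ K) hJ0) =
      Ideal.absNorm J * minkowskiBound K (1 : (FractionalIdeal (𝓞 K)⁰ K)ˣ) := by
    rw [minkowskiBound, minkowskiBound, volume_fundamentalDomain_fractionalIdealLatticeBasis,
      volume_fundamentalDomain_fractionalIdealLatticeBasis, Units.val_mk0, Units.val_one,
      FractionalIdeal.coeIdeal_absNorm, map_one, Rat.cast_one, ENNReal.ofReal_one, one_mul,
      mul_assoc, Rat.cast_natCast, ENNReal.ofReal_natCast]
  have h2 : minkowskiBound K (Units.mk0 (J : FractionalIdeal (𝓞 K)⁰ K) hJ0) <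
      volume (convexBodyLT K f) := by
    rw [h1, convexBodyLT_volume, ← ENNReal.ofReal_toReal (minkowskiBound_lt_top K 1).ne,
      ← ENNReal.ofReal_natCast, ← ENNReal.ofReal_mul (Nat.cast_nonneg _), 
      mul_comm (Ideal.absNorm J : ℝ)]
    refine lt_of_lt_of_le ?_ (le_mul_of_one_le_left' (by
      exact_mod_cast one_le_convexBodyLTFactor K))
    rw [← ENNReal.ofReal_coe_nnreal]
    refine (ENNReal.ofReal_lt_ofReal_iff_of_nonneg (by positivity)).mpr ?_
    push_cast
    exact h
  obtain ⟨a, ha, ha0, haf⟩ := exists_ne_zero_mem_ideal_lt K _ h2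
  obtain ⟨x, hx, rfl⟩ := (FractionalIdeal.mem_coeIdeal _).mp ha
  exact ⟨x, hx, fun h ↦ ha0 (by rw [h, map_zero]), haf⟩

/-- For `D ≤ 0` the bounds at the finite places follow from membership in an integral ideal, whose
norm is the inverse of that of `D`. -/
theorem exists_dominated_of_nonpos (D : NonarchPlace K →₀ ℤ) (hD : D ≤ 0)
    {f : InfinitePlace K → ℝ≥0}
    (h : (minkowskiBound K (1 : (FractionalIdeal (𝓞 K)⁰ K)ˣ)).toReal <
      (∏ w, (f w : ℝ) ^ w.mult) * divisorNorm D) :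
    ∃ x : K, x ≠ 0 ∧ (∀ w : InfinitePlace K, w x < f w) ∧
      ∀ v : NonarchPlace K, v.val x ≤ WithZero.exp (D v) := by
  let J : Ideal (𝓞 K) := ∏ v ∈ D.support, v.heightOne.asIdeal ^ (D v).natAbs
  have hnorm : (Ideal.absNorm J : ℝ) = divisorNorm (-D) := by
    rw [map_prod, divisorNorm, Finsupp.prod, Finsupp.support_neg, Nat.cast_prod]
    refine Finset.prod_congr rfl fun v _ ↦ ?_
    have := hD v
    rw [Finsupp.zero_apply] at this
    rw [map_pow, absNorm_heightOne, Nat.cast_pow, ← zpow_natCast, Finsupp.neg_apply]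
    congr 1
    lia
  have hJ : J ≠ ⊥ := by
    rw [← Submodule.zero_eq_bot, Finset.prod_ne_zero_iff]
    exact fun v _ ↦ pow_ne_zero _ v.heightOne.ne_bot
  obtain ⟨x, hx, hx0, hxf⟩ := exists_ne_zero_of_minkowskiBound_lt (f := f) hJ (by
    rw [hnorm, divisorNorm_neg, ← div_eq_mul_inv, div_lt_iff₀ (divisorNorm_pos D)]
    exact h)
  refine ⟨algebraMap (𝓞 K) K x, by simpa using hx0, hxf, fun v ↦ ?_⟩
  by_cases hv : v ∈ D.support
  · have h1 : x ∈ v.heightOne.asIdeal ^ (D v).natAbs :=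
      Ideal.le_of_dvd (Finset.dvd_prod_of_mem _ hv) hx
    rw [← v.heightOne.intValuation_le_pow_iff_mem, ← HeightOneSpectrum.valuation_of_algebraMap
      (K := K), valuation_heightOne] at h1
    refine h1.trans (WithZero.exp_le_exp.mpr ?_)
    have := hD v
    rw [Finsupp.zero_apply] at this
    lia
  · rw [Finsupp.notMem_support_iff.mp hv, WithZero.exp_zero, valuation_le_one_iff]
    exact v.algebraMap_mem x

end NonarchPlace

open NonarchPlace in
theorem HasProductFormula.of_numberField (K : Type*) [Field K] [NumberField K] :
    HasProductFormula K where
  nonempty_nonarchPlace := by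
    obtain ⟨P, hP⟩ := Ideal.exists_maximal (𝓞 K)
    exact ⟨ofHeightOne ⟨P, hP.isPrime,
      Ring.ne_bot_of_isMaximal_of_not_isField hP (RingOfIntegers.not_isField K)⟩⟩
  finite_setOf_val_ne_one x hx := finite_setOf_val_ne_one_of_numberField hx
  prod_eq_one x hx := prod_abv_eq_one_of_numberField hx
  finite_setOf_q_le B := finite_setOf_q_le_of_numberField B
  exists_dominated := by
    refine ⟨(mixedEmbedding.minkowskiBound K
      (1 : (FractionalIdeal (nonZeroDivisors (𝓞 K)) K)ˣ)).toReal, fun a ha ↦ ?_⟩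
    -- A positive integer that clears the poles allowed by `a`. Multiplication by `y` reduces to an
    -- integral ideal and, by the product formula, does not change the absolute value; the result is
    -- divided by `y` again.
    let y : K := ((∏ v ∈ a.divisor.support, v.q ^ (a.divisor v).natAbs : ℕ) : K)
    have hy : y ≠ 0 := Nat.cast_ne_zero.mpr (Finset.prod_ne_zero_iff.mpr fun v _ ↦
      pow_ne_zero _ (zero_lt_one.trans v.one_lt_q).ne')
    let Y : NonarchPlace K →₀ ℤ := Finsupp.ofSupportFinite (fun v ↦ WithZero.log (v.val y))
      ((finite_setOf_val_ne_one_of_numberField hy).subset fun v hv h ↦ hv (by simp [h]))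
    have hY (v) : WithZero.exp (Y v) = v.val y :=
      WithZero.exp_log ((Valuation.ne_zero_iff _).mpr hy)
    have hnat (v : NonarchPlace K) (n : ℕ) : v.val (n : K) ≤ 1 :=
      (v.valuation_le_one_iff _).mpr (natCast_mem v.ring n)
    have hq (v : NonarchPlace K) : v.val (v.q : K) ≤ WithZero.exp (-1) := by
      have h2 : (v.q : IsLocalRing.ResidueField v.ring) = 0 := by
        have := Fintype.ofFinite (IsLocalRing.ResidueField v.ring)
        rw [q, Nat.card_eq_fintype_card, Nat.cast_card_eq_zero]
      have h3 : (v.q : v.ring) ∈ IsLocalRing.maximalIdeal v.ring := by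
        rw [← IsLocalRing.residue_eq_zero_iff, map_natCast, h2]
      rw [← pow_one (IsLocalRing.maximalIdeal v.ring), mem_maximalIdeal_pow_iff] at h3
      exact h3
    have hD : a.divisor + Y ≤ 0 := by
      classical
      intro v
      rw [Finsupp.add_apply, Finsupp.zero_apply, ← le_neg_iff_add_nonpos_left,
        ← WithZero.exp_le_exp, hY]
      by_cases hv : v ∈ a.divisor.support
      · have h1 : y = ((v.q : K) ^ (a.divisor v).natAbs) *
            ((∏ v ∈ a.divisor.support.erase v, v.q ^ (a.divisor v).natAbs : ℕ) : K) := by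
          rw [← Nat.cast_pow, ← Nat.cast_mul, Finset.mul_prod_erase _
            (fun v ↦ v.q ^ (a.divisor v).natAbs) hv]
        rw [h1, map_mul, map_pow]
        refine (mul_le_mul' (pow_le_pow_left₀ zero_le (hq v) _) (hnat v _)).trans ?_
        rw [mul_one, ← WithZero.exp_nsmul, WithZero.exp_le_exp, nsmul_eq_mul]
        lia
      · rw [Finsupp.notMem_support_iff.mp hv, neg_zero, WithZero.exp_zero]
        exact hnat v _
    let f : InfinitePlace K → ℝ≥0 := fun w ↦ ‖Adeles.infEval w a.1‖₊ * (w y).toNNReal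
    have hf (w) : (f w : ℝ) = ‖Adeles.infEval w a.1‖ * w y := by
      rw [NNReal.coe_mul, coe_nnnorm, Real.coe_toNNReal _ (apply_nonneg w y)]
    have hprod : (∏ w, (f w : ℝ) ^ w.mult) * divisorNorm (a.divisor + Y) = a.absValue := by
      have h1 := prod_abv_eq_one_of_numberField hy
      have h2 : ∏ᶠ v : NonarchPlace K, v.abv y = divisorNorm Y := by
        rw [← finprod_zpow_eq_divisorNorm]
        exact finprod_congr fun v ↦ v.abv_eq_zpow hy
      rw [h2, finprod_eq_prod_of_fintype] at h1
      rw [Ideles.absValue_eq, finprod_eq_prod_of_fintype, divisorNorm_add]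
      simp only [hf, mul_pow, Finset.prod_mul_distrib]
      rw [mul_mul_mul_comm, h1, mul_one]
    rw [← hprod] at ha
    obtain ⟨x, hx0, hxf, hx⟩ := exists_dominated_of_nonpos _ hD ha
    refine ⟨x / y, div_ne_zero hx0 hy, fun w ↦ ?_, fun v ↦ ?_⟩
    · rw [map_div₀, div_le_iff₀ (InfinitePlace.pos_iff.mpr hy), ← hf]
      exact (hxf w).le
    · rw [map_div₀, ← a.exp_divisor, div_le_iff₀ (zero_lt_iff.mpr
        ((Valuation.ne_zero_iff _).mpr hy)), ← hY, ← WithZero.exp_add]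
      exact hx v

instance HasProductFormula.of_isGlobalField (K : Type*) [Field K] [h : IsGlobalField K] :
    HasProductFormula K := by
  rcases h.out with h | ⟨p, hp, halg, hfin⟩
  · exact .of_numberField K
  · let : Algebra (ZMod p) K := ((algebraMap (RatFunc (ZMod p)) K).comp (algebraMap _ _)).toAlgebra
    have : IsScalarTower (ZMod p) (RatFunc (ZMod p)) K := .of_algebraMap_eq fun _ ↦ rfl
    have := IsFunctionField.of_ratFunc (ZMod p) K
    exact IsFunctionField.hasProductFormula p K


/-! ## Adeles and ideles -/

theorem NumberField.InfinitePlace.isCompact_closedBall {K : Type*} [Field K] (v : InfinitePlace K)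
    (B : ℝ) : IsCompact (Metric.closedBall (0 : v.Completion) B) := by
  have h : Topology.IsClosedEmbedding (Completion.extensionEmbedding v) :=
    (Completion.isometry_extensionEmbedding v).isClosedEmbedding
  convert! h.isCompact_preimage (ProperSpace.isCompact_closedBall (0 : ℂ) B) using 1
  ext x
  simp [(Completion.isometry_extensionEmbedding v).norm_map_of_map_zero (map_zero _)]

namespace Adeles

variable {K : Type*} [Field K]

instance : T2Space (Adeles K) := by
  have h1 (v : NonarchPlace K) : T2Space v.Completion := inferInstance
  have h2 : T2Space (NonarchAdeles K) := by
    exact T2Space.of_injective_continuous DFunLike.coe_injective RestrictedProduct.continuous_coe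
  exact inferInstanceAs (T2Space ((∀ v : InfinitePlace K, v.Completion) × NonarchAdeles K))

theorem continuous_infEval (v : InfinitePlace K) : Continuous (infEval v) :=
  (continuous_apply v).comp (continuous_fst (X := InfiniteAdeleRing K) (Y := NonarchAdeles K))

theorem continuous_nonarchEval (v : NonarchPlace K) : Continuous (nonarchEval v) :=
  (RestrictedProduct.continuous_eval v).comp
    (continuous_snd (X := InfiniteAdeleRing K) (Y := NonarchAdeles K))

@[ext] theorem ext {a b : Adeles K} (h : ∀ v : InfinitePlace K, infEval v a = infEval v b)
    (h' : ∀ v : NonarchPlace K, nonarchEval v a = nonarchEval v b) : a = b :=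
  Prod.ext (funext h) (RestrictedProduct.ext _ _ h')

/-- The adele with given components. -/
noncomputable def mk (f : ∀ v : InfinitePlace K, v.Completion) (g : ∀ v : NonarchPlace K, v.Completion)
    (h : {v | g v ∉ v.Integers}.Finite) : Adeles K :=
  ((f, ⟨g, h⟩) : InfiniteAdeleRing K × NonarchAdeles K)

@[simp] theorem infEval_mk (f : ∀ v : InfinitePlace K, v.Completion)
    (g : ∀ v : NonarchPlace K, v.Completion) (h) (v : InfinitePlace K) :
    infEval v (mk f g h) = f v := rfl

@[simp] theorem nonarchEval_mk (f : ∀ v : InfinitePlace K, v.Completion)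
    (g : ∀ v : NonarchPlace K, v.Completion) (h) (v : NonarchPlace K) :
    nonarchEval v (mk f g h) = g v := rfl

theorem isOpen_setOf_integral : IsOpen {a : Adeles K | ∀ v, nonarchEval v a ∈ v.Integers} :=
  (RestrictedProduct.isOpen_forall_mem (R := fun v : NonarchPlace K ↦ v.Completion)
    (A := fun v ↦ (v.Integers : Set v.Completion)) fun v ↦ v.isOpen_integers).preimage
      (continuous_snd (X := InfiniteAdeleRing K) (Y := NonarchAdeles K))

/-- On everywhere integral families the restricted product topology is the product topology, so
Tychonoff applies. -/
theorem isCompact_setOf_integral (B : ℝ) :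
    IsCompact {a : Adeles K | (∀ v, ‖infEval v a‖ ≤ B) ∧ ∀ v, nonarchEval v a ∈ v.Integers} := by
  have h1 : IsCompact (Set.univ.pi fun v : InfinitePlace K ↦
      Metric.closedBall (0 : v.Completion) B) :=
    isCompact_univ_pi fun v ↦ v.isCompact_closedBall B
  have h2 : IsCompact (Set.range (RestrictedProduct.structureMap
      (fun v : NonarchPlace K ↦ v.Completion) (fun v ↦ (v.Integers : Set v.Completion))
        Filter.cofinite)) := by
    have (v : NonarchPlace K) : CompactSpace (v.Integers : Set v.Completion) :=
      isCompact_iff_compactSpace.mp v.isCompact_integers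
    exact isCompact_range RestrictedProduct.isEmbedding_structureMap.continuous
  rw [RestrictedProduct.range_structureMap] at h2
  convert! h1.prod h2 using 1
  ext a
  refine and_congr (forall_congr' fun v ↦ ?_) Iff.rfl
  exact ⟨fun h _ ↦ mem_closedBall_zero_iff.mpr h, fun h ↦ mem_closedBall_zero_iff.mp (h trivial)⟩

end Adeles

namespace Ideles

variable {K : Type*} [Field K]

@[ext] theorem ext {a b : Ideles K}
    (h : ∀ v : InfinitePlace K, Adeles.infEval v a.1 = Adeles.infEval v b.1)
    (h' : ∀ v : NonarchPlace K, Adeles.nonarchEval v a.1 = Adeles.nonarchEval v b.1) : a = b :=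
  Units.ext (Adeles.ext h h')

/-- The idele with given components. -/
noncomputable def mk (f : ∀ v : InfinitePlace K, v.Completion) (g : ∀ v : NonarchPlace K, v.Completion)
    (hf : ∀ v, f v ≠ 0) (hg : ∀ v, g v ≠ 0) (h : {v | Valued.v (g v) ≠ 1}.Finite) : Ideles K where
  val := Adeles.mk f g (h.subset fun v hv h1 ↦ hv h1.le)
  inv := Adeles.mk (fun v ↦ (f v)⁻¹) (fun v ↦ (g v)⁻¹) (h.subset fun v hv h1 ↦ hv
    (show Valued.v (g v)⁻¹ ≤ 1 by rw [map_inv₀, h1, inv_one]))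
  val_inv := by
    ext v
    · simp [hf]
    · simp [hg]
  inv_val := by
    ext v
    · simp [hf]
    · simp [hg]

@[simp] theorem infEval_mk (f : ∀ v : InfinitePlace K, v.Completion)
    (g : ∀ v : NonarchPlace K, v.Completion) (hf hg h) (v : InfinitePlace K) :
    Adeles.infEval v (mk f g hf hg h).1 = f v := rfl

@[simp] theorem nonarchEval_mk (f : ∀ v : InfinitePlace K, v.Completion)
    (g : ∀ v : NonarchPlace K, v.Completion) (hf hg h) (v : NonarchPlace K) :
    Adeles.nonarchEval v (mk f g hf hg h).1 = g v := rfl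

theorem infEval_inv (a : Ideles K) (v : InfinitePlace K) :
    Adeles.infEval v (a⁻¹).1 = (Adeles.infEval v a.1)⁻¹ := by
  rw [map_units_inv]

theorem nonarchEval_inv (a : Ideles K) (v : NonarchPlace K) :
    Adeles.nonarchEval v (a⁻¹).1 = (Adeles.nonarchEval v a.1)⁻¹ := by
  rw [map_units_inv]

/-- The principal idele of `x`. -/
noncomputable def diag [HasProductFormula K] (x : Kˣ) : Ideles K :=
  mk (fun v ↦ algebraMap K v.Completion x) (fun v ↦ algebraMap K v.Completion x)
    (fun v ↦ by rw [ne_eq, map_eq_zero]; exact x.ne_zero)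
    (fun v ↦ by rw [ne_eq, map_eq_zero]; exact x.ne_zero) (by
      simp only [NonarchPlace.valued_algebraMap]
      exact HasProductFormula.finite_setOf_val_ne_one _ x.ne_zero)

theorem diag_mem_principal [HasProductFormula K] (x : Kˣ) : diag x ∈ principal K :=
  ⟨x, fun _ ↦ rfl, fun _ ↦ rfl⟩

theorem absValue_diag [HasProductFormula K] (x : Kˣ) : absValue (diag x) = 1 := by
  rw [← HasProductFormula.prod_eq_one (x : K) x.ne_zero, absValue]
  congr 1
  · refine finprod_congr fun v ↦ ?_
    rw [diag, infEval_mk]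
    congr 1
    exact InfinitePlace.Completion.norm_coe v (WithAbs.toAbs v.1 (x : K))
  · refine finprod_congr fun v ↦ ?_
    rw [diag, nonarchEval_mk, NonarchPlace.normAbs_algebraMap_eq_abv]

theorem eq_diag_of_mem_principal [HasProductFormula K] {a : Ideles K} (ha : a ∈ principal K) :
    ∃ x : Kˣ, a = diag x := by
  obtain ⟨x, hx, hx'⟩ := ha
  exact ⟨x, Ideles.ext hx hx'⟩

theorem absValue_pos [IsGlobalField K] (a : Ideles K) : 0 < absValue a := by
  rw [absValue_eq]
  refine mul_pos ?_ (NonarchPlace.divisorNorm_pos _)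
  have := Fintype.ofFinite (InfinitePlace K)
  rw [finprod_eq_prod_of_fintype]
  exact Finset.prod_pos fun v _ ↦ pow_pos (norm_pos_iff.mpr (a.infEval_ne_zero v)) _

/-- The logarithm of the idelic absolute value. -/
noncomputable def logAbs [IsGlobalField K] : Ideles K →* Multiplicative ℝ where
  toFun a := Multiplicative.ofAdd (Real.log (absValue a))
  map_one' := by rw [absValue_one, Real.log_one]; rfl
  map_mul' a b := by
    rw [absValue_mul, Real.log_mul (absValue_pos a).ne' (absValue_pos b).ne']
    rfl

/-- It suffices to check at `1`: on the open set of ideles that are units at all non-Archimedean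
places, only the finite product of Archimedean norms remains. -/
theorem continuous_logAbs [IsGlobalField K] : Continuous (logAbs (K := K)) := by
  refine continuous_of_continuousAt_one _ ?_
  have := Fintype.ofFinite (InfinitePlace K)
  have h1 : ContinuousAt (fun a : Ideles K ↦ Multiplicative.ofAdd (Real.log
      (∏ v : InfinitePlace K, ‖Adeles.infEval v a.1‖ ^ v.mult))) 1 := by
    refine continuous_ofAdd.continuousAt.comp (ContinuousAt.log ?_ ?_)
    · exact (continuous_finsetProd _ fun v _ ↦ (((Adeles.continuous_infEval v).comp
        Units.continuous_val).norm.pow _)).continuousAt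
    · simp
  refine h1.congr ?_
  have h2 : IsOpen {a : Ideles K | (∀ v, Adeles.nonarchEval v a.1 ∈ v.Integers) ∧
      ∀ v, Adeles.nonarchEval v (a⁻¹).1 ∈ v.Integers} :=
    (Adeles.isOpen_setOf_integral.preimage Units.continuous_val).inter
      (Adeles.isOpen_setOf_integral.preimage (Units.continuous_val.comp continuous_inv))
  filter_upwards [h2.mem_nhds ⟨fun v ↦ by rw [Units.val_one, map_one]; exact one_mem _,
    fun v ↦ by rw [inv_one, Units.val_one, map_one]; exact one_mem _⟩] with a ha
  have h3 (v : NonarchPlace K) : (v.normAbs (Adeles.nonarchEval v a.1) : ℝ) = 1 := by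
    have h4 : v.normAbs (Adeles.nonarchEval v a.1) ≤ 1 := v.normAbs_le_one_iff.mpr (ha.1 v)
    have h5 : v.normAbs (Adeles.nonarchEval v (a⁻¹).1) ≤ 1 := v.normAbs_le_one_iff.mpr (ha.2 v)
    rw [nonarchEval_inv, map_inv₀, inv_le_one₀ (zero_lt_iff.mpr
      ((map_ne_zero _).mpr (a.nonarchEval_ne_zero v)))] at h5
    exact_mod_cast h4.antisymm h5
  change _ = Multiplicative.ofAdd (Real.log (absValue a))
  rw [absValue, finprod_congr h3, finprod_one, mul_one, finprod_eq_prod_of_fintype]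

end Ideles


/-! ### Discreteness of principal ideles and compact sets of ideles -/

namespace Ideles

variable {K : Type*} [Field K] [IsGlobalField K]

theorem le_prod_of_one_le {ι : Type*} {s : Finset ι} {f : ι → ℝ} (h : ∀ i ∈ s, 1 ≤ f i) {i : ι}
    (hi : i ∈ s) : f i ≤ ∏ j ∈ s, f j := by
  classical
  rw [← Finset.mul_prod_erase s f hi]
  refine le_mul_of_one_le_right (zero_le_one.trans (h i hi)) ?_
  refine Finset.prod_induction _ (1 ≤ ·) (fun _ _ ↦ one_le_mul_of_one_le_of_one_le) le_rfl
    fun j hj ↦ h j (Finset.mem_of_mem_erase hj)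

/-- If `x ≠ 1` were near `1`, then `x - 1` would have absolute value at most `1` everywhere and less
than `1` at `v₀`, against the product formula. So the principal ideles are discrete, hence closed.
The place `v₀` makes the inequality strict even without infinite places. -/
theorem isClosed_principal : IsClosed (principal K : Set (Ideles K)) := by
  obtain ⟨v₀⟩ := HasProductFormula.nonempty_nonarchPlace (K := K)
  have := Fintype.ofFinite (InfinitePlace K)
  have hball : IsOpen {x : v₀.Completion | Valued.v (x - 1) < 1} := by
    have h1 := (Valued.isOpen_ball v₀.Completion 1).preimage (continuous_sub_right 1)
    convert! h1 using 1
    ext x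
    simp [Valuation.restrict_lt_one_iff]
  let V : Set (Ideles K) := {a | (∀ v, Adeles.nonarchEval v a.1 ∈ v.Integers) ∧
    (∀ v, ‖Adeles.infEval v a.1 - 1‖ < 1) ∧ Valued.v (Adeles.nonarchEval v₀ a.1 - 1) < 1}
  have hV : IsOpen V := by
    refine (Adeles.isOpen_setOf_integral.preimage Units.continuous_val).inter (IsOpen.inter ?_ ?_)
    · have h2 : IsOpen {a : Ideles K | ∀ v, ‖Adeles.infEval v a.1 - 1‖ < 1} := by
        have h : {a : Ideles K | ∀ v, ‖Adeles.infEval v a.1 - 1‖ < 1} =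
            ⋂ v, {a : Ideles K | ‖Adeles.infEval v a.1 - 1‖ < 1} := by
          ext
          simp
        rw [h]
        refine isOpen_iInter_of_finite fun v ↦ ?_
        exact isOpen_lt (((Adeles.continuous_infEval v).comp Units.continuous_val).sub
          continuous_const).norm continuous_const
      exact h2
    · exact hball.preimage ((Adeles.continuous_nonarchEval v₀).comp Units.continuous_val)
  have hV1 : (1 : Ideles K) ∈ V := by
    refine ⟨fun v ↦ ?_, fun v ↦ ?_, ?_⟩
    · rw [Units.val_one, map_one]
      exact one_mem _
    · simp
    · simp
  have key (a : Ideles K) (ha : a ∈ principal K) (haV : a ∈ V) : a = 1 := by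
    obtain ⟨x, rfl⟩ := eq_diag_of_mem_principal ha
    by_contra hne
    have hx : (x : K) - 1 ≠ 0 := by
      intro h
      refine hne ?_
      have : x = 1 := Units.ext (sub_eq_zero.mp h)
      subst this
      ext v
      · simp [diag]
      · simp [diag]
    have h1 := HasProductFormula.prod_eq_one _ hx
    have h2 (v : NonarchPlace K) : v.abv ((x : K) - 1) ≤ 1 := by
      rw [v.abv_le_one_iff, v.valuation_le_one_iff]
      refine sub_mem ?_ (one_mem _)
      rw [← v.valuation_le_one_iff, ← v.valued_algebraMap]
      exact haV.1 v
    have h3 : v₀.abv ((x : K) - 1) < 1 := by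
      rw [v₀.abv_lt_one_iff, ← v₀.valued_algebraMap, map_sub, map_one]
      exact haV.2.2
    have h4 (v : InfinitePlace K) : v ((x : K) - 1) ≤ 1 := by
      have := haV.2.1 v
      change ‖algebraMap K v.Completion x - 1‖ < 1 at this
      rw [← map_one (algebraMap K v.Completion), ← map_sub] at this
      refine (le_of_eq ?_).trans this.le
      exact (InfinitePlace.Completion.norm_coe v (WithAbs.toAbs v.1 ((x : K) - 1))).symm
    refine absurd h1 (ne_of_lt ?_)
    rw [finprod_eq_prod_of_fintype]
    have h5 : ∏ v : InfinitePlace K, v ((x : K) - 1) ^ v.mult ≤ 1 :=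
      Finset.prod_le_one (fun v _ ↦ pow_nonneg (apply_nonneg v _) _)
        fun v _ ↦ pow_le_one₀ (apply_nonneg v _) (h4 v)
    have hfin : (Function.mulSupport fun v : NonarchPlace K ↦ v.abv ((x : K) - 1)).Finite := by
      refine (HasProductFormula.finite_setOf_val_ne_one _ hx).subset fun v hv h ↦ hv ?_
      exact v.abv_eq_one_iff.mpr h
    have h6 : ∏ᶠ v : NonarchPlace K, v.abv ((x : K) - 1) < 1 := by
      classical
      rw [finprod_eq_prod _ hfin]
      have hmem : v₀ ∈ hfin.toFinset := by
        rw [Set.Finite.mem_toFinset]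
        exact h3.ne
      rw [← Finset.mul_prod_erase _ _ hmem]
      refine mul_lt_one_of_nonneg_of_lt_one_left (apply_nonneg _ _) h3 ?_
      exact Finset.prod_le_one (fun v _ ↦ apply_nonneg _ _) fun v _ ↦ h2 v
    exact mul_lt_one_of_nonneg_of_lt_one_right h5 (finprod_nonneg fun v ↦ apply_nonneg _ _) h6
  have hdisc : DiscreteTopology (principal K) := by
    rw [discreteTopology_iff_isOpen_singleton_one]
    refine ⟨V, hV, ?_⟩
    ext a
    exact ⟨fun h ↦ Subtype.ext (key a a.2 h), fun h ↦ by rw [h]; exact hV1⟩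
  exact Subgroup.isClosed_of_discrete

/-- The idele with component `x` at a non-Archimedean place `v` and components `1` elsewhere. -/
noncomputable def single {K : Type*} [Field K] (v : NonarchPlace K) (x : v.Completion)
    (hx : x ≠ 0) : Ideles K := by
  classical
  exact mk 1 (Pi.mulSingle v x) (fun _ ↦ one_ne_zero)
    (fun w ↦ by
      rcases eq_or_ne w v with rfl | h
      · rwa [Pi.mulSingle_eq_same]
      · rw [Pi.mulSingle_eq_of_ne h]
        exact one_ne_zero)
    ((Set.finite_singleton v).subset fun w hw ↦ by
      by_contra h
      exact hw (by rw [Pi.mulSingle_eq_of_ne h, map_one]))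

theorem nonarchEval_single {K : Type*} [Field K] (v : NonarchPlace K) (x : v.Completion)
    (hx : x ≠ 0) : Adeles.nonarchEval v (single v x hx).1 = x := by
  classical
  exact Pi.mulSingle_eq_same (M := fun v : NonarchPlace K ↦ v.Completion) v x

theorem nonarchEval_single_of_ne {K : Type*} [Field K] (v : NonarchPlace K) (x : v.Completion)
    (hx : x ≠ 0) {w : NonarchPlace K} (h : w ≠ v) :
    Adeles.nonarchEval w (single v x hx).1 = 1 := by
  classical
  exact Pi.mulSingle_eq_of_ne (M := fun v : NonarchPlace K ↦ v.Completion) h x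

theorem infEval_single {K : Type*} [Field K] (v : NonarchPlace K) (x : v.Completion)
    (hx : x ≠ 0) (w : InfinitePlace K) : Adeles.infEval w (single v x hx).1 = 1 := rfl

theorem absValue_single {K : Type*} [Field K] (v : NonarchPlace K) (x : v.Completion)
    (hx : x ≠ 0) : absValue (single v x hx) = v.normAbs x := by
  rw [absValue, finprod_eq_single _ v, nonarchEval_single]
  · simp [infEval_single]
  · intro w hw
    simp [nonarchEval_single_of_ne v x hx hw]

theorem exists_lt_absValue (C : ℝ) : ∃ b : Ideles K, C < absValue b := by
  obtain ⟨v⟩ := HasProductFormula.nonempty_nonarchPlace (K := K)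
  obtain ⟨π, hπ0, hπ⟩ := v.exists_uniformizer
  obtain ⟨n, hn⟩ := pow_unbounded_of_one_lt C v.one_lt_q_real
  refine ⟨single v (algebraMap K v.Completion (π⁻¹ ^ n))
    (by simpa using fun h ↦ absurd h hπ0), hn.trans_le ?_⟩
  rw [absValue_single, v.normAbs_algebraMap_eq_abv, v.abv_eq_zpow (pow_ne_zero _ (inv_ne_zero hπ0)),
    map_pow, map_inv₀, hπ, ← WithZero.exp_neg, ← WithZero.exp_nsmul, WithZero.log_exp]
  simp

/-- The ideles with prescribed bounds for all components form a compact set. -/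
theorem exists_isCompact (B : ℝ) : ∃ W : Set (Ideles K), IsCompact W ∧ ∀ a : Ideles K,
    (∀ v, 1 ≤ ‖Adeles.infEval v a.1‖ ∧ ‖Adeles.infEval v a.1‖ ≤ B) →
    (∀ v : NonarchPlace K, 1 ≤ v.normAbs (Adeles.nonarchEval v a.1)) →
    (∀ v : NonarchPlace K, (v.normAbs (Adeles.nonarchEval v a.1) : ℝ) ≤ B) →
    (∀ v : NonarchPlace K, B < v.q → v.normAbs (Adeles.nonarchEval v a.1) = 1) → a ∈ W := by
  classical
  obtain ⟨n, hn⟩ := exists_nat_ge B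
  have hS := HasProductFormula.finite_setOf_q_le (K := K) n
  choose π hπ0 hπ using fun v : NonarchPlace K ↦ v.exists_uniformizer
  -- an idele that dominates all elements of the compact set
  let d : Ideles K := mk 1 (fun v ↦ if v.q ≤ n then algebraMap K v.Completion ((π v)⁻¹ ^ n) else 1)
    (fun _ ↦ one_ne_zero)
    (fun v ↦ by
      split_ifs
      · rw [ne_eq, map_eq_zero]
        exact pow_ne_zero _ (inv_ne_zero (hπ0 v))
      · exact one_ne_zero)
    (hS.subset fun v hv ↦ by
      by_contra h
      exact hv (by rw [if_neg (show ¬ v.q ≤ n from h), map_one]))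
  let A : Set (Adeles K) := (fun x ↦ d.1 * x) ''
    {a : Adeles K | (∀ v, ‖Adeles.infEval v a‖ ≤ max B 1) ∧
      ∀ v, Adeles.nonarchEval v a ∈ v.Integers}
  have hA : IsCompact A := (Adeles.isCompact_setOf_integral _).image (continuous_const_mul d.1)
  have hmemA (a : Adeles K) (h : ∀ v, ‖Adeles.infEval v a‖ ≤ max B 1)
      (h1 : ∀ v : NonarchPlace K, (v.normAbs (Adeles.nonarchEval v a) : ℝ) ≤ max B 1)
      (h2 : ∀ v : NonarchPlace K, B < v.q → v.normAbs (Adeles.nonarchEval v a) ≤ 1) : a ∈ A := by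
    refine ⟨(d⁻¹).1 * a, ⟨fun v ↦ ?_, fun v ↦ ?_⟩, by
      dsimp only
      rw [← mul_assoc, Units.mul_inv, one_mul]⟩
    · rw [map_mul, infEval_inv, infEval_mk, Pi.one_apply, inv_one, one_mul]
      exact h v
    · refine v.normAbs_le_one_iff.mp ?_
      rw [map_mul, nonarchEval_inv, nonarchEval_mk]
      split_ifs with hv
      · rw [map_mul, map_inv₀, inv_mul_le_one₀ (zero_lt_iff.mpr ((map_ne_zero _).mpr ((map_ne_zero _).mpr
          (pow_ne_zero _ (inv_ne_zero (hπ0 v)))))), ← NNReal.coe_le_coe]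
        refine (h1 v).trans ?_
        rw [v.normAbs_algebraMap_eq_abv, v.abv_eq_zpow (pow_ne_zero _ (inv_ne_zero (hπ0 v))),
          map_pow, map_inv₀, hπ, ← WithZero.exp_neg, ← WithZero.exp_nsmul, WithZero.log_exp]
        have h3 : ((n : ℝ)) ≤ (v.q : ℝ) ^ n := by
          exact_mod_cast (Nat.lt_pow_self v.one_lt_q).le
        have h4 : (1 : ℝ) ≤ (v.q : ℝ) ^ n := one_le_pow₀ v.one_lt_q_real.le
        simpa using ⟨hn.trans h3, h4⟩
      · rw [inv_one, one_mul]
        exact h2 v (hn.trans_lt (by exact_mod_cast not_le.mp hv))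
  refine ⟨{a | a.1 ∈ A ∧ (a⁻¹).1 ∈ A}, Units.isCompact_of_val_of_inv ?_ hA hA fun u hu ↦ hu, ?_⟩
  · exact (hA.isClosed.preimage Units.continuous_val).inter
      (hA.isClosed.preimage (Units.continuous_val.comp continuous_inv))
  · intro a h1 h2 h3 h4
    refine ⟨hmemA _ (fun v ↦ (h1 v).2.trans (le_max_left _ _))
      (fun v ↦ (h3 v).trans (le_max_left _ _)) fun v hv ↦ (h4 v hv).le, hmemA _ (fun v ↦ ?_)
      (fun v ↦ ?_) fun v hv ↦ ?_⟩
    · rw [infEval_inv, norm_inv]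
      exact (inv_le_one_of_one_le₀ (h1 v).1).trans (le_max_right _ _)
    · rw [nonarchEval_inv, map_inv₀]
      refine le_trans ?_ (le_max_right _ _)
      exact_mod_cast inv_le_one_of_one_le₀ (h2 v)
    · rw [nonarchEval_inv, map_inv₀]
      exact inv_le_one_of_one_le₀ (h2 v)

end Ideles


/-! ## Idele classes -/

namespace IdeleClassGroup

variable {K : Type*} [Field K] [IsGlobalField K]

instance : T2Space (IdeleClassGroup K) := by
  have : IsClosed (Ideles.principal K : Set (Ideles K)) := Ideles.isClosed_principal
  exact inferInstanceAs (T2Space (Ideles K ⧸ Ideles.principal K))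

omit [IsGlobalField K] in
theorem mk_surjective : Function.Surjective (mk : Ideles K →* IdeleClassGroup K) :=
  QuotientGroup.mk'_surjective _

omit [IsGlobalField K] in
theorem continuous_mk : Continuous (mk : Ideles K →* IdeleClassGroup K) :=
  QuotientGroup.continuous_mk

omit [IsGlobalField K] in
theorem mk_eq_one_iff {a : Ideles K} : mk a = 1 ↔ a ∈ Ideles.principal K :=
  QuotientGroup.eq_one_iff a

/-- The logarithm of the absolute value of an idele class. -/
noncomputable def logAbs : IdeleClassGroup K →* Multiplicative ℝ :=
  QuotientGroup.lift (Ideles.principal K) Ideles.logAbs (by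
    intro a ha
    obtain ⟨x, rfl⟩ := Ideles.eq_diag_of_mem_principal ha
    change Multiplicative.ofAdd (Real.log (Ideles.absValue (Ideles.diag x))) = 1
    rw [Ideles.absValue_diag, Real.log_one]
    rfl)

/-- The logarithm of the absolute value of an idele class, as a real number. -/
noncomputable def logAbsReal (c : IdeleClassGroup K) : ℝ := (logAbs c).toAdd

theorem logAbsReal_mk (a : Ideles K) : logAbsReal (mk a) = Real.log (Ideles.absValue a) := rfl

theorem logAbsReal_mul (c d : IdeleClassGroup K) :
    logAbsReal (c * d) = logAbsReal c + logAbsReal d := by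
  rw [logAbsReal, map_mul]
  rfl

theorem logAbsReal_mk_eq_zero_iff {a : Ideles K} :
    logAbsReal (mk a) = 0 ↔ Ideles.absValue a = 1 := by
  rw [logAbsReal_mk, Real.log_eq_zero]
  have := Ideles.absValue_pos a
  constructor
  · rintro (h | h | h) <;> linarith
  · exact fun h ↦ Or.inr (Or.inl h)

theorem continuous_logAbsReal : Continuous (logAbsReal : IdeleClassGroup K → ℝ) :=
  continuous_toAdd.comp (Continuous.quotient_lift Ideles.continuous_logAbs _)

/-- Fix `b` of large absolute value. If `|a| = 1`, then `a * b` dominates some nonzero `x`, and all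
components of `a * b / x` are at least `1` with product `|b|`. So each is at most `|b|`, and it is a
unit where `q_v > |b|`. These ideles lie in a fixed compact set. -/
theorem isCompact_logAbsReal_eq_zero : IsCompact {c : IdeleClassGroup K | logAbsReal c = 0} := by
  obtain ⟨C, hC⟩ := HasProductFormula.exists_dominated (K := K)
  obtain ⟨b, hb⟩ := Ideles.exists_lt_absValue (K := K) C
  obtain ⟨W, hW, hmem⟩ := Ideles.exists_isCompact (K := K) (Ideles.absValue b)
  refine (((hW.image continuous_mk).image (continuous_const_mul (mk b)⁻¹))).of_isClosed_subset
    (isClosed_eq continuous_logAbsReal continuous_const) ?_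
  intro c hc
  obtain ⟨a, rfl⟩ := mk_surjective c
  have ha : Ideles.absValue a = 1 := logAbsReal_mk_eq_zero_iff.mp hc
  have hab : Ideles.absValue (a * b) = Ideles.absValue b := by
    rw [Ideles.absValue_mul, ha, one_mul]
  obtain ⟨x, hx0, hx, hx'⟩ := hC (a * b) (hab ▸ hb)
  let d : Ideles K := a * b * (Ideles.diag (Units.mk0 x hx0))⁻¹
  have hd : Ideles.absValue d = Ideles.absValue b := by
    have h := Ideles.absValue_mul d (Ideles.diag (Units.mk0 x hx0))
    rwa [inv_mul_cancel_right, Ideles.absValue_diag, mul_one, hab, eq_comm] at h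
  have hdi (v : InfinitePlace K) : 1 ≤ ‖Adeles.infEval v d.1‖ := by
    have h0 : 0 < v x := v.pos_iff.mpr hx0
    have h1 : ‖Adeles.infEval v d.1‖ = ‖Adeles.infEval v (a * b).1‖ / v x := by
      rw [Units.val_mul, map_mul, Ideles.infEval_inv, norm_mul, norm_inv, ← div_eq_mul_inv]
      congr 1
      exact InfinitePlace.Completion.norm_coe v (WithAbs.toAbs v.1 x)
    rw [h1, one_le_div₀ h0]
    exact hx v
  have hdv (v : NonarchPlace K) : 1 ≤ Valued.v (Adeles.nonarchEval v d.1) := by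
    have h1 : Valued.v (Adeles.nonarchEval v d.1) =
        Valued.v (Adeles.nonarchEval v (a * b).1) / v.val x := by
      rw [Units.val_mul, map_mul, Ideles.nonarchEval_inv, map_mul, map_inv₀, ← div_eq_mul_inv,
        ← v.valued_algebraMap]
      rfl
    rw [h1, one_le_div₀ (zero_lt_iff.mpr ((Valuation.ne_zero_iff _).mpr hx0))]
    exact hx' v
  have hdn (v : NonarchPlace K) : 1 ≤ v.normAbs (Adeles.nonarchEval v d.1) := by
    have h2 := v.normAbs_le_one_iff (x := Adeles.nonarchEval v (d⁻¹).1)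
    rw [Ideles.nonarchEval_inv, map_inv₀, inv_le_one₀ (zero_lt_iff.mpr
      ((map_ne_zero _).mpr (d.nonarchEval_ne_zero v)))] at h2
    rw [h2]
    change Valued.v _ ≤ 1
    rw [map_inv₀]
    exact inv_le_one_of_one_le₀ (hdv v)
  have hprod (v : InfinitePlace K) : 1 ≤ ‖Adeles.infEval v d.1‖ ^ v.mult := one_le_pow₀ (hdi v)
  have := Fintype.ofFinite (InfinitePlace K)
  have hfin := Ideles.finite_mulSupport_normAbs d
  have hP := finprod_eq_prod_of_fintype fun v : InfinitePlace K ↦ ‖Adeles.infEval v d.1‖ ^ v.mult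
  have hQ := finprod_eq_prod _ hfin
  have hP1 : 1 ≤ ∏ v : InfinitePlace K, ‖Adeles.infEval v d.1‖ ^ v.mult :=
    Finset.one_le_prod fun v _ ↦ hprod v
  have hQ1 : 1 ≤ ∏ v ∈ hfin.toFinset, (v.normAbs (Adeles.nonarchEval v d.1) : ℝ) :=
    Finset.one_le_prod fun v _ ↦ by exact_mod_cast hdn v
  have habs : (∏ v : InfinitePlace K, ‖Adeles.infEval v d.1‖ ^ v.mult) *
      ∏ v ∈ hfin.toFinset, (v.normAbs (Adeles.nonarchEval v d.1) : ℝ) = Ideles.absValue b := by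
    rw [← hd, Ideles.absValue, hP, hQ]
  have hle (v : NonarchPlace K) :
      (v.normAbs (Adeles.nonarchEval v d.1) : ℝ) ≤ Ideles.absValue b := by
    rw [← habs]
    refine le_trans ?_ (le_mul_of_one_le_left (zero_le_one.trans hQ1) hP1)
    by_cases hv : v ∈ hfin.toFinset
    · exact Ideles.le_prod_of_one_le (f := fun v : NonarchPlace K ↦
        (v.normAbs (Adeles.nonarchEval v d.1) : ℝ)) (fun v _ ↦ by exact_mod_cast hdn v) hv
    · rw [Set.Finite.mem_toFinset, Function.notMem_mulSupport] at hv
      rwa [hv]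
  have hdW : d ∈ W := by
    refine hmem d (fun v ↦ ⟨hdi v, ?_⟩) hdn hle fun v hv ↦ ?_
    · rw [← habs]
      refine le_trans ?_ (le_mul_of_one_le_right (zero_le_one.trans hP1) hQ1)
      refine le_trans ?_ (Ideles.le_prod_of_one_le (f := fun v : InfinitePlace K ↦
        ‖Adeles.infEval v d.1‖ ^ v.mult) (fun v _ ↦ hprod v) (Finset.mem_univ v))
      exact le_self_pow₀ (hdi v) v.mult_ne_zero
    · by_contra hne
      refine (hle v).not_gt (hv.trans_le ?_)
      -- Values are discrete: a component larger than `1` is at least `q_v`, which exceeds the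
      -- bound.
      have hv1 : 1 < Valued.v (Adeles.nonarchEval v d.1) := by
        refine lt_of_le_of_ne (hdv v) fun h ↦ hne ?_
        change WithZeroMulInt.toNNReal v.q_ne_zero (Valued.v (Adeles.nonarchEval v d.1)) = 1
        rw [← h, map_one]
      rw [v.normAbs_eq_zpow (d.nonarchEval_ne_zero v)]
      have h0 : Valued.v (Adeles.nonarchEval v d.1) ≠ 0 :=
        (Valuation.ne_zero_iff _).mpr (d.nonarchEval_ne_zero v)
      have h1 : 1 ≤ WithZero.log (Valued.v (Adeles.nonarchEval v d.1)) := by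
        have h2 := (WithZero.log_lt_log one_ne_zero h0).mpr hv1
        rwa [WithZero.log_one] at h2
      calc (v.q : ℝ) = (v.q : ℝ) ^ (1 : ℤ) := (zpow_one _).symm
        _ ≤ _ := zpow_le_zpow_right₀ v.one_lt_q_real.le h1
  refine ⟨mk d, ⟨d, hdW, rfl⟩, ?_⟩
  have h1 : mk (Ideles.diag (Units.mk0 x hx0)) = 1 :=
    mk_eq_one_iff.mpr (Ideles.diag_mem_principal _)
  change (mk b)⁻¹ * mk (a * b * (Ideles.diag (Units.mk0 x hx0))⁻¹) = mk a
  rw [map_mul, map_inv, h1, inv_one, mul_one, map_mul, mul_comm (mk a), inv_mul_cancel_left]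

end IdeleClassGroup


/-! ## Galois descent for adeles -/

/-- If `E` is dense in a finite product of topological rings that the Galois group of `E/F`
permutes, then an invariant element comes from any "completion" `A` of `F`. -/
theorem exists_map_eq_of_galois_invariant {F E : Type*} [Field F] [Field E] [Algebra F E]
    [FiniteDimensional F E] [IsGalois F E] {ι : Type*} {R : ι → Type*} [∀ i, CommRing (R i)]
    [∀ i, TopologicalSpace (R i)] [∀ i, IsTopologicalRing (R i)] [∀ i, T2Space (R i)]
    (e : ∀ i, E →+* R i) (he : DenseRange fun x i ↦ e i x) (act : (E ≃ₐ[F] E) → ι → ι)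
    (φ : ∀ γ i, R (act γ i) →+* R i) (hφ : ∀ γ i, Continuous (φ γ i))
    (hφe : ∀ γ i x, φ γ i (e _ x) = e i (γ x)) {A : Type*} [TopologicalSpace A] (g : ∀ i, A → R i)
    (hg : ∀ i, Continuous (g i)) (j : F → A) (hj : ∀ i x, g i (j x) = e i (algebraMap F E x))
    {b : ∀ i, R i} (hb : ∀ γ i, φ γ i (b (act γ i)) = b i) {S : Set A} (hS : IsCompact S)
    {U : Set (∀ i, R i)} (hU : IsOpen U) (hbU : b ∈ U)
    (hUS : ∀ x : F, (fun i ↦ e i (algebraMap F E x)) ∈ U → j x ∈ S) :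
    ∃ a, ∀ i, g i a = b i := by
  classical
  -- With `Tr θ = 1`, the map `y ↦ ∑ γ(θ) γ(y)` fixes invariant families and sends `x ∈ E` to `Tr (θ
  -- x) ∈ F`.
  obtain ⟨θ, hθ⟩ := Algebra.trace_surjective F E 1
  let Ψ : (∀ i, R i) → ∀ i, R i := fun y i ↦ ∑ γ : E ≃ₐ[F] E, e i (γ θ) * φ γ i (y (act γ i))
  have hΨ : Continuous Ψ := by
    refine continuous_pi fun i ↦ continuous_finsetSum _ fun γ _ ↦ continuous_const.mul ?_
    exact (hφ γ i).comp (continuous_apply _)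
  have hΨb : Ψ b = b := by
    funext i
    have h := trace_eq_sum_automorphisms (K := F) θ
    rw [hθ, map_one] at h
    simp only [Ψ, hb]
    rw [← Finset.sum_mul, ← map_sum, ← h, map_one, one_mul]
  have hΨe (x : E) : Ψ (fun i ↦ e i x) = fun i ↦ g i (j (Algebra.trace F E (θ * x))) := by
    funext i
    simp only [Ψ, hφe, hj]
    rw [trace_eq_sum_automorphisms, map_sum]
    exact Finset.sum_congr rfl fun γ _ ↦ by rw [map_mul, map_mul]
  -- Approximating `b` by elements of `E` and applying `Ψ` approximates it by elements of `F` that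
  -- land in `S`; compactness of `S` yields an exact preimage without knowing that the maps `g` have
  -- closed image.
  have hcl : b ∈ closure ((fun a i ↦ g i a) '' S) := by
    rw [mem_closure_iff_nhds]
    intro V hV
    have hV' : Ψ ⁻¹' (V ∩ U) ∈ nhds b := by
      refine hΨ.continuousAt.preimage_mem_nhds ?_
      rw [hΨb]
      exact Filter.inter_mem hV (hU.mem_nhds hbU)
    obtain ⟨x, hx⟩ := he.exists_mem_open isOpen_interior ⟨b, mem_interior_iff_mem_nhds.mpr hV'⟩
    have hx' := interior_subset hx
    rw [Set.mem_preimage, hΨe] at hx'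
    refine ⟨_, hx'.1, j (Algebra.trace F E (θ * x)), hUS _ ?_, rfl⟩
    have h := hx'.2
    simp only [hj] at h
    exact h
  have hcpt : IsCompact ((fun a i ↦ g i a) '' S) := hS.image (continuous_pi hg)
  rw [hcpt.isClosed.closure_eq] at hcl
  obtain ⟨a, -, ha⟩ := hcl
  exact ⟨a, fun i ↦ congrFun ha i⟩

namespace NonarchPlace

variable {K L : Type*} [Field K] [Field L]

theorem continuous_completionMap (f : K →+* L) (v : NonarchPlace K) (w : NonarchPlace L)
    (h : w.ring.comap f = v.ring) : Continuous (completionMap f v w h) :=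
  (HeightOneSpectrum.adicCompletion.continuous_ofCompletion L w.prime).comp
    (Completion.continuous_map.comp
      (HeightOneSpectrum.adicCompletion.continuous_toCompletion K v.prime))

theorem denseRange_pi (S : Set (NonarchPlace K)) [Finite S] :
    DenseRange fun (x : K) (v : S) ↦ algebraMap K v.1.Completion x := by
  have key (v : S) {O : Set v.1.Completion} (hO : IsOpen O) (hne : O.Nonempty) :
      ∃ (y : K) (n : ℤ), ∀ x : K, v.1.val (x - y) ≤ WithZero.exp n →
        algebraMap K v.1.Completion x ∈ O := by
    obtain ⟨y, hy⟩ := (HeightOneSpectrum.denseRange_algebraMap K v.1.prime).exists_mem_open hO hne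
    obtain ⟨γ, hγ⟩ := Valued.mem_nhds.mp (hO.mem_nhds hy)
    have hγ0 : MonoidWithZeroHom.ValueGroup₀.embedding γ.1 ≠ 0 := by simp
    refine ⟨y, WithZero.log (MonoidWithZeroHom.ValueGroup₀.embedding γ.1) - 1, fun x hx ↦ hγ ?_⟩
    rw [Set.mem_ofPred_eq, Valuation.restrict_lt_iff_lt_embedding, ← map_sub,
      v.1.valued_algebraMap]
    refine hx.trans_lt ?_
    rw [← WithZero.lt_log_iff_exp_lt hγ0]
    lia
  refine dense_iff_inter_open.mpr fun O hO ⟨z, hz⟩ ↦ ?_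
  obtain ⟨u, hu, huO⟩ := isOpen_pi_iff'.mp hO z hz
  choose y n hy using fun v ↦ key v (hu v).1 ⟨_, (hu v).2⟩
  obtain ⟨x, hx⟩ := exists_forall_val_sub_le y n
  exact ⟨_, huO fun v _ ↦ hy v x (hx v), x, rfl⟩

end NonarchPlace


/-! ### Descent of invariant adeles, place by place -/

theorem NumberField.InfinitePlace.isometry_completionMapComap {K L : Type*} [Field K] [Field L]
    (f : K →+* L) (w : InfinitePlace L) : Isometry (completionMapComap f w) := by
  have h1 : Isometry (Completion.map
    (((WithAbs.equiv w.1).symm.toRingHom.comp f).comp (WithAbs.equiv (w.comap f).1).toRingHom)) :=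
    (isometry_withAbs_map f w).completion_map
  exact h1.comp (Completion.isometry_toCompletion (w.comap f))

theorem NumberField.InfinitePlace.denseRange_pi (K : Type*) [Field K] [IsGlobalField K] :
    DenseRange fun (x : K) (v : InfinitePlace K) ↦ algebraMap K v.Completion x := by
  rcases IsGlobalField.out (K := K) with h | ⟨p, hp, halg, hfin⟩
  · exact InfiniteAdeleRing.denseRange_algebraMap K
  · let : Algebra (ZMod p) K := ((algebraMap (RatFunc (ZMod p)) K).comp (algebraMap _ _)).toAlgebra
    have := IsFunctionField.isEmpty_infinitePlace p K
    exact Function.Surjective.denseRange fun y ↦ ⟨0, Subsingleton.elim _ _⟩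

namespace NonarchPlace

variable {K L : Type*} [Field K] [Field L] (f : K →+* L) {v : NonarchPlace K} {w : NonarchPlace L}
  (h : w.ring.comap f = v.ring)

include h in
theorem val_map_le_one_iff (x : K) : w.val (f x) ≤ 1 ↔ v.val x ≤ 1 := by
  rw [val, val, valuation_le_one_iff, valuation_le_one_iff, ← h, ValuationSubring.mem_comap]

include h in
theorem val_map_lt_one_iff (x : K) : w.val (f x) < 1 ↔ v.val x < 1 := by
  rcases eq_or_ne x 0 with rfl | hx
  · simp
  · rw [val, val, valuation_lt_one_iff _ ((map_ne_zero f).mpr hx), valuation_lt_one_iff _ hx, ← h,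
      ValuationSubring.mem_comap, map_inv₀]

/-- As values are discrete, `x` is divisible by a uniformizer `π`, and the image of `π` is a
non-unit. -/
theorem valued_completionMap_lt_one {x : v.Completion} (hx : Valued.v x < 1) :
    Valued.v (completionMap f v w h x) < 1 := by
  obtain ⟨π, hπ0, hπ⟩ := v.exists_uniformizer
  have hπ1 : v.val π < 1 := by
    rw [hπ, ← WithZero.exp_zero]
    exact WithZero.exp_lt_exp.mpr (by norm_num)
  have hpos : 0 < v.val π := zero_lt_iff.mpr ((Valuation.ne_zero_iff _).mpr hπ0)
  have hpos' : 0 < w.val (f π) :=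
    zero_lt_iff.mpr ((Valuation.ne_zero_iff _).mpr ((map_ne_zero f).mpr hπ0))
  have h1 : x / algebraMap K v.Completion π ∈ v.Integers := by
    change Valued.v (x / algebraMap K v.Completion π) ≤ 1
    rw [map_div₀, v.valued_algebraMap, div_le_one₀ hpos, hπ]
    rcases eq_or_ne (Valued.v x) 0 with h0 | h0
    · rw [h0]
      exact zero_le
    · rw [← WithZero.log_le_iff_le_exp h0]
      rw [← WithZero.log_lt_log h0 one_ne_zero, WithZero.log_one] at hx
      lia
  have h2 : Valued.v (completionMap f v w h (x / algebraMap K v.Completion π)) ≤ 1 :=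
    completionMap_mem_integers f v w h _ h1
  have h3 : completionMap f v w h (algebraMap K v.Completion π) = algebraMap L w.Completion (f π) :=
    completionMap_coe f v w h π
  rw [map_div₀, h3, map_div₀, w.valued_algebraMap, div_le_one₀ hpos'] at h2
  exact h2.trans_lt ((val_map_lt_one_iff f h π).mpr hπ1)

theorem valued_completionMap_eq_one_iff {x : v.Completion} :
    Valued.v (completionMap f v w h x) = 1 ↔ Valued.v x = 1 := by
  rcases eq_or_ne x 0 with rfl | hx0
  · simp
  rcases lt_trichotomy (Valued.v x) 1 with hx | hx | hx
  · exact iff_of_false (valued_completionMap_lt_one f h hx).ne hx.ne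
  · refine iff_of_true (le_antisymm (completionMap_mem_integers f v w h _ hx.le) ?_) hx
    have h1 : x⁻¹ ∈ v.Integers := by
      change Valued.v x⁻¹ ≤ 1
      rw [map_inv₀, hx, inv_one]
    have h2 : Valued.v (completionMap f v w h x⁻¹) ≤ 1 := completionMap_mem_integers f v w h _ h1
    rwa [map_inv₀, map_inv₀, inv_le_one₀] at h2
    exact zero_lt_iff.mpr ((map_ne_zero _).mpr ((map_ne_zero _).mpr hx0))
  · refine iff_of_false (fun h1 ↦ ?_) hx.ne'
    have h2 : Valued.v x⁻¹ < 1 := by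
      rw [map_inv₀]
      exact inv_lt_one_of_one_lt₀ hx
    have h3 := valued_completionMap_lt_one f h h2
    rw [map_inv₀, map_inv₀, h1, inv_one] at h3
    exact h3.false

/-- The image of a uniformizer is a non-unit at every place above `v`. -/
theorem finite_setOf_comap_eq [IsGlobalField L] (v : NonarchPlace K) :
    {w : NonarchPlace L | w.ring.comap f = v.ring}.Finite := by
  obtain ⟨π, hπ0, hπ⟩ := v.exists_uniformizer
  refine (HasProductFormula.finite_setOf_val_ne_one (f π) ((map_ne_zero f).mpr hπ0)).subset
    fun w hw ↦ ((val_map_lt_one_iff f hw π).mpr ?_).ne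
  rw [hπ, ← WithZero.exp_zero]
  exact WithZero.exp_lt_exp.mpr (by norm_num)

end NonarchPlace

namespace Adeles

theorem infEval_mapEquiv {K L : Type*} [Field K] [Field L] (σ : K ≃+* L) (a : Adeles K)
    (w : InfinitePlace L) : infEval w (mapEquiv σ a) =
      w.completionMapComap (σ : K →+* L) (infEval (w.comap (σ : K →+* L)) a) := rfl

theorem nonarchEval_mapEquiv {K L : Type*} [Field K] [Field L] (σ : K ≃+* L) (a : Adeles K)
    (w : NonarchPlace L) : nonarchEval w (mapEquiv σ a) =
      NonarchPlace.completionMap (σ : K →+* L) (NonarchPlace.comapEquiv σ w) w rfl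
        (nonarchEval (NonarchPlace.comapEquiv σ w) a) := rfl

theorem continuous_mapEquiv {K L : Type*} [Field K] [Field L] (σ : K ≃+* L) :
    Continuous (mapEquiv σ) := by
  let φ : InfiniteAdeleRing K → InfiniteAdeleRing L := fun a w ↦
    w.completionMapComap (σ : K →+* L) (a (w.comap (σ : K →+* L)))
  let ψ : NonarchAdeles K → NonarchAdeles L :=
    RestrictedProduct.mapAlongRingHom (fun v : NonarchPlace K ↦ v.Completion)
      (fun w : NonarchPlace L ↦ w.Completion) (NonarchPlace.comapEquiv σ)
      (NonarchPlace.comapEquiv_injective σ).tendsto_cofinite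
      (fun w ↦ NonarchPlace.completionMap (σ : K →+* L) (NonarchPlace.comapEquiv σ w) w rfl)
      (Filter.Eventually.of_forall fun _ x hx ↦
        NonarchPlace.completionMap_mem_integers _ _ _ _ x hx)
  change Continuous (Prod.map φ ψ)
  refine Continuous.prodMap ?_ ?_
  · exact continuous_pi fun w ↦ (w.isometry_completionMapComap (σ : K →+* L)).continuous.comp
      (continuous_apply (A := fun v : InfinitePlace K ↦ v.Completion) (w.comap (σ : K →+* L)))
  · exact RestrictedProduct.mapAlong_continuous (fun v : NonarchPlace K ↦ v.Completion)
      (fun w : NonarchPlace L ↦ w.Completion) (NonarchPlace.comapEquiv σ)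
      (NonarchPlace.comapEquiv_injective σ).tendsto_cofinite
      (fun w ↦ NonarchPlace.completionMap (σ : K →+* L) (NonarchPlace.comapEquiv σ w) w rfl)
      (Filter.Eventually.of_forall fun _ x hx ↦
        NonarchPlace.completionMap_mem_integers _ _ _ _ x hx)
      fun w ↦ NonarchPlace.continuous_completionMap _ _ _ _

variable {F E : Type*} [Field F] [Field E] [Algebra F E] [FiniteDimensional F E] [IsGalois F E]
  [IsGlobalField E]

theorem exists_infEval_eq_of_galois_invariant {b : Adeles E}
    (hb : ∀ γ : E ≃ₐ[F] E, mapEquiv (γ : E ≃+* E) b = b) :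
    ∃ a : ∀ v : InfinitePlace F, v.Completion, ∀ w : InfinitePlace E,
      w.completionMapComap (algebraMap F E) (a (w.comap (algebraMap F E))) = infEval w b := by
  obtain ⟨B, hB⟩ : ∃ B : ℝ, ∀ w, ‖infEval w b‖ < B := by
    obtain ⟨B, hB⟩ := (Set.finite_range fun w ↦ ‖infEval w b‖).bddAbove
    exact ⟨B + 1, fun w ↦ (hB ⟨w, rfl⟩).trans_lt (lt_add_one B)⟩
  refine exists_map_eq_of_galois_invariant (F := F) (E := E)
    (R := fun w : InfinitePlace E ↦ w.Completion)
    (fun w ↦ algebraMap E w.Completion) (InfinitePlace.denseRange_pi E)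
    (fun γ w ↦ w.comap ((γ : E ≃+* E) : E →+* E))
    (fun γ w ↦ w.completionMapComap ((γ : E ≃+* E) : E →+* E))
    (fun γ w ↦ (w.isometry_completionMapComap _).continuous)
    (fun γ w x ↦ w.completionMapComap_coe _ x)
    (A := ∀ v : InfinitePlace F, v.Completion)
    (fun w a ↦ w.completionMapComap (algebraMap F E) (a (w.comap (algebraMap F E))))
    (fun w ↦ (w.isometry_completionMapComap _).continuous.comp (continuous_apply _))
    (fun x v ↦ algebraMap F v.Completion x) (fun w x ↦ w.completionMapComap_coe _ x)
    (b := fun w ↦ infEval w b)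
    (fun γ w ↦ congrArg (infEval w) (hb γ))
    (S := Set.univ.pi fun v : InfinitePlace F ↦ Metric.closedBall (0 : v.Completion) B)
    (isCompact_univ_pi fun v ↦ v.isCompact_closedBall B)
    (U := Set.univ.pi fun w : InfinitePlace E ↦ Metric.ball (0 : w.Completion) B)
    (isOpen_set_pi Set.finite_univ fun w _ ↦ Metric.isOpen_ball)
    (fun w _ ↦ mem_ball_zero_iff.mpr (hB w)) fun x hx v _ ↦ ?_
  obtain ⟨w, rfl⟩ := InfinitePlace.comap_surjective (k := F) (K := E) v
  have h1 := mem_ball_zero_iff.mp (hx w trivial)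
  refine mem_closedBall_zero_iff.mpr (le_trans (le_of_eq ?_) h1.le)
  have h2 := (w.isometry_completionMapComap (algebraMap F E)).norm_map_of_map_zero (map_zero _)
    (algebraMap F _ x)
  rw [← h2]
  exact congrArg _ (w.completionMapComap_coe _ x)

theorem exists_nonarchEval_eq_of_galois_invariant {b : Adeles E}
    (hb : ∀ γ : E ≃ₐ[F] E, mapEquiv (γ : E ≃+* E) b = b) (v : NonarchPlace F) :
    ∃ a : v.Completion, ∀ (w : NonarchPlace E) (h : w.ring.comap (algebraMap F E) = v.ring),
      NonarchPlace.completionMap (algebraMap F E) v w h a = nonarchEval w b := by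
  let S : Set (NonarchPlace E) := {w | w.ring.comap (algebraMap F E) = v.ring}
  have hfin : Finite S := NonarchPlace.finite_setOf_comap_eq (algebraMap F E) v
  rcases isEmpty_or_nonempty S with hS | ⟨⟨w₀⟩⟩
  · exact ⟨0, fun w h ↦ (hS.false ⟨w, h⟩).elim⟩
  obtain ⟨π, hπ0, hπ⟩ := v.exists_uniformizer
  have hπ1 : w₀.1.val (algebraMap F E π) < 1 := by
    refine (NonarchPlace.val_map_lt_one_iff (algebraMap F E) w₀.2 π).mpr ?_
    rw [hπ, ← WithZero.exp_zero]
    exact WithZero.exp_lt_exp.mpr (by norm_num)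
  have hpos : 0 < w₀.1.val (algebraMap F E π) :=
    zero_lt_iff.mpr ((Valuation.ne_zero_iff _).mpr ((map_ne_zero _).mpr hπ0))
  -- The power `π ^ n` makes `b` integral at the single place `w₀`. This open condition suffices,
  -- since an element of `F` is integral at `w₀` exactly when it is integral at `v`, and this
  -- confines the approximations to a compact set.
  obtain ⟨n, hn⟩ := MulArchimedean.arch (Valued.v (nonarchEval w₀.1 b))
    ((one_lt_inv₀ hpos).mpr hπ1)
  have hπn : algebraMap F v.Completion (π ^ n) ≠ 0 := by
    rw [ne_eq, map_eq_zero]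
    exact pow_ne_zero n hπ0
  have hγ (γ : E ≃ₐ[F] E) (w : S) : NonarchPlace.comapEquiv (γ : E ≃+* E) w.1 ∈ S := by
    change (w.1.ring.comap _).comap _ = v.ring
    rw [← w.2, ValuationSubring.comap_comap]
    congr 1
    ext x
    exact γ.commutes x
  have hint (x : F) (hx : algebraMap E w₀.1.Completion (algebraMap F E (π ^ n)) *
      algebraMap E w₀.1.Completion (algebraMap F E x) ∈ w₀.1.Integers) :
      algebraMap F v.Completion (π ^ n) * algebraMap F v.Completion x ∈ v.Integers := by
    rw [← map_mul, ← map_mul] at hx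
    have h1 : w₀.1.val (algebraMap F E (π ^ n * x)) ≤ 1 := by
      rw [← w₀.1.valued_algebraMap]
      exact hx
    rw [← map_mul]
    change Valued.v (algebraMap F v.Completion (π ^ n * x)) ≤ 1
    rw [v.valued_algebraMap]
    exact (NonarchPlace.val_map_le_one_iff (algebraMap F E) w₀.2 _).mp h1
  obtain ⟨a, ha⟩ := exists_map_eq_of_galois_invariant (F := F) (E := E)
    (R := fun w : S ↦ w.1.Completion)
    (fun w ↦ algebraMap E w.1.Completion) (NonarchPlace.denseRange_pi S)
    (fun γ w ↦ ⟨NonarchPlace.comapEquiv (γ : E ≃+* E) w.1, hγ γ w⟩)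
    (fun γ w ↦ NonarchPlace.completionMap ((γ : E ≃+* E) : E →+* E) _ w.1 rfl)
    (fun γ w ↦ NonarchPlace.continuous_completionMap _ _ _ _)
    (fun γ w x ↦ NonarchPlace.completionMap_coe _ _ w.1 _ x)
    (A := v.Completion)
    (fun w ↦ NonarchPlace.completionMap (algebraMap F E) v w.1 w.2)
    (fun w ↦ NonarchPlace.continuous_completionMap _ _ _ _)
    (fun x ↦ algebraMap F v.Completion x) (fun w x ↦ NonarchPlace.completionMap_coe _ _ w.1 _ x)
    (b := fun w ↦ nonarchEval w.1 b)
    (fun γ w ↦ congrArg (nonarchEval w.1) (hb γ))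
    (S := (fun a ↦ (algebraMap F v.Completion (π ^ n))⁻¹ * a) '' (v.Integers : Set v.Completion))
    (v.isCompact_integers.image (continuous_const_mul _))
    (U := (fun y : ∀ w : S, w.1.Completion ↦
      algebraMap E w₀.1.Completion (algebraMap F E (π ^ n)) * y w₀) ⁻¹'
        (w₀.1.Integers : Set w₀.1.Completion))
    (w₀.1.isOpen_integers.preimage (continuous_const.mul (continuous_apply w₀)))
    (by
      change Valued.v (algebraMap E w₀.1.Completion (algebraMap F E (π ^ n)) *
        nonarchEval w₀.1 b) ≤ 1
      rw [map_mul, w₀.1.valued_algebraMap, map_pow, map_pow]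
      rw [inv_pow] at hn
      exact (mul_le_mul_right hn _).trans_eq (mul_inv_cancel₀ (pow_pos hpos n).ne'))
    fun x hx ↦ ⟨algebraMap F v.Completion (π ^ n) * algebraMap F v.Completion x, hint x hx, by
      dsimp only
      rw [inv_mul_cancel_left₀ hπn]⟩
  exact ⟨a, fun w h ↦ ha ⟨w, h⟩⟩

end Adeles


/-! ### Descent of invariant ideles and idele classes -/

theorem NonarchPlace.completionMap_comp {K L M : Type*} [Field K] [Field L] [Field M] (f : K →+* L)
    (g : L →+* M) (u : NonarchPlace K) (v : NonarchPlace L) (w : NonarchPlace M)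
    (h : v.ring.comap f = u.ring) (h' : w.ring.comap g = v.ring)
    (h'' : w.ring.comap (g.comp f) = u.ring) (x : u.Completion) :
    completionMap (g.comp f) u w h'' x = completionMap g v w h' (completionMap f u v h x) := by
  refine congrFun (Continuous.ext_on (HeightOneSpectrum.denseRange_algebraMap K u.prime)
    (continuous_completionMap _ _ _ _) ((continuous_completionMap _ _ _ _).comp
      (continuous_completionMap _ _ _ _)) ?_) x
  rintro _ ⟨x, rfl⟩
  refine (completionMap_coe (g.comp f) u w h'' x).trans ?_
  refine Eq.trans ?_ (congrArg _ (completionMap_coe f u v h x)).symm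
  exact (completionMap_coe g v w h' (f x)).symm

theorem NonarchPlace.normAbs_eq_one_iff {K : Type*} [Field K] (v : NonarchPlace K)
    {x : v.Completion} : v.normAbs x = 1 ↔ Valued.v x = 1 := by
  rcases eq_or_ne x 0 with rfl | hx
  · simp
  have h1 := v.normAbs_le_one_iff (x := x)
  have h2 := v.normAbs_le_one_iff (x := x⁻¹)
  rw [map_inv₀, map_inv₀, inv_le_one₀ (zero_lt_iff.mpr ((map_ne_zero _).mpr hx)),
    inv_le_one₀ (zero_lt_iff.mpr ((map_ne_zero _).mpr hx))] at h2
  rw [le_antisymm_iff, le_antisymm_iff, h1, h2]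

theorem Adeles.nonarchEval_mapEquiv_of_comap_eq {K L : Type*} [Field K] [Field L] (σ : K ≃+* L)
    (a : Adeles K) {v : NonarchPlace K} {w : NonarchPlace L}
    (h : w.ring.comap (σ : K →+* L) = v.ring) : nonarchEval w (mapEquiv σ a) =
      NonarchPlace.completionMap (σ : K →+* L) v w h (nonarchEval v a) := by
  obtain rfl : v = NonarchPlace.comapEquiv σ w := NonarchPlace.ext h.symm
  rfl

namespace Ideles

theorem map_mapEquiv_diag {K L : Type*} [Field K] [Field L] [IsGlobalField K] [IsGlobalField L]
    (σ : K ≃+* L) (x : Kˣ) :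
    Units.map (Adeles.mapEquiv σ : Adeles K →* Adeles L) (diag x) =
      diag (Units.map (σ : K →* L) x) := by
  refine Ideles.ext (fun w ↦ ?_) fun w ↦ ?_
  · exact w.completionMapComap_coe (σ : K →+* L) x
  · exact NonarchPlace.completionMap_coe (σ : K →+* L) (NonarchPlace.comapEquiv σ w) w rfl x

theorem diag_mul {K : Type*} [Field K] [IsGlobalField K] (x y : Kˣ) :
    diag (x * y) = diag x * diag y :=
  Ideles.ext (fun v ↦ map_mul (algebraMap K v.Completion) (x : K) (y : K))
    fun v ↦ map_mul (algebraMap K v.Completion) (x : K) (y : K)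

variable {F E : Type*} [Field F] [Field E] [Algebra F E] [FiniteDimensional F E] [IsGalois F E]
  [IsGlobalField E]

theorem exists_isImage_of_galois_invariant {b : Ideles E}
    (hb : ∀ γ : E ≃ₐ[F] E, Adeles.mapEquiv (γ : E ≃+* E) b.1 = b.1) :
    ∃ a : Ideles F, Adeles.IsImage (algebraMap F E) a.1 b.1 := by
  classical
  obtain ⟨f, hf⟩ := Adeles.exists_infEval_eq_of_galois_invariant hb
  choose g hg using Adeles.exists_nonarchEval_eq_of_galois_invariant hb
  -- Where no `w` lies above `v` the component is unconstrained and is set to `1`, so no extension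
  -- theorem for places is needed. Elsewhere a non-unit component forces one of `b` above it, which
  -- leaves finitely many.
  let P (v : NonarchPlace F) : Prop := ∃ w : NonarchPlace E, w.ring.comap (algebraMap F E) = v.ring
  let a : Ideles F := mk f (fun v ↦ if P v then g v else 1)
    (fun v h0 ↦ by
      obtain ⟨w, rfl⟩ := InfinitePlace.comap_surjective (k := F) (K := E) v
      refine b.infEval_ne_zero w ?_
      rw [← hf, h0, map_zero])
    (fun v ↦ by
      split_ifs with hv
      · intro h0
        obtain ⟨w, hw⟩ := hv
        refine b.nonarchEval_ne_zero w ?_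
        rw [← hg v w hw, h0, map_zero]
      · exact one_ne_zero)
    (by
      have hfin := (finite_mulSupport_normAbs b).image (NonarchPlace.under F)
      refine hfin.subset fun v hv ↦ ?_
      rw [Set.mem_ofPred_eq] at hv
      by_cases hP : P v
      · rw [if_pos hP] at hv
        obtain ⟨w, hw⟩ := hP
        refine ⟨w, fun h1 ↦ hv ?_, NonarchPlace.ext hw⟩
        rw [← NonarchPlace.valued_completionMap_eq_one_iff (algebraMap F E) hw, hg v w hw]
        rw [← w.normAbs_eq_one_iff]
        exact NNReal.coe_injective h1
      · rw [if_neg hP, map_one] at hv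
        exact absurd rfl hv)
  refine ⟨a, fun w ↦ (hf w).symm, fun v w h ↦ ?_⟩
  rw [nonarchEval_mk, if_pos ⟨w, h⟩, hg v w h]

end Ideles

namespace IdeleClassGroup

theorem mapEquiv_mk {K L : Type*} [Field K] [Field L] (σ : K ≃+* L) (a : Ideles K) :
    mapEquiv σ (mk a) = mk (Units.map (Adeles.mapEquiv σ : Adeles K →* Adeles L) a) := rfl

theorem continuous_mapEquiv {K L : Type*} [Field K] [Field L] (σ : K ≃+* L) :
    Continuous (mapEquiv σ) :=
  Continuous.quotient_lift (continuous_mk.comp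
    (Continuous.units_map _ (Adeles.continuous_mapEquiv σ))) _

variable {F E : Type*} [Field F] [Field E] [Algebra F E] [FiniteDimensional F E] [IsGalois F E]
  [IsGlobalField E]

/-- For a representative `b`, the quotients `γ b / b` are principal and form a 1-cocycle in `Eˣ`. By
Hilbert 90 it is the coboundary of some `y`, and `b / y` is an invariant idele. -/
theorem exists_isImage_of_galois_invariant {c : IdeleClassGroup E}
    (hc : ∀ γ, galoisAct F E γ c = c) :
    ∃ (a : Ideles F) (b : Ideles E), mk b = c ∧ Adeles.IsImage (algebraMap F E) a.1 b.1 := by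
  obtain ⟨b, rfl⟩ := mk_surjective c
  have h1 (γ : E ≃ₐ[F] E) : ∃ x : Eˣ,
      Units.map (Adeles.mapEquiv (γ : E ≃+* E) : Adeles E →* Adeles E) b = Ideles.diag x * b := by
    have h2 : mk (Units.map (Adeles.mapEquiv (γ : E ≃+* E) : Adeles E →* Adeles E) b * b⁻¹) = 1 := by
      rw [map_mul, map_inv, ← mapEquiv_mk, mul_inv_eq_one]
      exact hc γ
    obtain ⟨x, hx⟩ := Ideles.eq_diag_of_mem_principal (mk_eq_one_iff.mp h2)
    exact ⟨x, by rw [← hx, inv_mul_cancel_right]⟩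
  choose x hx using h1
  have hxw (γ : E ≃ₐ[F] E) (w : NonarchPlace E) :
      Adeles.nonarchEval w (Adeles.mapEquiv (γ : E ≃+* E) b.1) =
        algebraMap E w.Completion (x γ) * Adeles.nonarchEval w b.1 := by
    have h2 := congrArg (fun a : Ideles E ↦ Adeles.nonarchEval w a.1) (hx γ)
    simp only [Units.val_mul, map_mul] at h2
    exact h2
  have hcoc : groupCohomology.IsMulCocycle₁ x := by
    intro g h
    -- The cocycle identity can be checked in one completion, since `E` embeds in it and `b` is
    -- invertible there.
    obtain ⟨w⟩ := HasProductFormula.nonempty_nonarchPlace (K := E)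
    refine Units.ext ((algebraMap E w.Completion).injective
      (mul_right_cancel₀ (b.nonarchEval_ne_zero w) ?_))
    rw [← hxw, Adeles.nonarchEval_mapEquiv_of_comap_eq ((g * h : E ≃ₐ[F] E) : E ≃+* E) b.1
      (v := NonarchPlace.comapEquiv (h : E ≃+* E) (NonarchPlace.comapEquiv (g : E ≃+* E) w)) rfl]
    refine (NonarchPlace.completionMap_comp ((h : E ≃+* E) : E →+* E) ((g : E ≃+* E) : E →+* E)
      _ (NonarchPlace.comapEquiv (g : E ≃+* E) w) w rfl rfl rfl _).trans ?_
    rw [← Adeles.nonarchEval_mapEquiv, hxw, map_mul, ← Adeles.nonarchEval_mapEquiv, hxw,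
      AlgEquiv.smul_units_def, Units.val_mul, map_mul, mul_assoc]
    congr 1
    exact NonarchPlace.completionMap_coe ((g : E ≃+* E) : E →+* E) _ w rfl _
  obtain ⟨y, hy⟩ := groupCohomology.isMulCoboundary₁_of_isMulCocycle₁_of_aut_to_units x hcoc
  obtain ⟨a, ha⟩ := Ideles.exists_isImage_of_galois_invariant (F := F)
    (b := b * (Ideles.diag y)⁻¹) fun γ ↦ by
      have h2 : Units.map (Adeles.mapEquiv (γ : E ≃+* E) : Adeles E →* Adeles E)
          (b * (Ideles.diag y)⁻¹) = b * (Ideles.diag y)⁻¹ := by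
        have h3 : Units.map ((γ : E ≃+* E) : E →* E) y = x γ * y := by
          rw [← hy γ, div_mul_cancel]
          rfl
        rw [map_mul, map_inv, hx, Ideles.map_mapEquiv_diag, h3, Ideles.diag_mul, mul_inv,
          mul_mul_mul_comm, mul_inv_cancel, one_mul]
      exact congrArg Units.val h2
  refine ⟨a, _, ?_, ha⟩
  rw [map_mul, map_inv, mk_eq_one_iff.mpr (Ideles.diag_mem_principal y), inv_one, mul_one]

end IdeleClassGroup


/-! ## Base change of idele classes -/

namespace Adeles

variable (F E : Type*) [Field F] [Field E] [Algebra F E] [Algebra.IsIntegral F E] [IsGlobalField E]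

theorem tendsto_under : Filter.Tendsto (NonarchPlace.under F (L := E)) Filter.cofinite
    Filter.cofinite :=
  Filter.Tendsto.cofinite_of_finite_preimage_singleton fun v ↦
    (NonarchPlace.finite_setOf_comap_eq (algebraMap F E) v).subset
      fun _ hw ↦ congrArg NonarchPlace.ring hw

/-- The non-Archimedean part of the natural map `𝔸_F → 𝔸_E`. -/
noncomputable def nonarchBaseChange : NonarchAdeles F →+* NonarchAdeles E :=
  RestrictedProduct.mapAlongRingHom (fun v : NonarchPlace F ↦ v.Completion)
    (fun w : NonarchPlace E ↦ w.Completion) (NonarchPlace.under F) (tendsto_under F E)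
    (fun w ↦ NonarchPlace.completionMap (algebraMap F E) (NonarchPlace.under F w) w rfl)
    (Filter.Eventually.of_forall fun _ x hx ↦
      NonarchPlace.completionMap_mem_integers _ _ _ _ x hx)

theorem continuous_nonarchBaseChange : Continuous (nonarchBaseChange F E) :=
  RestrictedProduct.mapAlong_continuous (fun v : NonarchPlace F ↦ v.Completion)
    (fun w : NonarchPlace E ↦ w.Completion) (NonarchPlace.under F) (tendsto_under F E)
    (fun w ↦ NonarchPlace.completionMap (algebraMap F E) (NonarchPlace.under F w) w rfl)
    (Filter.Eventually.of_forall fun _ x hx ↦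
      NonarchPlace.completionMap_mem_integers _ _ _ _ x hx)
    fun _ ↦ NonarchPlace.continuous_completionMap _ _ _ _

/-- The Archimedean part of the natural map `𝔸_F → 𝔸_E`. -/
noncomputable def infBaseChange : InfiniteAdeleRing F →+* InfiniteAdeleRing E :=
  RingHom.pi fun w : InfinitePlace E ↦
    (w.completionMapComap (algebraMap F E)).comp
      (Pi.evalRingHom (fun v : InfinitePlace F ↦ v.Completion) (w.comap (algebraMap F E)))

omit [Algebra.IsIntegral F E] [IsGlobalField E] in
theorem continuous_infBaseChange : Continuous (infBaseChange F E) :=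
  continuous_pi fun w ↦ (w.isometry_completionMapComap (algebraMap F E)).continuous.comp
    (continuous_apply (A := fun v : InfinitePlace F ↦ v.Completion) (w.comap (algebraMap F E)))

/-- The natural map `𝔸_F → 𝔸_E`. -/
noncomputable def baseChange : Adeles F →+* Adeles E :=
  RingHom.prodMap (infBaseChange F E) (nonarchBaseChange F E)

theorem continuous_baseChange : Continuous (baseChange F E) :=
  (continuous_infBaseChange F E).prodMap (continuous_nonarchBaseChange F E)

variable {F E}

theorem isImage_iff {a : Adeles F} {b : Adeles E} :
    IsImage (algebraMap F E) a b ↔ b = baseChange F E a := by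
  constructor
  · exact fun h ↦ Adeles.ext h.1 fun w ↦ h.2 (NonarchPlace.under F w) w rfl
  · rintro rfl
    refine ⟨fun w ↦ rfl, fun v w h ↦ ?_⟩
    obtain rfl : v = NonarchPlace.under F w := NonarchPlace.ext h.symm
    rfl

end Adeles

namespace Ideles

variable {F E : Type*} [Field F] [Field E] [Algebra F E] [Algebra.IsIntegral F E]
  [IsGlobalField F] [IsGlobalField E]

theorem map_baseChange_diag (x : Fˣ) :
    Units.map (Adeles.baseChange F E : Adeles F →* Adeles E) (diag x) =
      diag (Units.map (algebraMap F E : F →* E) x) := by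
  refine Ideles.ext (fun w ↦ ?_) fun w ↦ ?_
  · exact w.completionMapComap_coe (algebraMap F E) x
  · exact NonarchPlace.completionMap_coe (algebraMap F E) (NonarchPlace.under F w) w rfl x

omit [Algebra.IsIntegral F E] [IsGlobalField F] [Algebra F E] [Field F] in
theorem absValue_lt_one {a : Ideles E} (h : ∀ v, ‖Adeles.infEval v a.1‖ ≤ 1)
    (h' : ∀ v, Valued.v (Adeles.nonarchEval v a.1) ≤ 1) {w : NonarchPlace E}
    (hw : Valued.v (Adeles.nonarchEval w a.1) < 1) : absValue a < 1 := by
  have := Fintype.ofFinite (InfinitePlace E)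
  have hfin := finite_mulSupport_normAbs a
  have h1 (v : NonarchPlace E) : (v.normAbs (Adeles.nonarchEval v a.1) : ℝ) ≤ 1 := by
    exact_mod_cast v.normAbs_le_one_iff.mpr (h' v)
  have h2 : (w.normAbs (Adeles.nonarchEval w a.1) : ℝ) < 1 :=
    lt_of_le_of_ne (h1 w) fun h3 ↦ hw.ne (w.normAbs_eq_one_iff.mp (NNReal.coe_injective h3))
  rw [absValue, finprod_eq_prod_of_fintype, finprod_eq_prod _ hfin]
  have h3 : ∏ v : InfinitePlace E, ‖Adeles.infEval v a.1‖ ^ v.mult ≤ 1 :=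
    Finset.prod_le_one (fun v _ ↦ by positivity) fun v _ ↦ pow_le_one₀ (norm_nonneg _) (h v)
  refine mul_lt_one_of_nonneg_of_lt_one_right h3 (Finset.prod_nonneg fun v _ ↦ NNReal.coe_nonneg _) ?_
  classical
  have hmem : w ∈ hfin.toFinset := by
    rw [Set.Finite.mem_toFinset]
    exact h2.ne
  rw [← Finset.mul_prod_erase _ _ hmem]
  refine mul_lt_one_of_nonneg_of_lt_one_left (NNReal.coe_nonneg _) h2 ?_
  exact Finset.prod_le_one (fun v _ ↦ NNReal.coe_nonneg _) fun v _ ↦ h1 v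

omit [Algebra.IsIntegral F E] [IsGlobalField F] [Algebra F E] [Field F] in
theorem absValue_inv (a : Ideles E) : absValue a⁻¹ = (absValue a)⁻¹ := by
  have h := absValue_mul a⁻¹ a
  rw [inv_mul_cancel, absValue_one] at h
  exact eq_inv_of_mul_eq_one_left h.symm

omit [Algebra.IsIntegral F E] [IsGlobalField F] [Algebra F E] [Field F] in
theorem absValue_pow (a : Ideles E) (n : ℕ) : absValue (a ^ n) = absValue a ^ n := by
  induction n with
  | zero => rw [pow_zero, pow_zero, absValue_one]
  | succ n ih => rw [pow_succ, pow_succ, absValue_mul, ih]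

end Ideles

namespace IdeleClassGroup

theorem logAbsReal_pow {K : Type*} [Field K] [IsGlobalField K] (c : IdeleClassGroup K) (n : ℕ) :
    logAbsReal (c ^ n) = n * logAbsReal c := by
  rw [logAbsReal, map_pow, toAdd_pow, nsmul_eq_mul]
  rfl

theorem logAbsReal_inv {K : Type*} [Field K] [IsGlobalField K] (c : IdeleClassGroup K) :
    logAbsReal c⁻¹ = -logAbsReal c := by
  rw [logAbsReal, map_inv]
  rfl

variable {F E : Type*} [Field F] [Field E] [Algebra F E]

section

variable [Algebra.IsIntegral F E] [IsGlobalField F] [IsGlobalField E]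

/-- The natural map `C_F → C_E`. -/
noncomputable def baseChange (F E : Type*) [Field F] [Field E] [Algebra F E]
    [Algebra.IsIntegral F E] [IsGlobalField F] [IsGlobalField E] :
    IdeleClassGroup F →* IdeleClassGroup E :=
  QuotientGroup.map _ _ (Units.map (Adeles.baseChange F E : Adeles F →* Adeles E)) (by
    intro a ha
    obtain ⟨x, rfl⟩ := Ideles.eq_diag_of_mem_principal ha
    rw [Subgroup.mem_comap, Ideles.map_baseChange_diag]
    exact Ideles.diag_mem_principal _)

theorem baseChange_mk (a : Ideles F) : baseChange F E (mk a) =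
    mk (Units.map (Adeles.baseChange F E : Adeles F →* Adeles E) a) := rfl

theorem continuous_baseChange : Continuous (baseChange F E) :=
  Continuous.quotient_lift (continuous_mk.comp
    (Continuous.units_map _ (Adeles.continuous_baseChange F E))) _

theorem mem_normOneImage_iff {c : IdeleClassGroup E} : c ∈ normOneImage (algebraMap F E) ↔
    ∃ d : IdeleClassGroup F, logAbsReal d = 0 ∧ baseChange F E d = c := by
  constructor
  · rintro ⟨b, ⟨a, ha, hab⟩, rfl⟩
    refine ⟨mk a, logAbsReal_mk_eq_zero_iff.mpr ha, ?_⟩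
    rw [baseChange_mk]
    exact congrArg mk (Units.ext (Adeles.isImage_iff.mp hab).symm)
  · rintro ⟨d, hd, rfl⟩
    obtain ⟨a, rfl⟩ := mk_surjective d
    exact ⟨_, ⟨a, logAbsReal_mk_eq_zero_iff.mp hd, Adeles.isImage_iff.mpr rfl⟩, rfl⟩

theorem logAbsReal_baseChange_mul (c d : IdeleClassGroup F) :
    logAbsReal (baseChange F E (c * d)) =
      logAbsReal (baseChange F E c) + logAbsReal (baseChange F E d) := by
  rw [map_mul, logAbsReal_mul]

/-- The logarithm of the absolute value over `E` is a continuous homomorphism on the compact group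
of classes of absolute value one over `F`. This replaces the formula relating the two absolute
values. -/
theorem logAbsReal_baseChange_eq_zero {d : IdeleClassGroup F} (hd : logAbsReal d = 0) :
    logAbsReal (baseChange F E d) = 0 := by
  let S : Submonoid (IdeleClassGroup F) :=
    { carrier := {c | logAbsReal c = 0}
      one_mem' := by
        change logAbsReal (mk (1 : Ideles F)) = 0
        rw [logAbsReal_mk_eq_zero_iff, Ideles.absValue_one]
      mul_mem' := fun {a b} ha hb ↦ by
        rw [Set.mem_ofPred_eq] at *
        rw [logAbsReal_mul, ha, hb, add_zero] }
  exact eq_zero_of_isCompact_of_continuous (S := S) isCompact_logAbsReal_eq_zero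
    (continuous_logAbsReal.comp (continuous_baseChange (F := F) (E := E)))
    logAbsReal_baseChange_mul hd

/-- If `|d|_F < 1`, then `|d|_E < 1`. -/
theorem logAbsReal_baseChange_neg {d : IdeleClassGroup F} (hd : logAbsReal d < 0) :
    logAbsReal (baseChange F E d) < 0 := by
  obtain ⟨a, rfl⟩ := mk_surjective d
  obtain ⟨C, hC⟩ := HasProductFormula.exists_dominated (K := F)
  obtain ⟨w⟩ := HasProductFormula.nonempty_nonarchPlace (K := E)
  let v := NonarchPlace.under F w
  obtain ⟨π, hπ0, hπ⟩ := v.exists_uniformizer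
  have hπ1 : v.val π < 1 := by
    rw [hπ, ← WithZero.exp_zero]
    exact WithZero.exp_lt_exp.mpr (by norm_num)
  have hπ0' : algebraMap F v.Completion π ≠ 0 := by rwa [ne_eq, map_eq_zero]
  -- For large `n` the idele `a ^ (-n) * s` dominates some nonzero `x`. Then `a ^ n * x` is bounded
  -- by `s`, so it is integral everywhere and a non-unit at `v`; its image over `E` is a non-unit at
  -- `w`, so `a ^ n` has absolute value less than one over `E`.
  let s := Ideles.single v (algebraMap F v.Completion π) hπ0'
  have hlt : 1 < (Ideles.absValue a)⁻¹ := by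
    refine (one_lt_inv₀ (Ideles.absValue_pos a)).mpr ?_
    rwa [logAbsReal_mk, ← Real.log_one, Real.log_lt_log_iff (Ideles.absValue_pos a) one_pos] at hd
  obtain ⟨n, hn⟩ := pow_unbounded_of_one_lt (C / Ideles.absValue s) hlt
  rw [div_lt_iff₀ (Ideles.absValue_pos s)] at hn
  have habs : Ideles.absValue ((a ^ n)⁻¹ * s) = (Ideles.absValue a)⁻¹ ^ n * Ideles.absValue s := by
    rw [Ideles.absValue_mul, Ideles.absValue_inv, Ideles.absValue_pow, inv_pow]
  obtain ⟨x, hx0, hx, hx'⟩ := hC _ (hn.trans_eq habs.symm)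
  let y := Ideles.diag (Units.mk0 x hx0)
  have hi (v : InfinitePlace F) : ‖Adeles.infEval v (a ^ n * y).1‖ ≤ 1 := by
    have h1 := hx v
    rw [Units.val_mul, map_mul, Ideles.infEval_inv, Ideles.infEval_single, mul_one, norm_inv,
      le_inv_comm₀ (v.pos_iff.mpr hx0) (norm_pos_iff.mpr ((a ^ n).infEval_ne_zero v))] at h1
    have h2 : ‖Adeles.infEval v y.1‖ = v x :=
      InfinitePlace.Completion.norm_coe v (WithAbs.toAbs v.1 x)
    rw [Units.val_mul, map_mul, norm_mul, h2]
    exact (mul_le_mul_of_nonneg_right h1 (apply_nonneg v x)).trans_eq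
      (inv_mul_cancel₀ (v.pos_iff.mpr hx0).ne')
  have hv (u : NonarchPlace F) : Valued.v (Adeles.nonarchEval u (a ^ n * y).1) ≤
      Valued.v (Adeles.nonarchEval u s.1) := by
    have h1 := hx' u
    have h2 : Valued.v (Adeles.nonarchEval u y.1) = u.val x := u.valued_algebraMap x
    rw [Units.val_mul, map_mul, Ideles.nonarchEval_inv, map_mul, map_inv₀, ← h2] at h1
    rw [Units.val_mul, map_mul, map_mul]
    refine (mul_le_mul_right h1 _).trans_eq (mul_inv_cancel_left₀ ?_ _)
    exact (map_ne_zero _).mpr ((a ^ n).nonarchEval_ne_zero u)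
  have hs (u : NonarchPlace F) : Valued.v (Adeles.nonarchEval u s.1) ≤ 1 := by
    rcases eq_or_ne u v with rfl | h
    · rw [Ideles.nonarchEval_single, NonarchPlace.valued_algebraMap]
      exact hπ1.le
    · rw [Ideles.nonarchEval_single_of_ne v _ _ h, map_one]
  have hneg : logAbsReal (baseChange F E (mk (a ^ n * y))) < 0 := by
    rw [baseChange_mk, logAbsReal_mk]
    refine Real.log_neg (Ideles.absValue_pos _) (Ideles.absValue_lt_one (w := w) (fun u ↦ ?_)
      (fun u ↦ ?_) ?_)
    · refine le_trans (le_of_eq ?_) (hi (u.comap (algebraMap F E)))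
      exact (u.isometry_completionMapComap (algebraMap F E)).norm_map_of_map_zero (map_zero _) _
    · exact NonarchPlace.completionMap_mem_integers (algebraMap F E) (NonarchPlace.under F u) u rfl
        _ ((hv _).trans (hs _))
    · refine NonarchPlace.valued_completionMap_lt_one (algebraMap F E)
        (v := NonarchPlace.under F w) (w := w) rfl ((hv _).trans_lt ?_)
      rw [Ideles.nonarchEval_single, NonarchPlace.valued_algebraMap]
      exact hπ1
  have h1 : mk (a ^ n * y) = mk a ^ n := by
    rw [map_mul, mk_eq_one_iff.mpr (Ideles.diag_mem_principal _), mul_one, map_pow]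
  rw [h1, map_pow, logAbsReal_pow] at hneg
  exact neg_of_mul_neg_right hneg (Nat.cast_nonneg n)

theorem logAbsReal_baseChange_eq_zero_iff {d : IdeleClassGroup F} :
    logAbsReal (baseChange F E d) = 0 ↔ logAbsReal d = 0 := by
  refine ⟨fun h ↦ ?_, logAbsReal_baseChange_eq_zero⟩
  rcases lt_trichotomy (logAbsReal d) 0 with h1 | h1 | h1
  · exact absurd h (logAbsReal_baseChange_neg h1).ne
  · exact h1
  · have h2 := logAbsReal_baseChange_neg (E := E) (d := d⁻¹) (by rw [logAbsReal_inv]; linarith)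
    rw [map_inv, logAbsReal_inv] at h2
    linarith

end

theorem mem_normOneImage_iff_of_galois_invariant [FiniteDimensional F E] [IsGalois F E]
    [IsGlobalField F] [IsGlobalField E] {c : IdeleClassGroup E}
    (hc : ∀ γ, galoisAct F E γ c = c) :
    c ∈ normOneImage (algebraMap F E) ↔ logAbsReal c = 0 := by
  rw [mem_normOneImage_iff]
  constructor
  · rintro ⟨d, hd, rfl⟩
    exact logAbsReal_baseChange_eq_zero hd
  · intro h
    obtain ⟨a, b, rfl, hab⟩ := exists_isImage_of_galois_invariant hc
    have h1 : baseChange F E (mk a) = mk b := by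
      rw [baseChange_mk]
      exact congrArg mk (Units.ext (Adeles.isImage_iff.mp hab).symm)
    refine ⟨mk a, ?_, h1⟩
    rw [← logAbsReal_baseChange_eq_zero_iff (E := E), h1, h]

end IdeleClassGroup


/-! ## Values of the idelic absolute value -/

theorem NonarchPlace.exists_q_eq_pow (p : ℕ) [hp : Fact p.Prime] {K : Type*} [Field K]
    [Algebra (ZMod p) K] (v : NonarchPlace K) : ∃ n : ℕ, v.q = p ^ n := by
  have := Fintype.ofFinite (IsLocalRing.ResidueField v.ring)
  obtain ⟨n, -, hn⟩ := FiniteField.card (IsLocalRing.ResidueField v.ring)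
    (ringChar (IsLocalRing.ResidueField v.ring))
  have h1 : (p : v.ring) = 0 := by
    ext
    rw [ZeroMemClass.coe_zero, SubringClass.coe_natCast, ← map_natCast (algebraMap (ZMod p) K),
      CharP.cast_eq_zero, map_zero]
  have h2 : (p : IsLocalRing.ResidueField v.ring) = 0 := by
    rw [← map_natCast (IsLocalRing.residue v.ring), h1, map_zero]
  have h3 := (Nat.dvd_prime hp.out).mp (ringChar.dvd h2)
  have h4 := h3.resolve_left (CharP.ringChar_ne_one)
  exact ⟨n, by rw [q, Nat.card_eq_fintype_card, hn, h4]⟩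

namespace IdeleClassGroup

/-- All residue fields have order a power of `p` and there are no infinite places. So an
integer-valued `v` is available for the discrete criterion. -/
theorem exists_logAbsReal_eq (p : ℕ) [hp : Fact p.Prime] {K : Type*} [Field K] [IsGlobalField K]
    [Algebra (ZMod p) K] (c : IdeleClassGroup K) : ∃ n : ℤ, logAbsReal c = n * Real.log p := by
  obtain ⟨a, rfl⟩ := mk_surjective c
  have := IsFunctionField.isEmpty_infinitePlace p K
  let M : Submonoid ℝ :=
    { carrier := {x | ∃ n : ℤ, x = (p : ℝ) ^ n}
      one_mem' := ⟨0, by simp⟩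
      mul_mem' := by
        rintro _ _ ⟨m, rfl⟩ ⟨n, rfl⟩
        exact ⟨m + n, (zpow_add₀ (Nat.cast_ne_zero.mpr hp.out.ne_zero) m n).symm⟩ }
  have hM : Ideles.absValue a ∈ M := by
    rw [Ideles.absValue, finprod_of_isEmpty, one_mul]
    refine finprod_induction (· ∈ M) (one_mem M) (fun _ _ ↦ mul_mem) fun v ↦ ?_
    obtain ⟨n, hn⟩ := v.exists_q_eq_pow p
    rw [v.normAbs_eq_zpow (a.nonarchEval_ne_zero v), hn]
    exact ⟨n * WithZero.log (Valued.v (Adeles.nonarchEval v a.1)), by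
      rw [zpow_mul, zpow_natCast, Nat.cast_pow]⟩
  obtain ⟨n, hn⟩ := hM
  exact ⟨n, by rw [logAbsReal_mk, hn, Real.log_zpow]⟩

end IdeleClassGroup

namespace NumberField.InfinitePlace

variable {K : Type*} [Field K]

theorem exists_isometry_real (v : InfinitePlace K) : ∃ ρ : ℝ →+* v.Completion, Isometry ρ := by
  rcases v.isReal_or_isComplex with hv | hv
  · exact ⟨(Completion.ringEquivRealOfIsReal hv).symm.toRingHom,
      (Completion.isometryEquivRealOfIsReal hv).symm.isometry⟩
  · exact ⟨(Completion.ringEquivComplexOfIsComplex hv).symm.toRingHom.comp Complex.ofRealHom,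
      (Completion.isometryEquivComplexOfIsComplex hv).symm.isometry.comp Complex.isometry_ofReal⟩

/-- The embedding of `ℝ` in the completion at an infinite place. -/
noncomputable def ofReal (v : InfinitePlace K) : ℝ →+* v.Completion :=
  v.exists_isometry_real.choose

theorem isometry_ofReal (v : InfinitePlace K) : Isometry v.ofReal :=
  v.exists_isometry_real.choose_spec

theorem norm_ofReal (v : InfinitePlace K) (x : ℝ) : ‖v.ofReal x‖ = |x| :=
  v.isometry_ofReal.norm_map_of_map_zero (map_zero _) x

/-- Both sides are continuous in `x` and agree on `ℚ`, so the arbitrary choices in `ofReal` are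
compatible. This makes the section `infExp` Galois-invariant. -/
theorem completionMapComap_ofReal {L : Type*} [Field L] (f : K →+* L) (w : InfinitePlace L)
    (x : ℝ) : w.completionMapComap f ((w.comap f).ofReal x) = w.ofReal x := by
  refine congrFun (Continuous.ext_on (Rat.denseRange_cast (𝕜 := ℝ))
    ((w.isometry_completionMapComap f).comp (w.comap f).isometry_ofReal).continuous
    w.isometry_ofReal.continuous ?_) x
  rintro _ ⟨q, rfl⟩
  have h := congrArg (fun g : ℚ →+* w.Completion ↦ g q) (Subsingleton.elim
    (((w.completionMapComap f).comp (w.comap f).ofReal).comp (algebraMap ℚ ℝ))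
    (w.ofReal.comp (algebraMap ℚ ℝ)))
  exact h

end NumberField.InfinitePlace

namespace Ideles

variable {K : Type*} [Field K]

/-- The idele with components `exp r` at the infinite places and `1` at the others. -/
noncomputable def infExp (K : Type*) [Field K] (r : ℝ) : Ideles K :=
  mk (fun v ↦ v.ofReal (Real.exp r)) 1
    (fun v ↦ (map_ne_zero v.ofReal).mpr (Real.exp_pos r).ne') (fun v ↦ one_ne_zero)
    (by simp)

theorem infExp_add (r s : ℝ) : infExp K (r + s) = infExp K r * infExp K s := by
  refine Ideles.ext (fun v ↦ ?_) fun v ↦ ?_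
  · rw [Units.val_mul, map_mul, infExp, infExp, infExp, infEval_mk, infEval_mk, infEval_mk,
      Real.exp_add, map_mul]
  · rw [Units.val_mul, map_mul, infExp, infExp, infExp, nonarchEval_mk, nonarchEval_mk,
      nonarchEval_mk, Pi.one_apply, mul_one]

theorem continuous_infExp : Continuous (infExp K) := by
  have h : Continuous fun r ↦ (infExp K r).1 := by
    let φ : ℝ → InfiniteAdeleRing K := fun r v ↦ v.ofReal (Real.exp r)
    let c : NonarchAdeles K := ⟨1, by simp⟩
    have hφ : Continuous φ :=
      continuous_pi fun v ↦ v.isometry_ofReal.continuous.comp Real.continuous_exp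
    exact hφ.prodMk (continuous_const (y := c))
  refine Units.continuous_iff.mpr ⟨h, ?_⟩
  have h1 (r : ℝ) : (infExp K r)⁻¹ = infExp K (-r) := by
    rw [inv_eq_iff_mul_eq_one, ← infExp_add, add_neg_cancel]
    refine Ideles.ext (fun v ↦ ?_) fun v ↦ ?_
    · simp [infExp]
    · simp [infExp]
  exact (h.comp continuous_neg).congr fun r ↦ congrArg Units.val (h1 r).symm

theorem map_mapEquiv_infExp {L : Type*} [Field L] (σ : K ≃+* L) (r : ℝ) :
    Units.map (Adeles.mapEquiv σ : Adeles K →* Adeles L) (infExp K r) = infExp L r :=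
  Ideles.ext (fun w ↦ w.completionMapComap_ofReal (σ : K →+* L) (Real.exp r)) fun w ↦
    map_one (NonarchPlace.completionMap (σ : K →+* L) (NonarchPlace.comapEquiv σ w) w rfl)

theorem absValue_infExp [NumberField K] (r : ℝ) :
    absValue (infExp K r) = Real.exp (r * Module.finrank ℚ K) := by
  have h (v : NonarchPlace K) : (v.normAbs (Adeles.nonarchEval v (infExp K r).1) : ℝ) = 1 := by
    rw [infExp, nonarchEval_mk, Pi.one_apply, map_one, NNReal.coe_one]
  rw [absValue, finprod_congr h, finprod_one, mul_one, finprod_eq_prod_of_fintype]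
  simp only [infExp, infEval_mk, InfinitePlace.norm_ofReal, Real.abs_exp]
  rw [Finset.prod_pow_eq_pow_sum, InfinitePlace.sum_mult_eq, ← Real.exp_nat_mul, mul_comm]

end Ideles


/-! ## Tori over global fields -/

section

variable (F E X : Type*) [Field F] [IsGlobalField F] [Field E] [Algebra F E]
  [FiniteDimensional F E] [IsGalois F E] [AddCommGroup X] [DistribMulAction (E ≃ₐ[F] E) X]

theorem UnramifiedIsIdentityComponent.torus_of_numberField [NumberField E] [IsGlobalField E] :
    UnramifiedIsIdentityComponent (T := torusPoints X (IdeleClassGroup.galoisAct F E))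
      (torusNormOne X (IdeleClassGroup.galoisAct F E)
        (IdeleClassGroup.normOneImage (algebraMap F E))) := by
  -- The local degrees at the infinite places add up to `n`, so `infExp E r` has absolute value `exp
  -- (r * n)`; dividing by `n` gives a section.
  let n : ℝ := Module.finrank ℚ E
  have hn : n ≠ 0 := Nat.cast_ne_zero.mpr Module.finrank_pos.ne'
  refine torus_of_real_section (v := IdeleClassGroup.logAbsReal)
    (s := fun r ↦ IdeleClassGroup.mk (Ideles.infExp E (r / n)))
    IdeleClassGroup.continuous_logAbsReal IdeleClassGroup.logAbsReal_mul
    IdeleClassGroup.isCompact_logAbsReal_eq_zero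
    (fun γ ↦ IdeleClassGroup.continuous_mapEquiv (γ : E ≃+* E))
    (IdeleClassGroup.continuous_mk.comp
      (Ideles.continuous_infExp.comp (continuous_id.div_const n))) (fun a b ↦ ?_) (fun r ↦ ?_)
    (fun γ r ↦ ?_) fun c hc ↦ IdeleClassGroup.mem_normOneImage_iff_of_galois_invariant hc
  · rw [add_div, Ideles.infExp_add, map_mul]
  · rw [IdeleClassGroup.logAbsReal_mk, Ideles.absValue_infExp, Real.log_exp, div_mul_cancel₀ _ hn]
  · exact congrArg IdeleClassGroup.mk (Ideles.map_mapEquiv_infExp (γ : E ≃+* E) (r / n))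

omit [IsGlobalField F] [IsGalois F E] in
-- Take an idele of `F` that is a uniformizer at the place below `w` and `1` elsewhere. Over `E` it
-- is integral everywhere and a non-unit at all places above that place, which the Galois group
-- permutes. So all conjugates have absolute value less than one.
theorem IdeleClassGroup.exists_logAbsReal_galoisAct_neg [IsGlobalField E] :
    ∃ c : IdeleClassGroup E, logAbsReal c < 0 ∧
      ∀ γ, logAbsReal (galoisAct F E γ c) < 0 := by
  obtain ⟨w⟩ := HasProductFormula.nonempty_nonarchPlace (K := E)
  let v := NonarchPlace.under F w
  obtain ⟨π, hπ0, hπ⟩ := v.exists_uniformizer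
  have hπ1 : v.val π < 1 := by
    rw [hπ, ← WithZero.exp_zero]
    exact WithZero.exp_lt_exp.mpr (by norm_num)
  have hπ0' : algebraMap F v.Completion π ≠ 0 := by rwa [ne_eq, map_eq_zero]
  let s := Ideles.single v (algebraMap F v.Completion π) hπ0'
  let b : Ideles E := Units.map (Adeles.baseChange F E : Adeles F →* Adeles E) s
  have hs (u : NonarchPlace F) : Valued.v (Adeles.nonarchEval u s.1) ≤ 1 := by
    rcases eq_or_ne u v with rfl | h
    · rw [Ideles.nonarchEval_single, NonarchPlace.valued_algebraMap]
      exact hπ1.le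
    · rw [Ideles.nonarchEval_single_of_ne v _ _ h, map_one]
  have hs' (u : NonarchPlace F) (hu : u = v) : Valued.v (Adeles.nonarchEval u s.1) < 1 := by
    rw [hu, Ideles.nonarchEval_single, NonarchPlace.valued_algebraMap]
    exact hπ1
  have hbi (u : InfinitePlace E) : Adeles.infEval u b.1 = 1 :=
    map_one (u.completionMapComap (algebraMap F E))
  have hb (u : NonarchPlace E) : Valued.v (Adeles.nonarchEval u b.1) ≤ 1 :=
    NonarchPlace.completionMap_mem_integers (algebraMap F E) (NonarchPlace.under F u) u rfl
      _ (hs _)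
  have hb' (u : NonarchPlace E) (hu : NonarchPlace.under F u = v) :
      Valued.v (Adeles.nonarchEval u b.1) < 1 := by
    refine NonarchPlace.valued_completionMap_lt_one (algebraMap F E)
      (v := NonarchPlace.under F u) (w := u) rfl ?_
    exact hs' _ hu
  refine ⟨mk b, ?_, fun γ ↦ ?_⟩
  · rw [logAbsReal_mk]
    refine Real.log_neg (Ideles.absValue_pos _) (Ideles.absValue_lt_one (w := w) (fun u ↦ ?_)
      hb (hb' w rfl))
    rw [hbi, norm_one]
  · refine Real.log_neg (Ideles.absValue_pos _) (Ideles.absValue_lt_one (w := w) (fun u ↦ ?_)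
      (fun u ↦ ?_) ?_)
    · rw [Units.coe_map, MonoidHom.coe_coe, Adeles.infEval_mapEquiv, hbi, map_one, norm_one]
    · exact NonarchPlace.completionMap_mem_integers ((γ : E ≃+* E) : E →+* E)
        (NonarchPlace.comapEquiv (γ : E ≃+* E) u) u rfl _ (hb _)
    · refine NonarchPlace.valued_completionMap_lt_one ((γ : E ≃+* E) : E →+* E)
        (v := NonarchPlace.comapEquiv (γ : E ≃+* E) w) (w := w) rfl (hb' _ ?_)
      refine NonarchPlace.ext ?_
      change (w.ring.comap _).comap _ = w.ring.comap _
      rw [ValuationSubring.comap_comap]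
      congr 1
      ext x
      exact γ.commutes x

/-- The valuation `v` is the logarithm of the absolute value to base `p`; it need not be onto `ℤ`.
-/
theorem UnramifiedIsIdentityComponent.torus_of_functionField (p : ℕ) [hp : Fact p.Prime]
    [Algebra (ZMod p) E] [IsGlobalField E] [Module.Free ℤ X] [Module.Finite ℤ X] :
    UnramifiedIsIdentityComponent (T := torusPoints X (IdeleClassGroup.galoisAct F E))
      (torusNormOne X (IdeleClassGroup.galoisAct F E)
        (IdeleClassGroup.normOneImage (algebraMap F E))) := by
  choose v hv using IdeleClassGroup.exists_logAbsReal_eq p (K := E)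
  have hlog : 0 < Real.log p := Real.log_pos (by exact_mod_cast hp.out.one_lt)
  have hzero (c : IdeleClassGroup E) : v c = 0 ↔ IdeleClassGroup.logAbsReal c = 0 := by
    rw [hv, mul_eq_zero, Int.cast_eq_zero, or_iff_left hlog.ne']
  have hneg (c : IdeleClassGroup E) : v c < 0 ↔ IdeleClassGroup.logAbsReal c < 0 := by
    rw [hv]
    refine ⟨fun h ↦ mul_neg_of_neg_of_pos (by exact_mod_cast h) hlog, fun h ↦ ?_⟩
    exact_mod_cast neg_of_mul_neg_left h hlog.le
  obtain ⟨c, hc, hcγ⟩ := IdeleClassGroup.exists_logAbsReal_galoisAct_neg F E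
  refine torus_of_discrete (v := v) ?_ (fun a b ↦ ?_) ?_
    (fun γ ↦ IdeleClassGroup.continuous_mapEquiv (γ : E ≃+* E))
    (Or.inr ⟨c, (hneg c).mpr hc, fun γ ↦ (hneg _).mpr (hcγ γ)⟩) fun c hc ↦ ?_
  · rw [Int.isClosedEmbedding_coe_real.isInducing.continuous_iff]
    refine (IdeleClassGroup.continuous_logAbsReal.div_const (Real.log p)).congr fun c ↦ ?_
    rw [hv, mul_div_cancel_right₀ _ hlog.ne']
    rfl
  · have h := IdeleClassGroup.logAbsReal_mul a b
    rw [hv, hv, hv, ← add_mul] at h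
    exact_mod_cast mul_right_cancel₀ hlog.ne' h
  · simp only [hzero]
    exact IdeleClassGroup.isCompact_logAbsReal_eq_zero
  · rw [hzero]
    exact IdeleClassGroup.mem_normOneImage_iff_of_galois_invariant hc

theorem UnramifiedIsIdentityComponent.torus_of_isGlobalField [Module.Free ℤ X]
    [Module.Finite ℤ X] :
    UnramifiedIsIdentityComponent (T := torusPoints X (IdeleClassGroup.galoisAct F E))
      (torusNormOne X (IdeleClassGroup.galoisAct F E)
        (IdeleClassGroup.normOneImage (algebraMap F E))) := by
  rcases IsGlobalField.out (K := F) with h | ⟨p, hp, halg, hfin⟩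
  · have : NumberField E := NumberField.of_module_finite F E
    have : IsGlobalField E := ⟨Or.inl this⟩
    exact torus_of_numberField F E X
  · let : Algebra (RatFunc (ZMod p)) E :=
      ((algebraMap F E).comp (algebraMap (RatFunc (ZMod p)) F)).toAlgebra
    have : IsScalarTower (RatFunc (ZMod p)) F E := .of_algebraMap_eq fun _ ↦ rfl
    have : FiniteDimensional (RatFunc (ZMod p)) E := FiniteDimensional.trans _ F E
    have : IsGlobalField E := ⟨Or.inr ⟨p, hp, inferInstance, inferInstance⟩⟩
    let : Algebra (ZMod p) E := ((algebraMap (RatFunc (ZMod p)) E).comp (algebraMap _ _)).toAlgebra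
    exact torus_of_functionField F E X p

end

theorem mainTheorem9 :
    -- `F` is a non-Archimedean local field
    (∀ (F : Type*) [Field F] [ValuativeRel F] [TopologicalSpace F] [IsNonarchimedeanLocalField F]
      (E : Type*) [Field E] [ValuativeRel E] [TopologicalSpace E] [IsNonarchimedeanLocalField E]
      [Algebra F E] [FiniteDimensional F E] [IsGalois F E] (_ : Continuous (algebraMap F E))
      (X : Type*) [AddCommGroup X] [Module.Free ℤ X] [Module.Finite ℤ X]
      [DistribMulAction (E ≃ₐ[F] E) X],
      UnramifiedIsIdentityComponent (T := torusPoints X (localGaloisAct F E))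
        (torusNormOne X (localGaloisAct F E) (localNormOneImage E (nonarchLocalAbs F)))) ∧
    -- `F` is an Archimedean local field
    (∀ (F : Type*) [RCLike F] (E : Type*) [RCLike E]
      [Algebra F E] [FiniteDimensional F E] [IsGalois F E] (_ : Continuous (algebraMap F E))
      (X : Type*) [AddCommGroup X] [Module.Free ℤ X] [Module.Finite ℤ X]
      [DistribMulAction (E ≃ₐ[F] E) X],
      UnramifiedIsIdentityComponent (T := torusPoints X (localGaloisAct F E))
        (torusNormOne X (localGaloisAct F E) (localNormOneImage E (archLocalAbs F)))) ∧
    -- `F` is a global field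
    (∀ (F : Type*) [Field F] [IsGlobalField F] (E : Type*) [Field E]
      [Algebra F E] [FiniteDimensional F E] [IsGalois F E]
      (X : Type*) [AddCommGroup X] [Module.Free ℤ X] [Module.Finite ℤ X]
      [DistribMulAction (E ≃ₐ[F] E) X],
      UnramifiedIsIdentityComponent (T := torusPoints X (IdeleClassGroup.galoisAct F E))
        (torusNormOne X (IdeleClassGroup.galoisAct F E)
          (IdeleClassGroup.normOneImage (algebraMap F E)))) := by
  refine ⟨?_, ?_, ?_⟩
  · intro F _ _ _ _ E _ _ _ _ _ _ _ hcont X _ _ _ _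
    exact .torus_of_isNonarchimedeanLocalField F E hcont X
  · intro F _ E _ _ _ _ hcont X _ _ _ _
    exact .torus_of_rclike F E hcont X
  · intro F _ _ E _ _ _ _ X _ _ _ _
    exact .torus_of_isGlobalField F E X
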